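/- **Vertex weights.** For complex $x,y,r,s$ with $r,s\neq0$, consider vertices $(i_1,j_1;i_2,j_2)$, where $i_1,j_1,i_2,j_2\in\{0,1\}$ are the states of the bottom, left, top and right edges. Let $$W(0,0;0,0)=1,\quad W(1,1;1,1)=\frac{r^{-2}x-y}{s^{-2}y-x},\quad W(1,0;1,0)=\frac{s^{-2}y-r^{-2}x}{s^{-2}y-x},$$ $$W(0,1;0,1)=\frac{y-x}{s^{-2}y-x},\quad W(1,0;0,1)=\frac{x(r^{-2}-1)}{s^{-2}y-x},\quad W(0,1;1,0)=\frac{y(s^{-2}-1)}{s^{-2}y-x},$$ let $W=0$ whenever $i_1+j_1\ne i_2+j_2$, and let $\widehat W$ be obtained from these weights by replacing each $W$ with $W\cdot\frac{s^{-2}y-x}{y-x}$; explicitly, $\widehat W(0,1;0,1)=1$, $\widehat W(0,0;0,0)=\frac{s^{-2}y-x}{y-x}$, and the other four weights have the same numerators as for $W$ and the denominator $y-x$. **Partition functions.** A signature $\lambda=(\lambda_1\ge\dots\ge\lambda_n\ge0)$ with $n$ parts (integers) defines the $n$-point set $\mathcal S(\lambda)=\{\lambda_1+n,\lambda_2+n-1,\dots,\lambda_n+1\}\subset\mathbb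 Z_{\ge1}$. For $\mathbf x=(x_1,\dots,x_k)$, $\mathbf r=(r_1,\dots,r_k)$, $\mathbf y=(y_1,y_2,\dots)$, $\mathbf s=(s_1,s_2,\dots)$, consider six vertex configurations (edges in states $0,1$, with $i_1+j_1=i_2+j_2$ at each vertex) in the strip $\mathbb Z_{\ge1}\times\{1,\dots,k\}$ with empty left boundary; the weight of a configuration is the product of its vertex weights, the vertex in column $i$ and row $j$ having the parameters $x_j,y_i,r_j,s_i$. * $G_{\lambda/\mu}(\mathbf x;\mathbf y;\mathbf r;\mathbf s)$ is the sum of the weights, with vertex weights $W$, of all configurations in which paths enter from the bottom exactly at $\mathcal S(\mu)$, exit at the top exactly at $\mathcal S(\lambda)$, and the horizontal edges far to the right are empty. $G_\lambda=G_{\lambda/(0,\dots,0)}$, with as many zeros as $\lambda$ has parts. * $F_{\lambda/\mu}(\mathbf x;\mathbf y;\mathbf r;\mathbf s)$ is the sum of the weights, with vertex weights $\widehat W$, of all configurations in which paths enter from the bottom exactly at $\mathcal S(\lambda)$, exit at the top exactly at $\mathcal S(\mu)$, and the horizontal edges far to the right are occupied in every row. $F_\lambda=F_{\lambda/\varnothing}$.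 These functions are defined for all pairs of signatures, and are $0$ when there are no such configurations. All sums are finite and all but finitely many factors of each product are $1$. **Theorem.** Let $M,N\ge1$, and let $\mathbf x=(x_1,\dots,x_M)$, $\mathbf r=(r_1,\dots,r_M)$, $\mathbf w=(w_1,\dots,w_N)$, $\boldsymbol\theta=(\theta_1,\dots,\theta_N)$, $\mathbf y=(y_1,y_2,\dots)$, $\mathbf s=(s_1,s_2,\dots)$ be complex, with $r_i,\theta_j,s_k\ne0$, $y_k\neq x_i$ and $y_k\ne s_k^2w_j$ for all $i,j,k$. Assume that there is $\delta>0$ with $$\left|\frac{y_k-s_k^2x_i}{y_k-x_i}\cdot\frac{y_k-w_j}{y_k-s_k^2w_j}\right|<1-\delta\qquad\text{for all }1\le i\le M,\ 1\le j\le N,\ k\ge1.$$ Assume moreover that $\inf_k|y_k-x_i|>0$ for all $i$ if $M\ge2$, and that $\inf_k|s_k^{-2}y_k-w_j|>0$ for all $j$ if $N\geq 2$. 1. (Skew Cauchy identity) For all signatures $\lambda,\mu$ (with any numbers of parts, possibly zero), $$\sum_{\nu}G_{\nu/\lambda}(\mathbf w;\mathbf y;\boldsymbol\theta;\mathbf s)\,F_{\nu/\mu}(\mathbf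 x;\mathbf y;\mathbf r;\mathbf s)=\prod_{i=1}^M\prod_{j=1}^N\frac{x_i-\theta_j^{-2}w_j}{x_i-w_j}\ \sum_{\varkappa}G_{\mu/\varkappa}(\mathbf w;\mathbf y;\boldsymbol\theta;\mathbf s)\,F_{\lambda/\varkappa}(\mathbf x;\mathbf y;\mathbf r;\mathbf s),$$ where $\nu$ and $\varkappa$ range over all signatures; the left side converges unconditionally and the right side has finitely many nonzero terms. 2. (Cauchy identity) $$\sum_{\nu}G_{\nu}(\mathbf w;\mathbf y;\boldsymbol\theta;\mathbf s)\,F_{\nu}(\mathbf x;\mathbf y;\mathbf r;\mathbf s)=\prod_{i=1}^{M}x_i(r_i^{-2}-1)\cdot\frac{\prod_{1\le i<j\le M}(r_i^{-2}x_i-x_j)(s_i^{-2}y_i-y_j)}{\prod_{i,j=1}^M(y_i-x_j)}\cdot\prod_{i=1}^{M}\prod_{j=1}^{N}\frac{x_i-\theta_j^{-2}w_j}{x_i-w_j},$$ where $\nu$ ranges over all signatures with $M$ parts and the series converges unconditionally. -/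

import Mathlib

open Filter

namespace FreeFermionSixVertex

/-- The vertex weights `W(i₁, j₁; i₂, j₂ | x; y; r; s)` normalized so that the empty vertex has
weight `1`. The arguments `i₁ j₁ i₂ j₂` are the states (occupied = `true`) of the bottom, left, top
and right edge. Vertices that do not preserve the number of paths have weight `0`. -/
noncomputable def W (x y r s : ℂ) : Bool → Bool → Bool → Bool → ℂ
  | false, false, false, false => 1
  | true, true, true, true => (r ^ (-2 : ℤ) * x - y) / (s ^ (-2 : ℤ) * y - x)
  | true, false, true, false => (s ^ (-2 : ℤ) * y - r ^ (-2 : ℤ) * x) / (s ^ (-2 : ℤ) * y - x)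
  | false, true, false, true => (y - x) / (s ^ (-2 : ℤ) * y - x)
  | true, false, false, true => x * (r ^ (-2 : ℤ) - 1) / (s ^ (-2 : ℤ) * y - x)
  | false, true, true, false => y * (s ^ (-2 : ℤ) - 1) / (s ^ (-2 : ℤ) * y - x)
  | _, _, _, _ => 0

/-- The vertex weights `Ŵ(i₁, j₁; i₂, j₂ | x; y; r; s)` normalized so that the vertex
`(0, 1; 0, 1)` has weight `1`. -/
noncomputable def WHat (x y r s : ℂ) : Bool → Bool → Bool → Bool → ℂ
  | false, false, false, false => (s ^ (-2 : ℤ) * y - x) / (y - x)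
  | true, true, true, true => (r ^ (-2 : ℤ) * x - y) / (y - x)
  | true, false, true, false => (s ^ (-2 : ℤ) * y - r ^ (-2 : ℤ) * x) / (y - x)
  | false, true, false, true => 1
  | true, false, false, true => x * (r ^ (-2 : ℤ) - 1) / (y - x)
  | false, true, true, false => y * (s ^ (-2 : ℤ) - 1) / (y - x)
  | _, _, _, _ => 0

/-- Nonnegative signatures `λ = (λ₁ ≥ ... ≥ λₙ ≥ 0)` with `n` parts. -/
abbrev Signature (n : ℕ) : Type := {l : Fin n → ℕ // Antitone l}

/-- The signature `(0, ..., 0)` with `n` parts (for `n = 0` this is the empty signature). -/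
def Signature.zero (n : ℕ) : Signature n := ⟨fun _ => 0, fun _ _ _ => le_rfl⟩

/-- The point configuration `𝒮(λ) = {λ₁ + n, λ₂ + n - 1, ..., λₙ + 1}`. The columns `1, 2, 3, ...`
of the half-infinite strip are numbered `0, 1, 2, ...` here, so that every point is shifted
by one; likewise `y 0, y 1, ...` and `s 0, s 1, ...` stand for `y₁, y₂, ...` and `s₁, s₂, ...`. -/
def Signature.points {n : ℕ} (l : Signature n) : Set ℕ :=
  Set.range fun i : Fin n => l.1 i + (i.rev : ℕ)

/-- A six vertex (up-right path) configuration in the half-infinite strip with `k` rows: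
`vert j i` is the state of the vertical edge in column `i` just below row `j` (`j = k`: above the
top row), and `horiz j i` is the state of the horizontal edge in row `j` just to the left of
column `i`. At every vertex as many paths come in as go out. -/
structure Config (k : ℕ) where
  vert : Fin (k + 1) → ℕ → Bool
  horiz : Fin k → ℕ → Bool
  conserve : ∀ (j : Fin k) (i : ℕ),
    (vert j.castSucc i).toNat + (horiz j i).toNat =
      (vert j.succ i).toNat + (horiz j (i + 1)).toNat

/-- Boundary conditions: paths enter at the bottom exactly at the points of `A` and exit at the top
exactly at the points of `B`, the left boundary is empty, and far to the right all horizontal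
edges have the state `e`. -/
def Config.HasBoundary {k : ℕ} (c : Config k) (A B : Set ℕ) (e : Bool) : Prop :=
  (∀ i, c.vert 0 i = true ↔ i ∈ A) ∧ (∀ i, c.vert (Fin.last k) i = true ↔ i ∈ B) ∧
    (∀ j, c.horiz j 0 = false) ∧ ∀ j, ∀ᶠ i in atTop, c.horiz j i = e

/-- The weight of a configuration: the product of the weights of all vertices, where the weight of
the vertex in row `j` and column `i` is `w (x j) (y i) (r j) (s i)`. -/
noncomputable def Config.weight (w : ℂ → ℂ → ℂ → ℂ → Bool → Bool → Bool → Bool → ℂ) {k : ℕ}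
    (c : Config k) (x : Fin k → ℂ) (y : ℕ → ℂ) (r : Fin k → ℂ) (s : ℕ → ℂ) : ℂ :=
  ∏ j : Fin k, ∏ᶠ i : ℕ, w (x j) (y i) (r j) (s i)
    (c.vert j.castSucc i) (c.horiz j i) (c.vert j.succ i) (c.horiz j (i + 1))

/-- The partition function `G_{λ/μ}(x; y; r; s)` for signatures with any numbers of parts: the sum
of the weights of the (finitely many) configurations with paths entering at `𝒮(μ)`, exiting at
`𝒮(λ)`, and empty right boundary. -/
noncomputable def skewG {k m n : ℕ} (lam : Signature m) (mu : Signature n)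
    (x : Fin k → ℂ) (y : ℕ → ℂ) (r : Fin k → ℂ) (s : ℕ → ℂ) : ℂ :=
  ∑ᶠ c ∈ {c : Config k | c.HasBoundary mu.points lam.points false}, c.weight W x y r s

/-- The partition function `F_{λ/μ}(x; y; r; s)` for signatures with any numbers of parts: the sum
of the weights of the (finitely many) configurations with paths entering at `𝒮(λ)`, exiting at
`𝒮(μ)`, and one path leaving far to the right in each row. -/
noncomputable def skewF {k m n : ℕ} (lam : Signature m) (mu : Signature n)
    (x : Fin k → ℂ) (y : ℕ → ℂ) (r : Fin k → ℂ) (s : ℕ → ℂ) : ℂ :=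
  ∑ᶠ c ∈ {c : Config k | c.HasBoundary lam.points mu.points true}, c.weight WHat x y r s

/-- `G_λ = G_{λ/(0,...,0)}`, with as many zeros as `λ` has parts. -/
noncomputable def G {k m : ℕ} (lam : Signature m)
    (x : Fin k → ℂ) (y : ℕ → ℂ) (r : Fin k → ℂ) (s : ℕ → ℂ) : ℂ :=
  skewG lam (Signature.zero m) x y r s

/-- `F_λ = F_{λ/∅}`, for a signature with as many parts as there are variables. -/
noncomputable def F {k : ℕ} (lam : Signature k)
    (x : Fin k → ℂ) (y : ℕ → ℂ) (r : Fin k → ℂ) (s : ℕ → ℂ) : ℂ :=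
  skewF lam (Signature.zero 0) x y r s

end FreeFermionSixVertex

/-! Stack the `N` rows with weights `W` (empty far to the right) below the `M` rows with weights
`WHat` (occupied far to the right). Cutting along the line between the two blocks shows that the
left side of the skew Cauchy identity is the partition function of this stack, `K` columns wide, as
`K → ∞`. With the blocks interchanged the same cut gives the finite sum on the right
(`strip_append`). All weights are column normalizations of the differences in `vertex`, and these
satisfy a Yang–Baxter equation whose cross does not depend on the column. Sliding a cross through a
strip exchanges two adjacent rows (`strip_exchange`). For a row `w_j` below a row `x_i`, the cross
contributes `x_i - θ_j⁻² w_j` at the empty left boundary, and at the right end it turns the state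
(empty, full) into (full, empty) with weight `x_i - w_j`. The quotients of these numbers form the
Cauchy product.

The obstacle is at the right end: the cross also maps (full, empty) to itself, and this contribution
must vanish in the limit. To the right of all boundary points a column has empty bottom and top
edges, so paths can only move to higher rows: the column transfer matrix is triangular with respect
to `height`. Its diagonal entries are bounded through products of the ratios in the hypothesis,
hence by some `ρ < 1`, except at the highest state with `M` paths, which is the desired one. If the
off-diagonal entries are uniformly bounded (`Admissible.exists_col_le`; the hypotheses on distances
enter here), all other states have summable partition functions and the desired one stays bounded
(`summable_of_triangular`). Run with absolute values, this also gives unconditional convergence.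
After an exchange, states above the new ground state no longer need to decay, so the induction over
exchanges only controls the lower ones (`LowLimit`).

For the Cauchy identity take `λ = (0, ..., 0)` with `M` parts and `μ = ∅`. Only `ϰ = ∅` survives on
the right, leaving a domain wall partition function. It has a product formula (`domainWall_eq`): as
a polynomial in the parameter `q' 0` of the first column it has degree less than the number of rows,
and row exchanges reduce its values at the row parameters `p'` to a smaller domain. -/

namespace FreeFermionSixVertex

/-! ### Column transfer matrices and the exchange of rows. -/

section Transfer

variable {R : Type*} [CommSemiring R]

/-- The vertex weights of a row, as a function of the column and of the states of the bottom, left,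
top and right edge. -/
abbrev RowWeight (R : Type*) := ℕ → Bool → Bool → Bool → Bool → R

/-- The `{0, 1}`-words of length `n`, the horizontal states of a stack of `n` rows. -/
def states : ℕ → Finset (List Bool)
  | 0 => {[]}
  | n + 1 => (Finset.univ ×ˢ states n).image fun p => p.1 :: p.2

theorem mem_states {n : ℕ} {σ : List Bool} : σ ∈ states n ↔ σ.length = n := by
  induction n generalizing σ with
  | zero => simp [states]
  | succ n ih =>
    cases σ with
    | nil => simp [states]
    | cons b σ => simp [states, ih]

theorem sum_states_zero (f : List Bool → R) : ∑ σ ∈ states 0, f σ = f [] := by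
  simp [states]

theorem sum_states_succ (n : ℕ) (f : List Bool → R) :
    ∑ σ ∈ states (n + 1), f σ = ∑ b : Bool, ∑ σ ∈ states n, f (b :: σ) := by
  rw [states, Finset.sum_image, Finset.sum_product]
  rintro ⟨a, σ⟩ _ ⟨b, τ⟩ _ h
  simpa using h

theorem sum_states_add (m n : ℕ) (f : List Bool → R) :
    ∑ σ ∈ states (m + n), f σ = ∑ σ ∈ states m, ∑ τ ∈ states n, f (σ ++ τ) := by
  induction m generalizing f with
  | zero => simp [sum_states_zero]
  | succ m ih =>
    rw [show m + 1 + n = (m + n) + 1 by ring, sum_states_succ, sum_states_succ]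
    refine Finset.sum_congr rfl fun b _ => ?_
    rw [ih]
    rfl

/-- The weight of column `k` of a stack of rows (listed from the bottom), with the bottom edge in
state `b`, the top edge in state `t`, the left edges in states `σ` and the right edges in
states `σ'`. -/
def col (k : ℕ) : List (RowWeight R) → Bool → List Bool → Bool → List Bool → R
  | [], b, [], t, [] => if b = t then 1 else 0
  | V :: l, b, j :: σ, t, j' :: σ' => ∑ v, V k b j v j' * col k l v σ t σ'
  | _, _, _, _, _ => 0

theorem col_append (k : ℕ) (l₁ l₂ : List (RowWeight R)) (b t : Bool) (σ₁ σ₁' σ₂ σ₂' : List Bool)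
    (h : σ₁.length = l₁.length) (h' : σ₁'.length = l₁.length) :
    col k (l₁ ++ l₂) b (σ₁ ++ σ₂) t (σ₁' ++ σ₂') =
      ∑ v, col k l₁ b σ₁ v σ₁' * col k l₂ v σ₂ t σ₂' := by
  induction l₁ generalizing b σ₁ σ₁' with
  | nil =>
    obtain rfl := List.length_eq_zero_iff.1 h
    obtain rfl := List.length_eq_zero_iff.1 h'
    simp [col]
  | cons V l ih =>
    cases σ₁ with
    | nil => simp at h
    | cons j σ =>
      cases σ₁' with
      | nil => simp at h'
      | cons j' σ' =>
        simp only [List.length_cons, add_left_inj] at h h'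
        simp only [List.cons_append, col]
        simp_rw [ih _ _ _ h h', Finset.mul_sum, Finset.sum_mul]
        rw [Finset.sum_comm]
        simp_rw [mul_assoc]

/-- The partition function of the first `K` columns of a stack of rows, with bottom edges `A`, top
edges `B`, left edges `σ₀`, and right edges `σ`. -/
def strip (l : List (RowWeight R)) (A B : ℕ → Bool) (σ₀ : List Bool) : ℕ → List Bool → R
  | 0, σ => if σ = σ₀ then 1 else 0
  | K + 1, σ' => ∑ σ ∈ states l.length, strip l A B σ₀ K σ * col K l (A K) σ (B K) σ'

theorem strip_congr (l : List (RowWeight R)) {A A' B B' : ℕ → Bool} (σ₀ : List Bool) {K : ℕ}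
    (hA : ∀ i < K, A i = A' i) (hB : ∀ i < K, B i = B' i) (σ : List Bool) :
    strip l A B σ₀ K σ = strip l A' B' σ₀ K σ := by
  induction K generalizing σ with
  | zero => rfl
  | succ K ih =>
    simp only [strip]
    rw [hA K K.lt_succ_self, hB K K.lt_succ_self]
    exact Finset.sum_congr rfl fun τ _ => by
      rw [ih (fun i hi => hA i (hi.trans K.lt_succ_self))
        (fun i hi => hB i (hi.trans K.lt_succ_self))]

/-- The indicator function of a finite set. -/
def ind (s : Finset ℕ) : ℕ → Bool := fun i => decide (i ∈ s)

/-- Cutting a stack along the horizontal line between two blocks: `ν` records the occupied vertical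
edges on the cut. This is how both sides of the Cauchy identity become partition functions of one
tall stack. -/
theorem strip_append (l₁ l₂ : List (RowWeight R)) (A B : ℕ → Bool) {τ₁ τ₂ : List Bool}
    (h₁ : τ₁.length = l₁.length) (K : ℕ) {σ₁ σ₂ : List Bool}
    (hσ₁ : σ₁.length = l₁.length) :
    strip (l₁ ++ l₂) A B (τ₁ ++ τ₂) K (σ₁ ++ σ₂) =
      ∑ ν ∈ (Finset.range K).powerset,
        strip l₁ A (ind ν) τ₁ K σ₁ * strip l₂ (ind ν) B τ₂ K σ₂ := by
  induction K generalizing σ₁ σ₂ with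
  | zero =>
    have : σ₁ ++ σ₂ = τ₁ ++ τ₂ ↔ σ₁ = τ₁ ∧ σ₂ = τ₂ :=
      ⟨fun h => List.append_inj h (hσ₁.trans h₁.symm), fun h => by rw [h.1, h.2]⟩
    simp only [strip, this, Finset.range_zero, Finset.powerset_empty, Finset.sum_singleton]
    split_ifs <;> simp_all
  | succ K ih =>
    -- A subset of the first `K + 1` columns is a subset `ν` of the first `K` together with a state
    -- `b` of column `K`. The next three facts separate the two.
    have key : ∀ (ν : Finset ℕ), ν ∈ (Finset.range K).powerset →
        ∀ b : Bool, ∀ i < K, ind (if b then insert K ν else ν) i = ind ν i := by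
      intro ν _ b i hi
      cases b <;> simp [ind, hi.ne]
    have key2 : ∀ (ν : Finset ℕ), ν ∈ (Finset.range K).powerset →
        ∀ b : Bool, ind (if b then insert K ν else ν) K = b := by
      intro ν hν b
      have : K ∉ ν := fun h => by simpa using Finset.mem_powerset.1 hν h
      cases b <;> simp [ind, this]
    have split : ∀ f : Finset ℕ → R, ∑ ν ∈ (Finset.range (K + 1)).powerset, f ν =
        ∑ b : Bool, ∑ ν ∈ (Finset.range K).powerset, f (if b then insert K ν else ν) := by
      intro f
      rw [Finset.range_add_one, Finset.sum_powerset_insert (by simp)]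
      simp [add_comm]
    rw [split]
    simp only [strip, List.length_append, sum_states_add]
    have lhs : ∀ ρ₁ ∈ states l₁.length, ∀ ρ₂ ∈ states l₂.length,
        strip (l₁ ++ l₂) A B (τ₁ ++ τ₂) K (ρ₁ ++ ρ₂) *
            col K (l₁ ++ l₂) (A K) (ρ₁ ++ ρ₂) (B K) (σ₁ ++ σ₂) =
          ∑ b : Bool, ∑ ν ∈ (Finset.range K).powerset,
            (strip l₁ A (ind ν) τ₁ K ρ₁ * col K l₁ (A K) ρ₁ b σ₁) *
              (strip l₂ (ind ν) B τ₂ K ρ₂ * col K l₂ b ρ₂ (B K) σ₂) := by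
      intro ρ₁ hρ₁ ρ₂ _
      rw [ih (mem_states.1 hρ₁), col_append K l₁ l₂ _ _ _ _ _ _ (mem_states.1 hρ₁) hσ₁,
        Finset.sum_mul_sum, Finset.sum_comm]
      refine Finset.sum_congr rfl fun b _ => Finset.sum_congr rfl fun ν _ => by ring
    rw [Finset.sum_congr rfl fun ρ₁ h₁ => Finset.sum_congr rfl fun ρ₂ h₂ => lhs ρ₁ h₁ ρ₂ h₂]
    have swap : ∀ f : List Bool → List Bool → Bool → Finset ℕ → R,
        ∑ ρ₁ ∈ states l₁.length, ∑ ρ₂ ∈ states l₂.length, ∑ b : Bool,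
          ∑ ν ∈ (Finset.range K).powerset, f ρ₁ ρ₂ b ν =
        ∑ b : Bool, ∑ ν ∈ (Finset.range K).powerset,
          ∑ ρ₁ ∈ states l₁.length, ∑ ρ₂ ∈ states l₂.length, f ρ₁ ρ₂ b ν := by
      intro f
      have comm : ∀ {α β γ : Type} (s : Finset α) (t : Finset β) (u : Finset γ)
          (g : α → β → γ → R), ∑ a ∈ s, ∑ b ∈ t, ∑ c ∈ u, g a b c =
            ∑ c ∈ u, ∑ a ∈ s, ∑ b ∈ t, g a b c := fun s t u g => by
        rw [Finset.sum_comm (s := u)]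
        exact Finset.sum_congr rfl fun a _ => Finset.sum_comm
      rw [comm]
      exact Finset.sum_congr rfl fun b _ => comm _ _ _ _
    rw [swap]
    refine Finset.sum_congr rfl fun b _ => Finset.sum_congr rfl fun ν hν => ?_
    rw [Finset.sum_mul_sum, key2 ν hν]
    refine Finset.sum_congr rfl fun ρ₁ _ => Finset.sum_congr rfl fun ρ₂ _ => ?_
    rw [strip_congr l₁ τ₁ (fun _ _ => rfl) (key ν hν b), strip_congr l₂ τ₂ (key ν hν b)
      (fun _ _ => rfl)]

/-- The rows with the first column removed. -/
def shiftRows (l : List (RowWeight R)) : List (RowWeight R) := l.map fun V k => V (k + 1)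

theorem col_shiftRows (k : ℕ) (l : List (RowWeight R)) (b t : Bool) (σ σ' : List Bool) :
    col k (shiftRows l) b σ t σ' = col (k + 1) l b σ t σ' := by
  induction l generalizing b σ σ' with
  | nil => cases σ <;> cases σ' <;> rfl
  | cons V l ih =>
    cases σ with
    | nil => cases σ' <;> rfl
    | cons j σ =>
      cases σ' with
      | nil => rfl
      | cons j' σ' =>
        simp only [shiftRows, List.map_cons, col] at ih ⊢
        simp_rw [ih]

/-- `strip` grows on the right, but the domain wall recursion has to peel off the first column. -/
theorem strip_succ_left (l : List (RowWeight R)) (A B : ℕ → Bool) {σ₀ : List Bool}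
    (h₀ : σ₀.length = l.length) (K : ℕ) {σ' : List Bool} (h : σ'.length = l.length) :
    strip l A B σ₀ (K + 1) σ' = ∑ σ ∈ states l.length, col 0 l (A 0) σ₀ (B 0) σ *
      strip (shiftRows l) (fun i => A (i + 1)) (fun i => B (i + 1)) σ K σ' := by
  induction K generalizing σ' with
  | zero =>
    simp only [strip, ite_mul, mul_ite, one_mul, mul_one, zero_mul, mul_zero]
    rw [Finset.sum_ite_eq', Finset.sum_ite_eq, if_pos (mem_states.2 h₀), if_pos (mem_states.2 h)]
  | succ K ih =>
    rw [strip]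
    conv_rhs => simp only [strip, Finset.mul_sum]
    rw [Finset.sum_comm]
    simp only [shiftRows, List.length_map]
    refine Finset.sum_congr rfl fun τ hτ => ?_
    rw [ih (mem_states.1 hτ), Finset.sum_mul]
    refine Finset.sum_congr rfl fun σ _ => ?_
    rw [← col_shiftRows, mul_assoc]
    rfl

/-- Two vertices stacked on top of each other. -/
def pairCol (k : ℕ) (U V : RowWeight R) (b a₁ a₂ t c₁ c₂ : Bool) : R :=
  ∑ v, U k b a₁ v c₁ * V k v a₂ t c₂

/-- The Yang–Baxter equation for two rows, with a cross vertex `X a₁ a₂ c₁ c₂` whose left edges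
are in states `a₁, a₂` and whose right edges are in states `c₁, c₂`. -/
def YangBaxter (X : Bool → Bool → Bool → Bool → R) (U V : RowWeight R) : Prop :=
  ∀ k b t a₁ a₂ c₁ c₂,
    ∑ e₁, ∑ e₂, pairCol k U V b a₁ a₂ t e₁ e₂ * X e₁ e₂ c₁ c₂ =
      ∑ e₁, ∑ e₂, X a₁ a₂ e₁ e₂ * pairCol k V U b e₁ e₂ t c₁ c₂

theorem col_cons_cons (k : ℕ) (U V : RowWeight R) (l : List (RowWeight R)) (b t a₁ a₂ c₁ c₂ : Bool)
    (σ σ' : List Bool) :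
    col k (U :: V :: l) b (a₁ :: a₂ :: σ) t (c₁ :: c₂ :: σ') =
      ∑ v, pairCol k U V b a₁ a₂ v c₁ c₂ * col k l v σ t σ' := by
  simp only [col, pairCol, Fintype.sum_bool]
  ring

theorem col_yangBaxter {X : Bool → Bool → Bool → Bool → R} {U V : RowWeight R}
    (hX : YangBaxter X U V) (k : ℕ) (l₁ l₂ : List (RowWeight R)) (b t a₁ a₂ c₁ c₂ : Bool)
    {σ₁ σ₁' : List Bool} (σ₂ σ₂' : List Bool)
    (h : σ₁.length = l₁.length) (h' : σ₁'.length = l₁.length) :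
    ∑ e₁, ∑ e₂, col k (l₁ ++ U :: V :: l₂) b (σ₁ ++ a₁ :: a₂ :: σ₂) t (σ₁' ++ e₁ :: e₂ :: σ₂') *
        X e₁ e₂ c₁ c₂ =
      ∑ e₁, ∑ e₂, X a₁ a₂ e₁ e₂ *
        col k (l₁ ++ V :: U :: l₂) b (σ₁ ++ e₁ :: e₂ :: σ₂) t (σ₁' ++ c₁ :: c₂ :: σ₂') := by
  simp_rw [col_append k l₁ _ b t σ₁ σ₁' _ _ h h', col_cons_cons]
  calc
    _ = ∑ v, ∑ u, col k l₁ b σ₁ v σ₁' * col k l₂ u σ₂ t σ₂' *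
        ∑ e₁, ∑ e₂, pairCol k U V v a₁ a₂ u e₁ e₂ * X e₁ e₂ c₁ c₂ := by
      simp only [Fintype.sum_bool]
      ring
    _ = ∑ v, ∑ u, col k l₁ b σ₁ v σ₁' * col k l₂ u σ₂ t σ₂' *
        ∑ e₁, ∑ e₂, X a₁ a₂ e₁ e₂ * pairCol k V U v e₁ e₂ u c₁ c₂ := by
      refine Finset.sum_congr rfl fun v _ => Finset.sum_congr rfl fun u _ => ?_
      rw [hX]
    _ = _ := by
      simp only [Fintype.sum_bool]
      ring

/-- The zipper argument: a cross vertex that fixes the empty left boundary can be moved from the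
right end of a strip to its left end. -/
theorem strip_exchange {X : Bool → Bool → Bool → Bool → R} {U V : RowWeight R} {ξ : R}
    (hX : YangBaxter X U V)
    (h₀ : ∀ a₁ a₂ c₁ c₂, (a₁ = false ∧ a₂ = false ↔ c₁ = false ∧ c₂ = false) ∨ X a₁ a₂ c₁ c₂ = 0)
    (hξ : X false false false false = ξ)
    (l₁ l₂ : List (RowWeight R)) (A B : ℕ → Bool) {τ₁ τ₂ : List Bool}
    (K : ℕ) {σ₁ : List Bool} (σ₂ : List Bool) (c₁ c₂ : Bool)
    (hτ : τ₁.length = l₁.length) (hσ : σ₁.length = l₁.length) (hσ₂ : σ₂.length = l₂.length) :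
    ∑ e₁, ∑ e₂, strip (l₁ ++ U :: V :: l₂) A B (τ₁ ++ false :: false :: τ₂) K
        (σ₁ ++ e₁ :: e₂ :: σ₂) * X e₁ e₂ c₁ c₂ =
      ξ * strip (l₁ ++ V :: U :: l₂) A B (τ₁ ++ false :: false :: τ₂) K
        (σ₁ ++ c₁ :: c₂ :: σ₂) := by
  induction K generalizing σ₁ σ₂ c₁ c₂ with
  | zero =>
    have e : ∀ a b, σ₁ ++ a :: b :: σ₂ = τ₁ ++ false :: false :: τ₂ ↔
        σ₁ = τ₁ ∧ a = false ∧ b = false ∧ σ₂ = τ₂ := by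
      intro a b
      refine ⟨fun h => ?_, ?_⟩
      · simpa using List.append_inj h (hσ.trans hτ.symm)
      · rintro ⟨rfl, rfl, rfl, rfl⟩
        rfl
    simp only [strip, e]
    have hh := h₀ false false c₁ c₂
    by_cases hc : σ₁ = τ₁ ∧ σ₂ = τ₂
    · obtain ⟨rfl, rfl⟩ := hc
      cases c₁ <;> cases c₂ <;> simp_all
    · have : ∀ a b : Bool, ¬ (σ₁ = τ₁ ∧ a = false ∧ b = false ∧ σ₂ = τ₂) := by tauto
      simp [this]
  | succ K ih =>
    have exp : ∀ (U V : RowWeight R) (e₁ e₂ : Bool) (σ₁ σ₂ : List Bool),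
        strip (l₁ ++ U :: V :: l₂) A B (τ₁ ++ false :: false :: τ₂) (K + 1)
          (σ₁ ++ e₁ :: e₂ :: σ₂) =
        ∑ ρ₁ ∈ states l₁.length, ∑ ρ₂ ∈ states l₂.length, ∑ a₁, ∑ a₂,
          strip (l₁ ++ U :: V :: l₂) A B (τ₁ ++ false :: false :: τ₂) K
            (ρ₁ ++ a₁ :: a₂ :: ρ₂) *
          col K (l₁ ++ U :: V :: l₂) (A K) (ρ₁ ++ a₁ :: a₂ :: ρ₂) (B K)
            (σ₁ ++ e₁ :: e₂ :: σ₂) := by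
      intro U V e₁ e₂ σ₁ σ₂
      rw [strip, List.length_append, sum_states_add]
      refine Finset.sum_congr rfl fun ρ₁ _ => ?_
      simp only [List.length_cons, sum_states_succ]
      simp_rw [Fintype.sum_bool, ← Finset.sum_add_distrib]
    simp_rw [exp]
    calc
      _ = ∑ ρ₁ ∈ states l₁.length, ∑ ρ₂ ∈ states l₂.length, ∑ a₁, ∑ a₂,
          strip (l₁ ++ U :: V :: l₂) A B (τ₁ ++ false :: false :: τ₂) K
            (ρ₁ ++ a₁ :: a₂ :: ρ₂) *
          ∑ e₁, ∑ e₂, col K (l₁ ++ U :: V :: l₂) (A K) (ρ₁ ++ a₁ :: a₂ :: ρ₂) (B K)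
            (σ₁ ++ e₁ :: e₂ :: σ₂) * X e₁ e₂ c₁ c₂ := by
        simp only [Fintype.sum_bool, Finset.sum_mul, ← Finset.sum_add_distrib]
        refine Finset.sum_congr rfl fun ρ₁ _ => Finset.sum_congr rfl fun ρ₂ _ => by ring
      _ = ∑ ρ₁ ∈ states l₁.length, ∑ ρ₂ ∈ states l₂.length, ∑ c, ∑ d,
          (∑ a₁, ∑ a₂, strip (l₁ ++ U :: V :: l₂) A B (τ₁ ++ false :: false :: τ₂) K
            (ρ₁ ++ a₁ :: a₂ :: ρ₂) * X a₁ a₂ c d) *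
          col K (l₁ ++ V :: U :: l₂) (A K) (ρ₁ ++ c :: d :: ρ₂) (B K)
            (σ₁ ++ c₁ :: c₂ :: σ₂) := by
        refine Finset.sum_congr rfl fun ρ₁ h₁ => Finset.sum_congr rfl fun ρ₂ _ => ?_
        simp_rw [col_yangBaxter hX K l₁ l₂ (A K) (B K) _ _ c₁ c₂ ρ₂ σ₂ (mem_states.1 h₁) hσ]
        simp only [Fintype.sum_bool]
        ring
      _ = _ := by
        simp_rw [Finset.mul_sum]
        refine Finset.sum_congr rfl fun ρ₁ h₁ => Finset.sum_congr rfl fun ρ₂ h₂ => ?_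
        refine Finset.sum_congr rfl fun c _ => Finset.sum_congr rfl fun d _ => ?_
        rw [ih ρ₂ c d (mem_states.1 h₁) (mem_states.1 h₂), mul_assoc]

end Transfer

end FreeFermionSixVertex

namespace FreeFermionSixVertex

/-! ### Path configurations are summed by the transfer matrices. -/

section Configurations

/-- The horizontal path states forced by the bottom states `A`, the top states `B` and an empty
left boundary. -/
def path (A B : ℕ → Bool) : ℕ → Bool
  | 0 => false
  | i + 1 => xor (xor (A i) (path A B i)) (B i)

theorem eq_xor_of_conserve {a j b j' : Bool} (h : a.toNat + j.toNat = b.toNat + j'.toNat) :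
    j' = xor (xor a j) b := by
  revert h; revert a j b j'; decide

/-- Vertex weights that vanish unless as many paths leave as enter. -/
def Conservative {R : Type*} [Zero R] (V : RowWeight R) : Prop :=
  ∀ k b j t j', V k b j t j' ≠ 0 → b.toNat + j.toNat = t.toNat + j'.toNat

theorem strip_nil {R : Type*} [CommSemiring R] (a b : Finset ℕ) {K : ℕ} (ha : a ⊆ Finset.range K)
    (hb : b ⊆ Finset.range K) :
    strip ([] : List (RowWeight R)) (ind a) (ind b) [] K [] = if a = b then 1 else 0 := by
  have : ∀ L, strip ([] : List (RowWeight R)) (ind a) (ind b) [] L [] =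
      if ∀ i < L, (i ∈ a ↔ i ∈ b) then 1 else 0 := by
    intro L
    induction L with
    | zero => simp [strip]
    | succ L ih =>
      have e : (∀ i < L + 1, (i ∈ a ↔ i ∈ b)) ↔ (∀ i < L, (i ∈ a ↔ i ∈ b)) ∧ (L ∈ a ↔ L ∈ b) := by
        rw [Nat.forall_lt_succ_right]
      simp only [strip, List.length_nil, sum_states_zero, ih, col, e, ind, decide_eq_decide]
      split_ifs <;> simp_all
  rw [this]
  refine if_congr ⟨fun h => ?_, fun h => by simp [h]⟩ rfl rfl
  ext i
  by_cases hi : i < K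
  · exact h i hi
  · constructor <;> intro h'
    · exact absurd (Finset.mem_range.1 (ha h')) hi
    · exact absurd (Finset.mem_range.1 (hb h')) hi

/-- In one row, conservation leaves at most one choice of the horizontal edges. `path` is defined by
parity alone; where it violates conservation, a factor of the product is zero. -/
theorem strip_singleton {R : Type*} [CommSemiring R] {V : RowWeight R} (hV : Conservative V)
    (A B : ℕ → Bool) (K : ℕ) (j : Bool) :
    strip [V] A B [false] K [j] = if j = path A B K then
      ∏ i ∈ Finset.range K, V i (A i) (path A B i) (B i) (path A B (i + 1)) else 0 := by
  induction K generalizing j with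
  | zero => simp [strip, path]
  | succ K ih =>
    have : ∀ j₀, col K [V] (A K) [j₀] (B K) [j] = V K (A K) j₀ (B K) j := by
      intro j₀
      simp only [col, Fintype.sum_bool]
      cases B K <;> simp
    rw [strip]
    simp only [List.length_singleton, sum_states_succ, sum_states_zero, ih, this]
    rw [Finset.prod_range_succ]
    have h2 : ∀ j₀, (if j₀ = path A B K then
        ∏ i ∈ Finset.range K, V i (A i) (path A B i) (B i) (path A B (i + 1)) else 0) *
          V K (A K) j₀ (B K) j = if j₀ = path A B K then
        (∏ i ∈ Finset.range K, V i (A i) (path A B i) (B i) (path A B (i + 1))) *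
          V K (A K) (path A B K) (B K) j else 0 := by
      intro j₀
      split_ifs with h
      · rw [h]
      · simp
    simp_rw [h2]
    rw [Finset.sum_ite_eq', if_pos (Finset.mem_univ _)]
    split_ifs with h
    · rw [h]
    · have : V K (A K) (path A B K) (B K) j = 0 := by
        by_contra h0
        exact h (eq_xor_of_conserve (hV _ _ _ _ _ h0))
      rw [this, mul_zero]

theorem ind_eq_iff {f : ℕ → Bool} {a : Finset ℕ} :
    (∀ i, f i = true ↔ i ∈ (a : Set ℕ)) ↔ f = ind a := by
  constructor
  · intro h
    funext i
    have := h i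
    simp only [ind]
    rw [Finset.mem_coe] at this
    rw [Bool.eq_iff_iff, this, decide_eq_true_iff]
  · rintro rfl i
    simp [ind]

theorem ind_of_subset_range {a : Finset ℕ} {K i : ℕ} (ha : a ⊆ Finset.range K) (hi : K ≤ i) :
    ind a i = false := by
  simp only [ind, decide_eq_false_iff_not]
  exact fun h => absurd (Finset.mem_range.1 (ha h)) (by omega)

theorem Config.hasBoundary_iff {k : ℕ} (c : Config k) (a b : Finset ℕ) (e : Bool) :
    c.HasBoundary a b e ↔ c.vert 0 = ind a ∧ c.vert (Fin.last k) = ind b ∧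
      (∀ j, c.horiz j 0 = false) ∧ ∀ j, ∀ᶠ i in atTop, c.horiz j i = e := by
  rw [Config.HasBoundary, ind_eq_iff, ind_eq_iff]

/-- Conservation of paths in a whole column. -/
theorem Config.conserve_column {k : ℕ} (c : Config k) (i : ℕ) :
    (c.vert 0 i).toNat + ∑ j, (c.horiz j i).toNat =
      (c.vert (Fin.last k) i).toNat + ∑ j, (c.horiz j (i + 1)).toNat := by
  have h := Finset.sum_congr (rfl : (Finset.univ : Finset (Fin k)) = _)
    fun j _ => c.conserve j i
  rw [Finset.sum_add_distrib, Finset.sum_add_distrib] at h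
  have h1 := Fin.sum_univ_succ fun j => (c.vert j i).toNat
  have h2 := Fin.sum_univ_castSucc fun j => (c.vert j i).toNat
  omega

/-- Beyond the support of the boundary conditions a configuration is frozen. -/
theorem Config.frozen {k : ℕ} {c : Config k} {a b : Finset ℕ} {e : Bool}
    (hc : c.HasBoundary a b e) {K : ℕ} (ha : a ⊆ Finset.range K) (hb : b ⊆ Finset.range K)
    {i : ℕ} (hi : K ≤ i) : (∀ j, c.horiz j i = e) ∧ ∀ j, c.vert j i = false := by
  rw [Config.hasBoundary_iff] at hc
  obtain ⟨h0, h1, _, h3⟩ := hc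
  -- In these columns no path enters at the bottom or exits at the top, so the number of occupied
  -- horizontal edges is constant. It equals its limiting value, which is the minimum `0` or the
  -- maximum `k`, and this fixes every single edge.
  have step : ∀ i, K ≤ i → ∑ j, (c.horiz j i).toNat = ∑ j, (c.horiz j (i + 1)).toNat := by
    intro i hi
    have := c.conserve_column i
    rw [h0, h1, ind_of_subset_range ha hi, ind_of_subset_range hb hi] at this
    simpa using this
  have step' : ∀ i, K ≤ i → ∀ n,
      ∑ j, (c.horiz j i).toNat = ∑ j, (c.horiz j (i + n)).toNat := by
    intro i hi n
    induction n with
    | zero => rfl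
    | succ n ih => rw [ih, step _ (by omega)]; rfl
  obtain ⟨n, hn⟩ := eventually_atTop.1 (eventually_all.2 h3)
  have total : ∀ i, K ≤ i → ∑ j, (c.horiz j i).toNat = ∑ _j : Fin k, e.toNat := by
    intro i hi
    rw [step' i hi n]
    exact Finset.sum_congr rfl fun j _ => by rw [hn _ (by omega)]
  have hor : ∀ i, K ≤ i → ∀ j, c.horiz j i = e := by
    intro i hi j
    have ht := total i hi
    cases e with
    | false =>
      simp only [Bool.toNat_false, Finset.sum_const_zero, Finset.sum_eq_zero_iff,
        Finset.mem_univ, true_implies] at ht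
      simpa using ht j
    | true =>
      have := (Finset.sum_eq_sum_iff_of_le (s := Finset.univ)
        (f := fun j => (c.horiz j i).toNat) (g := fun _ => true.toNat)
        (fun j _ => by cases c.horiz j i <;> simp)).1 ht j (Finset.mem_univ _)
      simpa using this
  refine ⟨hor i hi, fun j => ?_⟩
  induction j using Fin.induction with
  | zero => rw [h0, ind_of_subset_range ha hi]
  | succ j ih =>
    have := c.conserve j i
    rw [hor i hi, hor (i + 1) (by omega), ih] at this
    simpa using this

/-- A configuration without its bottom row. -/
def Config.tail {k : ℕ} (c : Config (k + 1)) : Config k where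
  vert j i := c.vert j.succ i
  horiz j i := c.horiz j.succ i
  conserve j i := c.conserve j.succ i

/-- A configuration with a row added at the bottom. -/
def Config.cons {k : ℕ} (A h : ℕ → Bool) (c : Config k)
    (hc : ∀ i, (A i).toNat + (h i).toNat = (c.vert 0 i).toNat + (h (i + 1)).toNat) :
    Config (k + 1) where
  vert := Fin.cons A c.vert
  horiz := Fin.cons h c.horiz
  conserve j := by
    cases j using Fin.cases with
    | zero => exact hc
    | succ j => exact c.conserve j

theorem Config.horiz_zero {k : ℕ} {c : Config (k + 1)} (h : c.horiz 0 0 = false) :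
    c.horiz 0 = path (c.vert 0) (c.vert 1) := by
  funext i
  induction i with
  | zero => exact h
  | succ i ih =>
    rw [path, ← ih]
    exact eq_xor_of_conserve (c.conserve 0 i)

theorem Config.ext_tail {k : ℕ} {c c' : Config (k + 1)} (h : c.tail = c'.tail)
    (h0 : c.vert 0 = c'.vert 0) (h1 : c.horiz 0 = c'.horiz 0) : c = c' := by
  obtain ⟨v, g, _⟩ := c
  obtain ⟨v', g', _⟩ := c'
  simp only [Config.tail, Config.mk.injEq] at h h0 h1 ⊢
  constructor
  · funext j
    cases j using Fin.cases with
    | zero => exact h0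
    | succ j => exact congrFun h.1 j
  · funext j
    cases j using Fin.cases with
    | zero => exact h1
    | succ j => exact congrFun h.2 j

/-- The sum of the weights of all configurations with given boundary conditions is given by the
column transfer construction. -/
theorem finsum_config_eq_strip {k : ℕ} (V : Fin k → RowWeight ℂ) {e : Bool}
    (hV : ∀ j, Conservative (V j)) (hV1 : ∀ j i, V j i false e false e = 1) {a b : Finset ℕ} {K : ℕ}
    (ha : a ⊆ Finset.range K) (hb : b ⊆ Finset.range K) :
    {c : Config k | c.HasBoundary a b e}.Finite ∧
    ∑ᶠ c ∈ {c : Config k | c.HasBoundary a b e}, ∏ j : Fin k, ∏ᶠ i : ℕ, V j i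
        (c.vert j.castSucc i) (c.horiz j i) (c.vert j.succ i) (c.horiz j (i + 1)) =
      strip (List.ofFn V) (ind a) (ind b) (List.replicate k false) K (List.replicate k e) := by
  induction k generalizing a with
  | zero =>
    simp only [List.ofFn_zero, List.replicate_zero, strip_nil a b ha hb, Finset.univ_eq_empty,
      Finset.prod_empty]
    have hs : ∀ c : Config 0, c.HasBoundary a b e → a = b := by
      intro c hc
      rw [Config.hasBoundary_iff] at hc
      have : ind a = ind b := hc.1.symm.trans hc.2.1
      ext i
      have := congrFun this i
      simpa [ind] using this
    have hsub : {c : Config 0 | c.HasBoundary a b e}.Subsingleton := by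
      intro c hc c' hc'
      rw [Set.mem_ofPred_eq, Config.hasBoundary_iff] at hc hc'
      obtain ⟨v, g, _⟩ := c
      obtain ⟨v', g', _⟩ := c'
      rw [Config.mk.injEq]
      refine ⟨?_, funext fun j => j.elim0⟩
      funext j
      obtain rfl : j = 0 := Fin.ext (by omega)
      exact hc.1.trans hc'.1.symm
    refine ⟨hsub.finite, ?_⟩
    split_ifs with h
    · subst h
      let c₀ : Config 0 := ⟨fun _ => ind a, fun j => j.elim0, fun j => j.elim0⟩
      have h₀ : c₀.HasBoundary a a e := (Config.hasBoundary_iff _ _ _ _).2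
        ⟨rfl, rfl, fun j => j.elim0, fun j => j.elim0⟩
      have : {c : Config 0 | c.HasBoundary a a e} = {c₀} :=
        hsub.eq_singleton_of_mem h₀
      rw [this, finsum_mem_singleton]
    · have : {c : Config 0 | c.HasBoundary a b e} = ∅ :=
        Set.eq_empty_of_forall_notMem fun c hc => h (hs c hc)
      rw [this, finsum_mem_empty]
  | succ k ih =>
    set S := {c : Config (k + 1) | c.HasBoundary a b e} with hS
    let T : Finset ℕ → Set (Config (k + 1)) := fun ν => {c | c ∈ S ∧ c.vert 1 = ind ν}
    have hST : S = ⋃ ν ∈ (((Finset.range K).powerset : Finset (Finset ℕ)) : Set (Finset ℕ)),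
        T ν := by
      ext c
      simp only [Set.mem_iUnion, exists_prop]
      refine ⟨fun hc => ?_, fun ⟨_, _, h⟩ => h.1⟩
      refine ⟨(Finset.range K).filter fun i => c.vert 1 i = true,
        Finset.mem_coe.2 (Finset.mem_powerset.2 (Finset.filter_subset _ _)), hc, ?_⟩
      rw [← ind_eq_iff]
      intro i
      simp only [Finset.coe_filter, Finset.mem_range, Set.mem_ofPred_eq]
      refine ⟨fun h => ⟨?_, h⟩, fun h => h.2⟩
      by_contra hi
      rw [(Config.frozen hc ha hb (not_lt.1 hi)).2 1] at h
      exact absurd h (by simp)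
    have main : ∀ ν ∈ (Finset.range K).powerset, (T ν).Finite ∧
        ∑ᶠ c ∈ T ν, ∏ j : Fin (k + 1), ∏ᶠ i : ℕ, V j i
          (c.vert j.castSucc i) (c.horiz j i) (c.vert j.succ i) (c.horiz j (i + 1)) =
        strip [V 0] (ind a) (ind ν) [false] K [e] *
          strip (List.ofFn fun j => V j.succ) (ind ν) (ind b) (List.replicate k false) K
            (List.replicate k e) := by
      intro ν hν
      have hν' := Finset.mem_powerset.1 hν
      obtain ⟨fin, sum⟩ := ih (fun j => V j.succ) (fun j => hV _) (fun j => hV1 _) hν'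
      set h := path (ind a) (ind ν) with hh
      -- Either the forced bottom row is a genuine row with the correct right end, and removing it
      -- is a bijection onto configurations with `k` rows, or there is no configuration and the
      -- transfer side has to vanish as well.
      by_cases hOK : (∀ i, (ind a i).toNat + (h i).toNat = (ind ν i).toNat + (h (i + 1)).toNat) ∧
          ∀ i, K ≤ i → h i = e
      · have bij : Set.BijOn Config.tail (T ν) {c : Config k | c.HasBoundary ν b e} := by
          refine ⟨?_, ?_, ?_⟩
          · rintro c ⟨hc, hcν⟩
            rw [hS, Set.mem_ofPred_eq, Config.hasBoundary_iff] at hc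
            rw [Set.mem_ofPred_eq, Config.hasBoundary_iff]
            exact ⟨hcν, hc.2.1, fun j => hc.2.2.1 j.succ, fun j => hc.2.2.2 j.succ⟩
          · rintro c ⟨hc, hcν⟩ c' ⟨hc', hcν'⟩ htail
            rw [hS, Set.mem_ofPred_eq, Config.hasBoundary_iff] at hc hc'
            refine Config.ext_tail htail (hc.1.trans hc'.1.symm) ?_
            rw [Config.horiz_zero (hc.2.2.1 0), Config.horiz_zero (hc'.2.2.1 0), hc.1, hc'.1,
              hcν, hcν']
          · intro c hc
            rw [Set.mem_ofPred_eq, Config.hasBoundary_iff] at hc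
            refine ⟨Config.cons (ind a) h c (by rw [hc.1]; exact hOK.1), ⟨?_, hc.1⟩, rfl⟩
            rw [hS, Set.mem_ofPred_eq, Config.hasBoundary_iff]
            refine ⟨rfl, hc.2.1, fun j => ?_, fun j => ?_⟩
            · cases j using Fin.cases with
              | zero => rfl
              | succ j => exact hc.2.2.1 j
            · cases j using Fin.cases with
              | zero => exact eventually_atTop.2 ⟨K, fun i hi => hOK.2 i hi⟩
              | succ j => exact hc.2.2.2 j
        refine ⟨Set.Finite.of_finite_image (bij.image_eq ▸ fin) bij.injOn, ?_⟩
        rw [strip_singleton (hV 0), ← hh, if_pos (hOK.2 K le_rfl).symm, ← sum,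
          mul_finsum_mem]
        refine finsum_mem_eq_of_bijOn Config.tail bij fun c hc => ?_
        rw [Fin.prod_univ_succ]
        congr 1
        obtain ⟨hc, hcν⟩ := hc
        rw [hS, Set.mem_ofPred_eq, Config.hasBoundary_iff] at hc
        have hz := Config.horiz_zero (hc.2.2.1 0)
        rw [hc.1, hcν, ← hh] at hz
        rw [finprod_eq_prod_of_mulSupport_subset (s := Finset.range K)]
        · refine Finset.prod_congr rfl fun i _ => ?_
          rw [Fin.castSucc_zero, hc.1, hz, Fin.succ_zero_eq_one, hcν]
        · intro i hi
          by_contra hiK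
          apply hi
          rw [Finset.mem_coe, Finset.mem_range, not_lt] at hiK
          beta_reduce
          rw [Fin.castSucc_zero, hc.1, hz, Fin.succ_zero_eq_one, hcν, hOK.2 i hiK,
            hOK.2 (i + 1) (by omega), ind_of_subset_range ha hiK, ind_of_subset_range hν' hiK, hV1]
      · have hemp : T ν = ∅ := by
          refine Set.eq_empty_of_forall_notMem fun c hc => hOK ?_
          obtain ⟨hcS, hcν⟩ := hc
          have hc := hcS
          rw [hS, Set.mem_ofPred_eq, Config.hasBoundary_iff] at hc
          have hz := Config.horiz_zero (hc.2.2.1 0)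
          rw [hc.1, hcν, ← hh] at hz
          rw [← hz, ← hc.1, ← hcν]
          exact ⟨c.conserve 0, fun i hi => (Config.frozen hcS ha hb hi).1 0⟩
        rw [hemp]
        refine ⟨Set.finite_empty, ?_⟩
        rw [finsum_mem_empty, strip_singleton (hV 0), ← hh]
        split_ifs with he
        -- If the path has the correct state at `K`, it keeps it forever, so the defect is a
        -- violation of conservation inside the first `K` columns, where it produces a zero factor.
        · have : ∃ i < K, (ind a i).toNat + (h i).toNat ≠
              (ind ν i).toNat + (h (i + 1)).toNat := by
            by_contra hno
            push Not at hno
            have hconst : ∀ i, K ≤ i → h i = e := by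
              intro i hi
              induction i, hi using Nat.le_induction with
              | base => exact he.symm
              | succ i hi ih =>
                rw [hh, path, ind_of_subset_range ha hi, ind_of_subset_range hν' hi, ← hh, ih]
                simp
            refine hOK ⟨fun i => ?_, hconst⟩
            by_cases hi : i < K
            · exact hno i hi
            · rw [not_lt] at hi
              rw [hconst i hi, hconst (i + 1) (by omega), ind_of_subset_range ha hi,
                ind_of_subset_range hν' hi]
          obtain ⟨i, hi, hne⟩ := this
          rw [Finset.prod_eq_zero (Finset.mem_range.2 hi), zero_mul]
          by_contra h0
          exact hne (hV 0 _ _ _ _ _ h0)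
        · rw [zero_mul]
    have hfin : S.Finite := by
      rw [hST]
      exact Set.Finite.biUnion (Finset.finite_toSet _) fun ν hν => (main ν hν).1
    refine ⟨hfin, ?_⟩
    rw [hST, finsum_mem_biUnion]
    · rw [finsum_mem_coe_finset, List.ofFn_succ]
      refine (Finset.sum_congr rfl fun ν hν => (main ν hν).2).trans ?_
      exact (strip_append [V 0] (List.ofFn fun j => V j.succ) (ind a) (ind b)
        (τ₁ := [false]) rfl K (σ₁ := [e]) rfl).symm
    · intro ν hν ν' hν' hne
      refine Set.disjoint_left.2 fun c hc hc' => hne ?_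
      have : ind ν = ind ν' := hc.2.symm.trans hc'.2
      ext i
      have := congrFun this i
      simpa [ind] using this
    · exact Finset.finite_toSet _
    · exact fun ν hν => (main ν hν).1

end Configurations

end FreeFermionSixVertex

namespace FreeFermionSixVertex

/-! ### Signatures as finite sets of points. -/

section Signatures

theorem Signature.strictMono_rev {n : ℕ} (l : Signature n) :
    StrictMono fun i : Fin n => l.1 i.rev + (i : ℕ) := by
  intro i j hij
  have := l.2 (Fin.rev_le_rev.2 hij.le)
  have h2 : (i : ℕ) < j := hij
  simp only
  omega

theorem Signature.points_eq_range {n : ℕ} (l : Signature n) :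
    l.points = Set.range fun i : Fin n => l.1 i.rev + (i : ℕ) := by
  rw [Signature.points]
  ext x
  simp only [Set.mem_range]
  constructor
  · rintro ⟨i, rfl⟩
    exact ⟨i.rev, by rw [Fin.rev_rev]⟩
  · rintro ⟨i, rfl⟩
    exact ⟨i.rev, by rw [Fin.rev_rev]⟩

/-- The point configuration of a signature as a finite set. -/
def Signature.finset {n : ℕ} (l : Signature n) : Finset ℕ :=
  Finset.univ.image fun i : Fin n => l.1 i.rev + (i : ℕ)

theorem Signature.coe_finset {n : ℕ} (l : Signature n) : (l.finset : Set ℕ) = l.points := by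
  rw [Signature.points_eq_range, Signature.finset]
  simp

theorem Signature.card_finset {n : ℕ} (l : Signature n) : l.finset.card = n := by
  rw [Signature.finset, Finset.card_image_of_injective _ l.strictMono_rev.injective]
  simp

/-- The number of parts is recovered as the cardinality, and a strictly increasing sequence is
determined by its range. -/
theorem Signature.finset_injective :
    Function.Injective fun l : (n : ℕ) × Signature n => l.2.finset := by
  rintro ⟨n, l⟩ ⟨m, l'⟩ h
  simp only at h
  obtain rfl : n = m := by rw [← l.card_finset, h, l'.card_finset]
  have h2 : l.points = l'.points := by rw [← Signature.coe_finset, h, Signature.coe_finset]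
  rw [Signature.points_eq_range, Signature.points_eq_range] at h2
  have h3 := (StrictMono.range_inj l.strictMono_rev l'.strictMono_rev).1 h2
  have : l = l' := by
    refine Subtype.ext (funext fun i => ?_)
    have := congrFun h3 i.rev
    simpa using this
  rw [this]

theorem Signature.exists_finset_eq (s : Finset ℕ) : ∃ l : Signature s.card, l.finset = s := by
  let f := s.orderEmbOfFin rfl
  -- A strictly increasing sequence of integers grows by at least one per step, so subtracting the
  -- index keeps it nonnegative and monotone.
  have hf : ∀ i j : Fin s.card, i ≤ j → f i + ((j : ℕ) - i) ≤ f j := by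
    rintro ⟨i, hi⟩ ⟨j, hj⟩ hij
    obtain ⟨d, rfl⟩ := Nat.exists_eq_add_of_le (show i ≤ j from hij)
    induction d with
    | zero => simp
    | succ d ih =>
      have h1 := ih (by omega) (by simp)
      have h2 : f ⟨i + d, by omega⟩ < f ⟨i + (d + 1), hj⟩ := f.strictMono (by simp)
      simp only at h1 ⊢
      omega
  have hle : ∀ i : Fin s.card, (i : ℕ) ≤ f i := by
    intro i
    have := hf ⟨0, i.pos⟩ i (Nat.zero_le _)
    simp only at this
    omega
  refine ⟨⟨fun i => f i.rev - (i.rev : ℕ), ?_⟩, ?_⟩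
  · intro i j hij
    have h1 := hf j.rev i.rev (Fin.rev_le_rev.2 hij)
    have h2 := hle j.rev
    have h3 : (j.rev : ℕ) ≤ i.rev := Fin.rev_le_rev.2 hij
    simp only
    omega
  · have : ∀ i : Fin s.card, f i.rev.rev - (i.rev.rev : ℕ) + i = f i := by
      intro i
      rw [Fin.rev_rev]
      exact Nat.sub_add_cancel (hle i)
    simp only [Signature.finset, this]
    rw [← Finset.coe_inj]
    simp [f]

/-- Signatures with any numbers of parts correspond to finite sets of points. -/
noncomputable def signatureEquiv : ((n : ℕ) × Signature n) ≃ Finset ℕ :=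
  Equiv.ofBijective (fun l => l.2.finset) ⟨Signature.finset_injective, fun s =>
    let ⟨l, hl⟩ := Signature.exists_finset_eq s
    ⟨⟨_, l⟩, hl⟩⟩

theorem signatureEquiv_apply (l : (n : ℕ) × Signature n) : signatureEquiv l = l.2.finset := rfl

theorem Signature.finset_zero (n : ℕ) : (Signature.zero n).finset = Finset.range n := by
  ext i
  simp only [Signature.finset, Signature.zero, zero_add, Finset.mem_image, Finset.mem_univ,
    true_and, Finset.mem_range]
  exact ⟨fun ⟨j, hj⟩ => hj ▸ j.2, fun h => ⟨⟨i, h⟩, rfl⟩⟩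

end Signatures

/-! ### Free fermion weights and their Yang–Baxter equation. -/

section Vertices

/-- The free fermion six vertex weights, without normalization. The parameters of the row are
`p, p'` and those of the column are `q, q'`. -/
def vertex (p p' q q' : ℂ) : Bool → Bool → Bool → Bool → ℂ
  | false, false, false, false => q' - p
  | true, true, true, true => p' - q
  | true, false, true, false => q' - p'
  | false, true, false, true => q - p
  | true, false, false, true => p' - p
  | false, true, true, false => q' - q
  | _, _, _, _ => 0

/-- A row of vertices, with a normalization that depends on the column. -/
def vertexRow (q q' : ℕ → ℂ) (p p' : ℂ) (d : ℕ → ℂ) : RowWeight ℂ :=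
  fun k b j t j' => d k * vertex p p' (q k) (q' k) b j t j'

/-- The weights of a cross of two rows with parameters `p₁, p₁'` and `p₂, p₂'`. -/
def cross (p₁ p₁' p₂ p₂' : ℂ) : Bool → Bool → Bool → Bool → ℂ
  | false, false, false, false => p₂ - p₁'
  | true, true, true, true => p₁ - p₂'
  | false, true, false, true => p₁ - p₁'
  | false, true, true, false => p₂ - p₁
  | true, false, false, true => p₂' - p₁'
  | true, false, true, false => p₂ - p₂'
  | _, _, _, _ => 0

theorem vertexRow_conservative (q q' : ℕ → ℂ) (p p' : ℂ) (d : ℕ → ℂ) :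
    Conservative (vertexRow q q' p p' d) := by
  intro k b j t j'
  cases b <;> cases j <;> cases t <;> cases j' <;> simp [vertexRow, vertex]

/-- The cross does not involve `q` and `q'`, so one cross passes through all columns. The
normalizations multiply both sides by `d₁ k * d₂ k` and do not matter. -/
theorem yangBaxter_vertexRow (q q' : ℕ → ℂ) (p₁ p₁' p₂ p₂' : ℂ) (d₁ d₂ : ℕ → ℂ) :
    YangBaxter (cross p₁ p₁' p₂ p₂') (vertexRow q q' p₁ p₁' d₁) (vertexRow q q' p₂ p₂' d₂) := by
  intro k b t a₁ a₂ c₁ c₂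
  simp only [pairCol, vertexRow, Fintype.sum_bool]
  generalize d₁ k = d₁
  generalize d₂ k = d₂
  generalize q k = q
  generalize q' k = q'
  cases b <;> cases t <;> cases a₁ <;> cases a₂ <;> cases c₁ <;> cases c₂ <;>
    simp only [vertex, cross, mul_zero, zero_mul, add_zero, zero_add] <;> ring

theorem cross_empty (p₁ p₁' p₂ p₂' : ℂ) (a₁ a₂ c₁ c₂ : Bool) :
    (a₁ = false ∧ a₂ = false ↔ c₁ = false ∧ c₂ = false) ∨ cross p₁ p₁' p₂ p₂' a₁ a₂ c₁ c₂ = 0 := by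
  cases a₁ <;> cases a₂ <;> cases c₁ <;> cases c₂ <;> simp [cross]

/-- The nonvanishing is used only for the empty vertex, whose weight `1` is a quotient of equal
numbers. -/
theorem W_eq_vertex {x y r s : ℂ} (h : s ^ (-2 : ℤ) * y - x ≠ 0) (b j t j' : Bool) :
    W x y r s b j t j' = (s ^ (-2 : ℤ) * y - x)⁻¹ *
      vertex x (r ^ (-2 : ℤ) * x) y (s ^ (-2 : ℤ) * y) b j t j' := by
  cases b <;> cases j <;> cases t <;> cases j' <;> simp only [W, vertex] <;>
    first
    | exact (inv_mul_cancel₀ h).symm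
    | exact (mul_zero _).symm
    | exact div_eq_inv_mul _ _
    | (rw [div_eq_inv_mul]; ring)

theorem WHat_eq_vertex {x y r s : ℂ} (h : y - x ≠ 0) (b j t j' : Bool) :
    WHat x y r s b j t j' = (y - x)⁻¹ *
      vertex x (r ^ (-2 : ℤ) * x) y (s ^ (-2 : ℤ) * y) b j t j' := by
  cases b <;> cases j <;> cases t <;> cases j' <;> simp only [WHat, vertex] <;>
    first
    | exact (inv_mul_cancel₀ h).symm
    | exact (mul_zero _).symm
    | exact div_eq_inv_mul _ _
    | (rw [div_eq_inv_mul]; ring)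

/-- The second column parameter `s⁻²y`. -/
noncomputable def colParam (y s : ℕ → ℂ) (k : ℕ) : ℂ := s k ^ (-2 : ℤ) * y k

/-- A row with the weights `W`. -/
noncomputable def rowG (y s : ℕ → ℂ) (x r : ℂ) : RowWeight ℂ :=
  vertexRow y (colParam y s) x (r ^ (-2 : ℤ) * x) fun k => (colParam y s k - x)⁻¹

/-- A row with the weights `Ŵ`. -/
noncomputable def rowF (y s : ℕ → ℂ) (x r : ℂ) : RowWeight ℂ :=
  vertexRow y (colParam y s) x (r ^ (-2 : ℤ) * x) fun k => (y k - x)⁻¹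

/-- Any `K` that covers the boundary points is allowed, so all signatures inside a window can be
truncated at the same column. -/
theorem skewG_eq_strip {k m n : ℕ} (lam : Signature m) (mu : Signature n)
    {x : Fin k → ℂ} {y : ℕ → ℂ} {r : Fin k → ℂ} {s : ℕ → ℂ}
    (h : ∀ j i, colParam y s i - x j ≠ 0) {K : ℕ}
    (hlam : lam.finset ⊆ Finset.range K) (hmu : mu.finset ⊆ Finset.range K) :
    skewG lam mu x y r s = strip (List.ofFn fun j => rowG y s (x j) (r j)) (ind mu.finset)
      (ind lam.finset) (List.replicate k false) K (List.replicate k false) := by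
  have := (finsum_config_eq_strip (fun j => rowG y s (x j) (r j)) (e := false)
    (fun j => vertexRow_conservative _ _ _ _ _)
    (fun j i => inv_mul_cancel₀ (h j i)) hmu hlam).2
  rw [← this, skewG, Signature.coe_finset, Signature.coe_finset]
  refine finsum_mem_congr rfl fun c _ => ?_
  refine Finset.prod_congr rfl fun j _ => finprod_congr fun i => ?_
  exact W_eq_vertex (h j i) _ _ _ _

theorem skewF_eq_strip {k m n : ℕ} (lam : Signature m) (mu : Signature n)
    {x : Fin k → ℂ} {y : ℕ → ℂ} {r : Fin k → ℂ} {s : ℕ → ℂ}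
    (h : ∀ j i, y i - x j ≠ 0) {K : ℕ}
    (hlam : lam.finset ⊆ Finset.range K) (hmu : mu.finset ⊆ Finset.range K) :
    skewF lam mu x y r s = strip (List.ofFn fun j => rowF y s (x j) (r j)) (ind lam.finset)
      (ind mu.finset) (List.replicate k false) K (List.replicate k true) := by
  have := (finsum_config_eq_strip (fun j => rowF y s (x j) (r j)) (e := true)
    (fun j => vertexRow_conservative _ _ _ _ _)
    (fun j i => inv_mul_cancel₀ (h j i)) hlam hmu).2
  rw [← this, skewF, Signature.coe_finset, Signature.coe_finset]
  refine finsum_mem_congr rfl fun c _ => ?_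
  refine Finset.prod_congr rfl fun j _ => finprod_congr fun i => ?_
  exact WHat_eq_vertex (h j i) _ _ _ _

end Vertices

end FreeFermionSixVertex

namespace FreeFermionSixVertex

/-! ### Exchanging a full row with an empty row in the limit of many columns. -/

section Exchange

open Topology

/-- The sum over all horizontal paths of the number of rows below the path. -/
def height : List Bool → ℕ
  | [] => 0
  | _ :: σ => height σ + σ.count true

theorem height_append (σ τ : List Bool) :
    height (σ ++ τ) = height σ + height τ + σ.length * τ.count true := by
  induction σ with
  | nil => simp [height]
  | cons b σ ih =>
    simp only [List.cons_append, height, ih, List.count_append, List.length_cons]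
    ring

/-- A row of vertices, together with the state of its horizontal edges far to the right. -/
structure TaggedRow where
  full : Bool
  p : ℂ
  p' : ℂ
  d : ℕ → ℂ

/-- The vertex weights of a row. -/
def TaggedRow.weight (q q' : ℕ → ℂ) (ρ : TaggedRow) : RowWeight ℂ :=
  vertexRow q q' ρ.p ρ.p' ρ.d

/-- The horizontal states of a stack of rows far to the right. -/
def ground (l : List TaggedRow) : List Bool := l.map TaggedRow.full

/-- The partition function of the first `K` columns of a stack of rows with empty left boundary. -/
def stackStrip (q q' : ℕ → ℂ) (A B : ℕ → Bool) (l : List TaggedRow) (K : ℕ) (σ : List Bool) : ℂ :=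
  strip (l.map (TaggedRow.weight q q')) A B (List.replicate l.length false) K σ

theorem stackStrip_exchange (q q' : ℕ → ℂ) (A B : ℕ → Bool) (l₁ l₂ : List TaggedRow)
    (g f : TaggedRow) (K : ℕ) {σ₁ : List Bool} (σ₂ : List Bool) (c₁ c₂ : Bool)
    (hσ : σ₁.length = l₁.length) (hσ₂ : σ₂.length = l₂.length) :
    ∑ e₁, ∑ e₂, stackStrip q q' A B (l₁ ++ g :: f :: l₂) K (σ₁ ++ e₁ :: e₂ :: σ₂) *
        cross g.p g.p' f.p f.p' e₁ e₂ c₁ c₂ =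
      (f.p - g.p') * stackStrip q q' A B (l₁ ++ f :: g :: l₂) K (σ₁ ++ c₁ :: c₂ :: σ₂) := by
  have h := strip_exchange (yangBaxter_vertexRow q q' g.p g.p' f.p f.p' g.d f.d)
    (cross_empty g.p g.p' f.p f.p') rfl (l₁.map (TaggedRow.weight q q'))
    (l₂.map (TaggedRow.weight q q')) A B (τ₁ := List.replicate l₁.length false)
    (τ₂ := List.replicate l₂.length false) K σ₂ c₁ c₂ (by simp) (by simpa using hσ)
    (by simpa using hσ₂)
  have e : ∀ g f : TaggedRow, List.replicate (l₁ ++ g :: f :: l₂).length false =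
      List.replicate l₁.length false ++ false :: false :: List.replicate l₂.length false := by
    intro g f
    rw [List.length_append, List.replicate_add]
    rfl
  simp only [stackStrip, e, List.map_append, List.map_cons]
  exact h

/-- The vector of partition functions, multiplied by `c`, has a limit `L` in its ground state, and
the limit `0` in all other states that are not higher than the ground state. -/
def LowLimit (q q' : ℕ → ℂ) (A B : ℕ → Bool) (l : List TaggedRow) (c L : ℂ) : Prop :=
  Tendsto (fun K => c * stackStrip q q' A B l K (ground l)) atTop (𝓝 L) ∧
    ∀ σ : List Bool, σ.length = l.length → σ.count true = (ground l).count true →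
      height σ ≤ height (ground l) → σ ≠ ground l →
        Tendsto (fun K => c * stackStrip q q' A B l K σ) atTop (𝓝 0)

/-- The exchange lowers the ground state by one unit of `height`, and the cross changes the height
by at most one. Hence every state within the new bound is fed by states within the old one, and the
old ground state contributes, among them, only to the new ground state. The factor `f.p - g.p'` is
collected in `c` instead of being divided out, since it may vanish. -/
theorem LowLimit.swap {q q' : ℕ → ℂ} {A B : ℕ → Bool} {l₁ l₂ : List TaggedRow} {g f : TaggedRow}
    {c L : ℂ} (hg : g.full = false) (hf : f.full = true)
    (h : LowLimit q q' A B (l₁ ++ g :: f :: l₂) c L) :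
    LowLimit q q' A B (l₁ ++ f :: g :: l₂) (c * (f.p - g.p')) (L * (f.p - g.p)) := by
  obtain ⟨h1, h2⟩ := h
  have gold : ground (l₁ ++ g :: f :: l₂) = ground l₁ ++ false :: true :: ground l₂ := by
    simp [ground, hg, hf]
  have gnew : ground (l₁ ++ f :: g :: l₂) = ground l₁ ++ true :: false :: ground l₂ := by
    simp [ground, hg, hf]
  have len₁ : (ground l₁).length = l₁.length := by simp [ground]
  have len₂ : (ground l₂).length = l₂.length := by simp [ground]
  rw [gold] at h1 h2
  have hh : ∀ (σ₁ σ₂ : List Bool) (a b : Bool), height (σ₁ ++ a :: b :: σ₂) =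
      height σ₁ + height σ₂ + (2 + σ₁.length) * σ₂.count true + (if b then 1 else 0)
        + σ₁.length * ((if a then 1 else 0) + if b then 1 else 0) := by
    intro σ₁ σ₂ a b
    cases a <;> cases b <;> simp [height_append, height] <;> ring
  have hc : ∀ (σ₁ σ₂ : List Bool) (a b : Bool), (σ₁ ++ a :: b :: σ₂).count true =
      σ₁.count true + σ₂.count true + (if a then 1 else 0) + if b then 1 else 0 := by
    intro σ₁ σ₂ a b
    cases a <;> cases b <;> simp <;> ring
  have split : ∀ σ : List Bool, σ.length = (l₁ ++ f :: g :: l₂).length →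
      ∃ σ₁ a b σ₂, σ = σ₁ ++ a :: b :: σ₂ ∧ σ₁.length = l₁.length ∧ σ₂.length = l₂.length := by
    intro σ hσ
    simp only [List.length_append, List.length_cons] at hσ
    have h1 : (σ.take l₁.length).length = l₁.length := by
      rw [List.length_take]; omega
    have h2 : (σ.drop l₁.length).length = l₂.length + 1 + 1 := by
      rw [List.length_drop]; omega
    obtain ⟨a, t, ht⟩ := List.exists_cons_of_length_eq_add_one h2
    rw [ht, List.length_cons, add_left_inj] at h2
    obtain ⟨b, t', ht'⟩ := List.exists_cons_of_length_eq_add_one h2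
    rw [ht', List.length_cons, add_left_inj] at h2
    refine ⟨_, a, b, t', ?_, h1, h2⟩
    rw [← ht', ← ht, List.take_append_drop]
  have inj : ∀ (σ₁ σ₂ : List Bool) (a b a' b' : Bool), σ₁.length = l₁.length →
      (σ₁ ++ a :: b :: σ₂ = ground l₁ ++ a' :: b' :: ground l₂ ↔
        σ₁ = ground l₁ ∧ a = a' ∧ b = b' ∧ σ₂ = ground l₂) := by
    intro σ₁ σ₂ a b a' b' h
    constructor
    · intro h'
      simpa using List.append_inj h' (h.trans len₁.symm)
    · rintro ⟨rfl, rfl, rfl, rfl⟩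
      rfl
  have ex : ∀ (σ₁ σ₂ : List Bool) (c₁ c₂ : Bool), σ₁.length = l₁.length →
      σ₂.length = l₂.length →
      (fun K => c * (f.p - g.p') *
        stackStrip q q' A B (l₁ ++ f :: g :: l₂) K (σ₁ ++ c₁ :: c₂ :: σ₂)) =
      fun K => ∑ e₁, ∑ e₂, (c * stackStrip q q' A B (l₁ ++ g :: f :: l₂) K
        (σ₁ ++ e₁ :: e₂ :: σ₂)) * cross g.p g.p' f.p f.p' e₁ e₂ c₁ c₂ := by
    intro σ₁ σ₂ c₁ c₂ h₁ h₂
    funext K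
    rw [mul_assoc, ← stackStrip_exchange q q' A B l₁ l₂ g f K σ₂ c₁ c₂ h₁ h₂]
    simp only [Finset.mul_sum, mul_assoc]
  have zero : ∀ (σ₁ σ₂ : List Bool) (a b : Bool), σ₁.length = l₁.length → σ₂.length = l₂.length →
      (σ₁ ++ a :: b :: σ₂).count true = (ground l₁ ++ false :: true :: ground l₂).count true →
      height (σ₁ ++ a :: b :: σ₂) ≤ height (ground l₁ ++ false :: true :: ground l₂) →
      σ₁ ++ a :: b :: σ₂ ≠ ground l₁ ++ false :: true :: ground l₂ →
      ∀ z : ℂ, Tendsto (fun K => (c * stackStrip q q' A B (l₁ ++ g :: f :: l₂) K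
        (σ₁ ++ a :: b :: σ₂)) * z) atTop (𝓝 0) := by
    intro σ₁ σ₂ a b hl₁ hl₂ hcount hheight hne z
    have := (h2 (σ₁ ++ a :: b :: σ₂) (by simp [hl₁, hl₂]) hcount hheight hne).mul_const z
    rwa [zero_mul] at this
  constructor
  · rw [gnew, ex _ _ _ _ len₁ len₂]
    -- Two states feed (full, empty): the old ground state, which yields the limit, and (full,
    -- empty) itself, which is lower by one and disappears.
    have e1 := h1.mul_const (cross g.p g.p' f.p f.p' false true true false)
    have e2 := zero (ground l₁) (ground l₂) true false len₁ len₂ (by simp [hc])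
      (by rw [hh, hh]; simp) (by simp) (cross g.p g.p' f.p f.p' true false true false)
    have := e1.add e2
    rw [add_zero] at this
    refine (this.congr fun K => ?_)
    simp only [Fintype.sum_bool, cross, mul_zero, zero_add, add_zero]
    ring
  · intro σ hσ hcount hheight hne
    obtain ⟨σ₁, a, b, σ₂, rfl, hl₁, hl₂⟩ := split σ hσ
    rw [gnew] at hcount hheight hne
    rw [ex _ _ _ _ hl₁ hl₂]
    rw [Ne, inj _ _ _ _ _ _ hl₁] at hne
    have z : ∀ a b, (σ₁ ++ a :: b :: σ₂).count true =
          (ground l₁ ++ false :: true :: ground l₂).count true →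
        height (σ₁ ++ a :: b :: σ₂) ≤ height (ground l₁ ++ false :: true :: ground l₂) →
        ¬ (σ₁ = ground l₁ ∧ a = false ∧ b = true ∧ σ₂ = ground l₂) → _ :=
      fun a b h h' h'' => zero σ₁ σ₂ a b hl₁ hl₂ h h' (by rwa [Ne, inj _ _ _ _ _ _ hl₁])
    simp only [hh, hc, hl₁, len₁] at hcount hheight z
    have fin : ∀ F G : ℕ → ℂ, Tendsto F atTop (𝓝 0) → Tendsto G atTop (𝓝 0) →
        Tendsto (fun K => F K + G K) atTop (𝓝 0) := fun F G hF hG => by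
      simpa using hF.add hG
    cases a <;> cases b <;>
      simp only [Bool.false_eq_true, if_true, if_false] at hcount hheight hne z
    · refine (z false false (by simp; omega) (by simp; omega) (by simp)
        (cross g.p g.p' f.p f.p' false false false false)).congr fun K => ?_
      simp only [Fintype.sum_bool, cross, mul_zero, zero_add]
    · refine (fin _ _ (z false true (by simp; omega) (by simp; omega) ?_
        (cross g.p g.p' f.p f.p' false true false true)) (z true false (by simp; omega)
        (by simp; omega) (by simp)
        (cross g.p g.p' f.p f.p' true false false true))).congr fun K => ?_
      · rintro ⟨rfl, _, _, rfl⟩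
        omega
      · simp only [Fintype.sum_bool, cross, mul_zero, zero_add, add_zero]
        ring
    · refine (fin _ _ (z false true (by simp; omega) (by simp; omega) ?_
        (cross g.p g.p' f.p f.p' false true true false)) (z true false (by simp; omega)
        (by simp; omega) (by simp)
        (cross g.p g.p' f.p f.p' true false true false))).congr fun K => ?_
      · rintro ⟨h, _, _, h'⟩
        exact hne ⟨h, trivial, trivial, h'⟩
      · simp only [Fintype.sum_bool, cross, mul_zero, zero_add, add_zero]
        ring
    · refine (z true true (by simp; omega) (by simp; omega) (by simp)
        (cross g.p g.p' f.p f.p' true true true true)).congr fun K => ?_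
      simp only [Fintype.sum_bool, cross, mul_zero, add_zero]

theorem LowLimit.move_one {q q' : ℕ → ℂ} {A B : ℕ → Bool} {f : TaggedRow} (hf : f.full = true)
    {l₁ gs l₂ : List TaggedRow} (hg : ∀ g ∈ gs, g.full = false) {c L : ℂ}
    (h : LowLimit q q' A B (l₁ ++ (gs ++ f :: l₂)) c L) :
    LowLimit q q' A B (l₁ ++ f :: (gs ++ l₂)) (c * (gs.map fun g => f.p - g.p').prod)
      (L * (gs.map fun g => f.p - g.p).prod) := by
  induction gs generalizing l₁ c L with
  | nil => simpa using h
  | cons g gs ih =>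
    have h1 := ih (l₁ := l₁ ++ [g]) (fun g' hg' => hg g' (List.mem_cons_of_mem _ hg'))
      (by simpa using h)
    have h2 := LowLimit.swap (hg g List.mem_cons_self) hf (l₁ := l₁) (l₂ := gs ++ l₂)
      (by simpa using h1)
    simpa [mul_assoc, mul_comm, mul_left_comm] using h2

/-- Moving all full rows below all empty rows. -/
theorem LowLimit.move_all {q q' : ℕ → ℂ} {A B : ℕ → Bool} {l₁ gs fs : List TaggedRow}
    (hg : ∀ g ∈ gs, g.full = false) (hf : ∀ f ∈ fs, f.full = true) {c L : ℂ}
    (h : LowLimit q q' A B (l₁ ++ (gs ++ fs)) c L) :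
    LowLimit q q' A B (l₁ ++ (fs ++ gs))
      (c * (fs.map fun f => (gs.map fun g => f.p - g.p').prod).prod)
      (L * (fs.map fun f => (gs.map fun g => f.p - g.p).prod).prod) := by
  induction fs generalizing l₁ c L with
  | nil => simpa using h
  | cons f fs ih =>
    have h1 := LowLimit.move_one (hf f List.mem_cons_self) hg h
    have h2 := ih (l₁ := l₁ ++ [f]) (fun f' hf' => hf f' (List.mem_cons_of_mem _ hf'))
      (by simpa using h1)
    simpa [mul_assoc] using h2

end Exchange

end FreeFermionSixVertex

namespace FreeFermionSixVertex

/-! ### Triangularity of the transfer matrix with respect to height. -/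

section Triangular

variable {R : Type*} [CommSemiring R]

/-- Under an empty top edge, whatever travels along the vertical edges of the column must leave to
the right in a higher row. If the bottom is empty too, an occupied vertical edge makes the increase
strict, and otherwise nothing moves. -/
theorem col_triangular {k : ℕ} {l : List (RowWeight R)} (hl : ∀ V ∈ l, Conservative V)
    {b : Bool} {σ σ' : List Bool} (h : col k l b σ false σ' ≠ 0) :
    σ'.count true = b.toNat + σ.count true ∧ height σ ≤ height σ' ∧
      (b = false → σ = σ' ∨ height σ < height σ') := by
  induction l generalizing b σ σ' with
  | nil =>
    cases σ <;> cases σ' <;> cases b <;> simp [col] at h ⊢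
  | cons V l ih =>
    cases σ with
    | nil => simp [col] at h
    | cons j σ =>
      cases σ' with
      | nil => simp [col] at h
      | cons j' σ' =>
        rw [col] at h
        obtain ⟨u, _, hu⟩ := Finset.exists_ne_zero_of_sum_ne_zero h
        have hV := hl V List.mem_cons_self _ _ _ _ _ (left_ne_zero_of_mul hu)
        obtain ⟨h1, h2, h3⟩ := ih (fun V hV => hl V (List.mem_cons_of_mem _ hV))
          (right_ne_zero_of_mul hu)
        have e1 : ∀ (a : Bool) (τ : List Bool), (a :: τ).count true = a.toNat + τ.count true := by
          intro a τ
          cases a <;> simp [add_comm]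
        simp only [height, e1]
        refine ⟨by omega, by omega, ?_⟩
        rintro rfl
        cases u with
        | true => exact Or.inr (by simp at h1; omega)
        | false =>
          have hj : j = j' := by
            revert hV; cases j <;> cases j' <;> simp
          rcases h3 rfl with h3 | h3
          · exact Or.inl (by rw [hj, h3])
          · exact Or.inr (by simp at h1; omega)

theorem height_le_ground {N M : ℕ} {σ : List Bool} (h : σ.length = N + M)
    (hc : σ.count true = M) :
    height σ ≤ height (List.replicate N false ++ List.replicate M true) := by
  induction σ generalizing N M with
  | nil => simp [height]
  | cons b σ ih =>
    cases b with
    | false =>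
      simp only [List.length_cons] at h
      have hc' : σ.count true = M := by simpa using hc
      have := σ.count_le_length (a := true)
      obtain ⟨N, rfl⟩ : ∃ n, N = n + 1 := ⟨N - 1, by omega⟩
      have h1 := ih (N := N) (M := M) (by omega) hc'
      simp only [List.replicate_succ, List.cons_append, height, hc', List.count_append,
        List.count_replicate_self, List.count_replicate]
      simpa using h1
    | true =>
      simp only [List.length_cons] at h
      obtain ⟨M, rfl⟩ : ∃ m, M = m + 1 := ⟨M - 1, by simp at hc; omega⟩
      have hc' : σ.count true = M := by simpa using hc
      have h1 := ih (N := N) (M := M) (by omega) hc'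
      simp only [height_append, List.replicate_succ, height, hc', List.length_replicate,
        List.count_replicate_self, List.count_cons_self] at h1 ⊢
      nlinarith

end Triangular

/-! ### Summability from triangular recurrences. -/

section Recurrence

/-- Summing the inequality gives `S ≤ a 0 + ρ S + ∑ b` for every partial sum `S`, to be solved for
`S`. -/
theorem summable_of_recurrence {a b : ℕ → ℝ} {ρ : ℝ} (ha : ∀ n, 0 ≤ a n) (hb : ∀ n, 0 ≤ b n)
    (hρ : 0 ≤ ρ) (hρ1 : ρ < 1) (hs : Summable b) (h : ∀ n, a (n + 1) ≤ ρ * a n + b n) :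
    Summable a := by
  have h1 : 0 < 1 - ρ := by linarith
  refine summable_of_sum_range_le (c := (a 0 + ∑' n, b n) / (1 - ρ)) ha fun n => ?_
  rw [le_div_iff₀ h1]
  have hB : 0 ≤ ∑' n, b n := tsum_nonneg hb
  induction n with
  | zero => simpa using add_nonneg (ha 0) hB
  | succ n ih =>
    rw [Finset.sum_range_succ']
    have h2 : ∑ i ∈ Finset.range n, a (i + 1) ≤
        ρ * ∑ i ∈ Finset.range n, a i + ∑' n, b n := by
      calc _ ≤ ∑ i ∈ Finset.range n, (ρ * a i + b i) := Finset.sum_le_sum fun i _ => h i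
        _ = ρ * ∑ i ∈ Finset.range n, a i + ∑ i ∈ Finset.range n, b i := by
          rw [Finset.sum_add_distrib, Finset.mul_sum]
        _ ≤ _ := by
          have := hs.sum_le_tsum (Finset.range n) fun i _ => hb i
          linarith
    nlinarith

theorem bounded_of_recurrence {a b : ℕ → ℝ} (hb : ∀ n, 0 ≤ b n) (hs : Summable b)
    (h : ∀ n, a (n + 1) ≤ a n + b n) (n : ℕ) : a n ≤ a 0 + ∑' n, b n := by
  have : a n ≤ a 0 + ∑ i ∈ Finset.range n, b i := by
    induction n with
    | zero => simp
    | succ n ih =>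
      rw [Finset.sum_range_succ]
      linarith [h n]
  linarith [hs.sum_le_tsum (Finset.range n) fun i _ => hb i]

/-- Products of nonnegative matrices that are triangular with respect to the height of the states,
uniformly bounded, and strictly contracting on the diagonal except at the highest state `g`. -/
theorem summable_of_triangular {n M : ℕ} {g : List Bool} {v : ℕ → List Bool → ℝ}
    {T : ℕ → List Bool → List Bool → ℝ} {ρ C : ℝ} (hρ : 0 ≤ ρ) (hρ1 : ρ < 1)
    (hv : ∀ K σ, 0 ≤ v K σ)
    (hrec : ∀ K σ', v (K + 1) σ' = ∑ σ ∈ states n, v K σ * T K σ σ')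
    (htri : ∀ K σ σ', T K σ σ' ≠ 0 →
      σ.count true = σ'.count true ∧ (σ = σ' ∨ height σ < height σ'))
    (hdiag : ∀ K σ, σ ∈ states n → σ.count true = M → σ ≠ g → T K σ σ ≤ ρ)
    (hg : ∀ K, T K g g ≤ 1) (hgs : g ∈ states n)
    (hgM : g.count true = M)
    (hgmax : ∀ σ ∈ states n, σ.count true = M → height σ ≤ height g)
    (hC : ∀ K, ∀ σ ∈ states n, ∀ σ' ∈ states n, σ.count true = M → σ'.count true = M →
      T K σ σ' ≤ C) :
    (∀ σ ∈ states n, σ.count true = M → σ ≠ g → Summable fun K => v K σ) ∧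
      ∃ c, ∀ K, v K g ≤ c := by
  set C' := max C 0
  let low : List Bool → Finset (List Bool) := fun σ' =>
    (states n).filter fun σ => σ.count true = M ∧ height σ < height σ'
  have step : ∀ σ' ∈ states n, σ'.count true = M → ∀ K,
      v (K + 1) σ' ≤ v K σ' * T K σ' σ' + ∑ σ ∈ low σ', C' * v K σ := by
    intro σ' hσ' hc' K
    rw [hrec, ← Finset.sum_erase_add _ _ hσ', add_comm]
    gcongr
    calc _ ≤ ∑ σ ∈ (states n).erase σ', if σ ∈ low σ' then C' * v K σ else 0 := by
          refine Finset.sum_le_sum fun σ hσ => ?_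
          obtain ⟨hne, hσs⟩ := Finset.mem_erase.1 hσ
          split_ifs with h
          · have := hC K σ hσs σ' hσ' (Finset.mem_filter.1 h).2.1 hc'
            have h2 : T K σ σ' ≤ C' := this.trans (le_max_left _ _)
            nlinarith [hv K σ]
          · by_cases h0 : T K σ σ' = 0
            · rw [h0, mul_zero]
            · obtain ⟨h1, h2⟩ := htri K σ σ' h0
              exact absurd (Finset.mem_filter.2 ⟨hσs, h1.trans hc', h2.resolve_left hne⟩) h
      _ = ∑ σ ∈ ((states n).erase σ').filter (· ∈ low σ'), C' * v K σ :=
          (Finset.sum_filter _ _).symm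
      _ ≤ _ := by
          refine Finset.sum_le_sum_of_subset_of_nonneg
            (fun σ hσ => (Finset.mem_filter.1 hσ).2) fun σ _ _ => ?_
          exact mul_nonneg (le_max_right _ _) (hv K σ)
  have hb : ∀ σ' K, 0 ≤ ∑ σ ∈ low σ', C' * v K σ := fun σ' K =>
    Finset.sum_nonneg fun σ _ => mul_nonneg (le_max_right _ _) (hv K σ)
  -- Induction on the height: the states strictly below `σ` act as a summable source. None of them
  -- is `g`, since `g` has maximal height.
  have hsum : ∀ h, ∀ σ ∈ states n, σ.count true = M → σ ≠ g → height σ = h →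
      Summable fun K => v K σ := by
    intro h
    induction h using Nat.strong_induction_on with
    | _ h ih =>
      intro σ' hσ' hc' hne hh
      refine summable_of_recurrence (b := fun K => ∑ σ ∈ low σ', C' * v K σ)
        (fun K => hv K σ') (hb σ') hρ hρ1 ?_ ?_
      · refine summable_sum fun σ hσ => Summable.mul_left _ ?_
        obtain ⟨hσs, hc, hlt⟩ := Finset.mem_filter.1 hσ
        refine ih (height σ) (hh ▸ hlt) σ hσs hc ?_ rfl
        rintro rfl
        exact absurd (hgmax σ' hσ' hc') (by omega)
      · intro K
        refine (step σ' hσ' hc' K).trans ?_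
        refine add_le_add ?_ le_rfl
        rw [mul_comm]
        exact mul_le_mul_of_nonneg_right (hdiag K σ' hσ' hc' hne) (hv K σ')
  refine ⟨fun σ h1 h2 h3 => hsum _ σ h1 h2 h3 rfl, v 0 g + ∑' K, ∑ σ ∈ low g, C' * v K σ,
    bounded_of_recurrence (a := fun K => v K g) (hb g) ?_ ?_⟩
  · refine summable_sum fun σ hσ => Summable.mul_left _ ?_
    obtain ⟨hσs, hc, hlt⟩ := Finset.mem_filter.1 hσ
    refine hsum _ σ hσs hc ?_ rfl
    rintro rfl
    exact lt_irrefl _ hlt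
  · intro K
    refine (step g hgs hgM K).trans ?_
    gcongr
    exact mul_le_of_le_one_right (hv K g) (hg K)

end Recurrence

/-! ### Domination by absolute values. -/

section AbsoluteValues

/-- The absolute values of the vertex weights. -/
noncomputable def absRow (V : RowWeight ℂ) : RowWeight ℝ := fun k b j t j' => ‖V k b j t j'‖

theorem absRow_conservative {V : RowWeight ℂ} (h : Conservative V) : Conservative (absRow V) :=
  fun k b j t j' hne => h k b j t j' (norm_ne_zero_iff.1 hne)

theorem norm_col_le (k : ℕ) (l : List (RowWeight ℂ)) (b t : Bool) (σ σ' : List Bool) :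
    ‖col k l b σ t σ'‖ ≤ col k (l.map absRow) b σ t σ' := by
  induction l generalizing b σ σ' with
  | nil =>
    cases σ <;> cases σ' <;> simp only [col, List.map_nil, norm_zero, le_refl]
    split_ifs <;> simp
  | cons V l ih =>
    cases σ with
    | nil => simp [col]
    | cons j σ =>
      cases σ' with
      | nil => simp [col]
      | cons j' σ' =>
        simp only [col, List.map_cons]
        refine (norm_sum_le _ _).trans (Finset.sum_le_sum fun v _ => ?_)
        rw [norm_mul]
        exact mul_le_mul_of_nonneg_left (ih _ _ _) (norm_nonneg _)

theorem col_absRow_nonneg (k : ℕ) (l : List (RowWeight ℂ)) (b t : Bool) (σ σ' : List Bool) :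
    0 ≤ col k (l.map absRow) b σ t σ' :=
  (norm_nonneg _).trans (norm_col_le k l b t σ σ')

theorem norm_strip_le (l : List (RowWeight ℂ)) (A B : ℕ → Bool) (σ₀ : List Bool) (K : ℕ)
    (σ : List Bool) : ‖strip l A B σ₀ K σ‖ ≤ strip (l.map absRow) A B σ₀ K σ := by
  induction K generalizing σ with
  | zero =>
    simp only [strip]
    split_ifs <;> simp
  | succ K ih =>
    simp only [strip, List.length_map]
    refine (norm_sum_le _ _).trans (Finset.sum_le_sum fun τ _ => ?_)
    rw [norm_mul]
    exact mul_le_mul (ih _) (norm_col_le _ _ _ _ _ _) (norm_nonneg _)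
      ((norm_nonneg _).trans (ih _))

theorem strip_absRow_nonneg (l : List (RowWeight ℂ)) (A B : ℕ → Bool) (σ₀ : List Bool) (K : ℕ)
    (σ : List Bool) : 0 ≤ strip (l.map absRow) A B σ₀ K σ :=
  (norm_nonneg _).trans (norm_strip_le l A B σ₀ K σ)

/-- `Q`, `Q'` and `η` are gauge factors on left, right and vertical edges; those on inner vertical
edges cancel between neighbouring rows. The `2` in `2 * c` counts the states of a vertical edge. -/
theorem col_weighted_le (k : ℕ) (l : List (RowWeight ℂ)) {Q Q' η c : ℝ} (hQ : 0 ≤ Q)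
    (hQ' : 0 ≤ Q') (hη : 0 ≤ η) (hc : 0 ≤ c)
    (h : ∀ V ∈ l, ∀ b j t j', ‖V k b j t j'‖ * Q' ^ j'.toNat * η ^ b.toNat ≤
      c * Q ^ j.toNat * η ^ t.toNat) (b t : Bool) (σ σ' : List Bool) :
    col k (l.map absRow) b σ t σ' * Q' ^ σ'.count true * η ^ b.toNat ≤
      (2 * c) ^ l.length * Q ^ σ.count true * η ^ t.toNat := by
  induction l generalizing b σ σ' with
  | nil =>
    cases σ <;> cases σ' <;> simp only [col, List.map_nil, zero_mul, List.length_nil, pow_zero,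
      one_mul, List.count_nil, mul_one] <;> try positivity
    split_ifs with h
    · rw [h, one_mul]
    · rw [zero_mul]; positivity
  | cons V l ih =>
    cases σ with
    | nil => simp only [col, List.map_cons, zero_mul]; positivity
    | cons j σ =>
      cases σ' with
      | nil => simp only [col, List.map_cons, zero_mul]; positivity
      | cons j' σ' =>
        have e1 : ∀ (a : Bool) (τ : List Bool), (a :: τ).count true = a.toNat + τ.count true := by
          intro a τ
          cases a <;> simp [add_comm]
        have term : ∀ v, absRow V k b j v j' * col k (l.map absRow) v σ t σ' *
            Q' ^ (j' :: σ').count true * η ^ b.toNat ≤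
            c * Q ^ j.toNat * ((2 * c) ^ l.length * Q ^ σ.count true * η ^ t.toNat) := by
          intro v
          have h1 := h V List.mem_cons_self b j v j'
          have h2 := ih (fun V hV => h V (List.mem_cons_of_mem _ hV)) v σ σ'
          have h3 := col_absRow_nonneg k l v t σ σ'
          calc _ = (‖V k b j v j'‖ * Q' ^ j'.toNat * η ^ b.toNat) *
                (col k (l.map absRow) v σ t σ' * Q' ^ σ'.count true) := by
                rw [e1, pow_add, absRow]; ring
            _ ≤ (c * Q ^ j.toNat * η ^ v.toNat) *
                (col k (l.map absRow) v σ t σ' * Q' ^ σ'.count true) := by gcongr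
            _ = c * Q ^ j.toNat * (col k (l.map absRow) v σ t σ' * Q' ^ σ'.count true *
                η ^ v.toNat) := by ring
            _ ≤ _ := by gcongr
        rw [List.map_cons, col, Finset.sum_mul, Finset.sum_mul]
        refine (Finset.sum_le_sum fun v _ => term v).trans (le_of_eq ?_)
        simp only [Fintype.sum_bool, e1, pow_add, List.length_cons]
        ring

/-- By conservation all vertical edges are empty here, so only the vertices `(0, 0; 0, 0)` and `(0,
1; 0, 1)` occur. -/
theorem col_diagonal_le (k : ℕ) (l : List (RowWeight ℂ)) (hl : ∀ V ∈ l, Conservative V) {α β : ℝ}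
    (hα : 0 ≤ α) (hβ : 0 ≤ β) (h0 : ∀ V ∈ l, ‖V k false false false false‖ ≤ α)
    (h1 : ∀ V ∈ l, ‖V k false true false true‖ ≤ β) (σ : List Bool) :
    col k (l.map absRow) false σ false σ ≤ β ^ σ.count true * α ^ σ.count false := by
  induction l generalizing σ with
  | nil =>
    cases σ with
    | nil => simp [col]
    | cons _ _ => simp only [List.map_nil, col]; positivity
  | cons V l ih =>
    cases σ with
    | nil => simp only [List.map_cons, col]; positivity
    | cons j σ =>
      have hz : col k (l.map absRow) true σ false σ = 0 := by
        by_contra h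
        have := (col_triangular (fun V hV => by
          obtain ⟨V', hV', rfl⟩ := List.mem_map.1 hV
          exact absRow_conservative (hl V' (List.mem_cons_of_mem _ hV'))) h).1
        simp at this
      have hi := ih (fun V hV => hl V (List.mem_cons_of_mem _ hV))
        (fun V hV => h0 V (List.mem_cons_of_mem _ hV))
        (fun V hV => h1 V (List.mem_cons_of_mem _ hV)) σ
      have := col_absRow_nonneg k l false false σ σ
      simp only [List.map_cons, col, Fintype.sum_bool, hz, mul_zero, zero_add]
      cases j with
      | false =>
        have h := h0 V List.mem_cons_self
        calc _ ≤ α * (β ^ σ.count true * α ^ σ.count false) :=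
              mul_le_mul h hi this hα
          _ = _ := by simp [pow_succ]; ring
      | true =>
        have h := h1 V List.mem_cons_self
        calc _ ≤ β * (β ^ σ.count true * α ^ σ.count false) :=
              mul_le_mul h hi this hβ
          _ = _ := by simp [pow_succ]; ring

end AbsoluteValues

end FreeFermionSixVertex

namespace FreeFermionSixVertex

/-! ### Elementary inequalities for the column parameters. -/

section Bounds

/-- If `|q' - x||q - w| ≤ |q - x||q' - w|` with `x ≠ w` then `q` is close to `w` whenever `q'` is. -/
theorem exists_norm_sub_mul_le {x w : ℂ} (hxw : x ≠ w) : ∃ C : ℝ, 0 ≤ C ∧ ∀ q q' : ℂ,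
    ‖q' - x‖ * ‖q - w‖ ≤ ‖q - x‖ * ‖q' - w‖ →
      ‖q - w‖ * (1 + ‖q'‖) ≤ C * (1 + ‖q‖) * ‖q' - w‖ := by
  -- No point is within distance less than `e` of both `x` and `w`. If `q'` is near `w` it is far
  -- from `x`, and the hypothesis forces `q` to be near `w`; otherwise the denominator `‖q' - w‖` is
  -- harmless.
  set e := ‖x - w‖ / 2 with he
  have hpos : 0 < e := by
    have := norm_pos_iff.2 (sub_ne_zero.2 hxw)
    positivity
  set r := 1 + ‖x‖ + ‖w‖ with hr
  have hr1 : 1 ≤ r := by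
    have := norm_nonneg x
    have := norm_nonneg w
    linarith
  have hr0 : 0 ≤ r := by linarith
  refine ⟨r * (r + e) / e, by positivity, fun q q' h => ?_⟩
  have hq := norm_nonneg q
  have hq' := norm_nonneg q'
  have h1 : ‖q - w‖ ≤ r * (1 + ‖q‖) := by
    have := norm_sub_le q w
    have h2 : ‖w‖ ≤ r - 1 := by linarith [norm_nonneg x]
    nlinarith
  have h1' : ‖q - x‖ ≤ r * (1 + ‖q‖) := by
    have := norm_sub_le q x
    have h2 : ‖x‖ ≤ r - 1 := by linarith [norm_nonneg w]
    nlinarith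
  have h3 : 1 + ‖q'‖ ≤ r + ‖q' - w‖ := by
    have : ‖q'‖ ≤ ‖q' - w‖ + ‖w‖ := by simpa using norm_add_le (q' - w) w
    linarith [norm_nonneg x]
  have key : ‖q - w‖ * (1 + ‖q'‖) * e ≤ r * (r + e) * (1 + ‖q‖) * ‖q' - w‖ := by
    rcases le_or_gt e ‖q' - w‖ with hc | hc
    · calc ‖q - w‖ * (1 + ‖q'‖) * e ≤ (r * (1 + ‖q‖)) * ((r + ‖q' - w‖) * e) := by
            rw [mul_assoc]; gcongr
        _ ≤ (r * (1 + ‖q‖)) * ((r + e) * ‖q' - w‖) :=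
            mul_le_mul_of_nonneg_left (by nlinarith) (by positivity)
        _ = _ := by ring
    · have h4 : e ≤ ‖q' - x‖ := by
        have : ‖x - w‖ ≤ ‖q' - x‖ + ‖q' - w‖ := by
          have := norm_sub_le (q' - w) (q' - x)
          rw [show q' - w - (q' - x) = x - w by ring] at this
          linarith
        linarith
      calc ‖q - w‖ * (1 + ‖q'‖) * e ≤ ‖q - w‖ * (r + e) * ‖q' - x‖ :=
            mul_le_mul (mul_le_mul_of_nonneg_left (by linarith) (norm_nonneg _)) h4 hpos.le
              (by positivity)
        _ = (r + e) * (‖q' - x‖ * ‖q - w‖) := by ring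
        _ ≤ (r + e) * (‖q - x‖ * ‖q' - w‖) := by gcongr
        _ ≤ (r + e) * ((r * (1 + ‖q‖)) * ‖q' - w‖) := by gcongr
        _ = _ := by ring
  rw [div_mul_eq_mul_div, div_mul_eq_mul_div, le_div_iff₀ hpos]
  exact key

/-- If `|q' - x||q - w| ≤ |q - x||q' - w|` with `x ≠ w` then `q'` is close to `q` whenever `q` is
close to `x`. -/
theorem exists_norm_sub_le {x w : ℂ} (hxw : x ≠ w) : ∃ C : ℝ, 0 ≤ C ∧ ∀ q q' : ℂ,
    ‖q' - x‖ * ‖q - w‖ ≤ ‖q - x‖ * ‖q' - w‖ →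
      ‖q' - q‖ ≤ C * (1 + ‖q‖) * min 1 ‖q - x‖ * ‖q' - w‖ := by
  obtain ⟨C₁, hC₁, h₁⟩ := exists_norm_sub_mul_le hxw
  set e := min 1 (‖x - w‖ / 2) with he
  have hpos : 0 < e := by
    have := norm_pos_iff.2 (sub_ne_zero.2 hxw)
    positivity
  have he1 : e ≤ 1 := min_le_left _ _
  have he2 : e ≤ ‖x - w‖ / 2 := min_le_right _ _
  refine ⟨(1 + C₁ + 1) / e, by positivity, fun q q' h => ?_⟩
  have hq := norm_nonneg q
  have hq' := norm_nonneg q'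
  rw [div_mul_eq_mul_div, div_mul_eq_mul_div, div_mul_eq_mul_div, le_div_iff₀ hpos]
  rcases le_or_gt e ‖q - x‖ with hc | hc
  · have hm : e ≤ min 1 ‖q - x‖ := le_min he1 hc
    have h2 : ‖q - w‖ ≤ C₁ * (1 + ‖q‖) * ‖q' - w‖ := by
      refine le_trans ?_ (h₁ q q' h)
      nlinarith [norm_nonneg (q - w)]
    have h3 : ‖q' - q‖ ≤ ‖q' - w‖ + ‖q - w‖ := by
      have := norm_sub_le (q' - w) (q - w)
      rwa [show q' - w - (q - w) = q' - q by ring] at this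
    have h4 : ‖q' - q‖ ≤ (1 + C₁ + 1) * (1 + ‖q‖) * ‖q' - w‖ := by
      nlinarith [norm_nonneg (q' - w), mul_nonneg hq (norm_nonneg (q' - w))]
    calc ‖q' - q‖ * e ≤ ((1 + C₁ + 1) * (1 + ‖q‖) * ‖q' - w‖) * min 1 ‖q - x‖ := by gcongr
      _ = _ := by ring
  · have hm : min 1 ‖q - x‖ = ‖q - x‖ := min_eq_right (by linarith)
    rw [hm]
    have h2 : e ≤ ‖q - w‖ := by
      have : ‖x - w‖ ≤ ‖q - x‖ + ‖q - w‖ := by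
        have := norm_sub_le (q - w) (q - x)
        rw [show q - w - (q - x) = x - w by ring] at this
        linarith
      linarith
    have h3 : ‖q' - x‖ * e ≤ ‖q - x‖ * ‖q' - w‖ := by
      refine le_trans ?_ h
      gcongr
    have h4 : e ≤ ‖q' - w‖ := by
      have h5 : ‖x - w‖ ≤ ‖q' - x‖ + ‖q' - w‖ := by
        have := norm_sub_le (q' - w) (q' - x)
        rw [show q' - w - (q' - x) = x - w by ring] at this
        linarith
      have h6 : ‖q' - x‖ ≤ ‖q' - w‖ := by
        by_contra hlt
        rw [not_le] at hlt
        nlinarith [norm_nonneg (q' - w), norm_nonneg (q' - x)]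
      linarith
    have h5 : ‖q' - q‖ ≤ ‖q' - x‖ + ‖q - x‖ := by
      have := norm_sub_le (q' - x) (q - x)
      rwa [show q' - x - (q - x) = q' - q by ring] at this
    have h6 : ‖q - x‖ * e ≤ ‖q - x‖ * ‖q' - w‖ := by gcongr
    have h7 : 0 ≤ ‖q - x‖ * ‖q' - w‖ := by positivity
    calc ‖q' - q‖ * e ≤ 2 * (‖q - x‖ * ‖q' - w‖) := by nlinarith
      _ ≤ (1 + C₁ + 1) * (1 + ‖q‖) * (‖q - x‖ * ‖q' - w‖) := by
          gcongr
          nlinarith [mul_nonneg hC₁ hq]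
      _ = _ := by ring

/-- With `Q = 1 + ‖q‖` and `Q' = 1 + ‖q'‖`, every weight is of order at most `Q ^ j * Q' ^ (1 -
j')`. The exponents vanish exactly for the vertex `(1, 0; 0, 1)`, whose weight contains no column
parameter. -/
theorem norm_vertex_le (p p' q q' : ℂ) (b j t j' : Bool) :
    ‖vertex p p' q q' b j t j'‖ * (1 + ‖q'‖) ^ j'.toNat ≤
      (2 + ‖p‖ + ‖p'‖) * (1 + ‖q‖) ^ j.toNat * (1 + ‖q'‖) := by
  have hp := norm_nonneg p
  have hp' := norm_nonneg p'
  have hq := norm_nonneg q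
  have hq' := norm_nonneg q'
  have t1 := norm_sub_le q' p
  have t2 := norm_sub_le p' q
  have t3 := norm_sub_le q' p'
  have t4 := norm_sub_le q p
  have t5 := norm_sub_le p' p
  have t6 := norm_sub_le q' q
  have m1 := mul_nonneg hp hq
  have m2 := mul_nonneg hp hq'
  have m3 := mul_nonneg hp' hq
  have m4 := mul_nonneg hp' hq'
  have m5 := mul_nonneg hq hq'
  have triv : ∀ a b : Bool, ‖(0 : ℂ)‖ * (1 + ‖q'‖) ^ a.toNat ≤
      (2 + ‖p‖ + ‖p'‖) * (1 + ‖q‖) ^ b.toNat * (1 + ‖q'‖) := by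
    intro a b
    rw [norm_zero, zero_mul]
    positivity
  have r1 : 1 ≤ 1 + ‖q'‖ := by linarith
  cases b <;> cases j <;> cases t <;> cases j' <;> simp only [vertex] <;> try exact triv _ _
  all_goals simp only [Bool.toNat_false, Bool.toNat_true, pow_zero, pow_one, mul_one]
  · nlinarith
  · refine mul_le_mul_of_nonneg_right ?_ (by linarith)
    nlinarith
  · nlinarith [mul_nonneg m1 hq', mul_nonneg m3 hq']
  · refine mul_le_mul_of_nonneg_right ?_ (by linarith)
    nlinarith
  · nlinarith
  · refine mul_le_mul_of_nonneg_right ?_ (by linarith)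
    nlinarith

theorem one_add_norm_le {q p : ℂ} {ε : ℝ} (hε : 0 < ε) (h : ε ≤ ‖q - p‖) :
    1 + ‖q‖ ≤ ((1 + ‖p‖) / ε + 1) * ‖q - p‖ := by
  have h1 : ‖q‖ ≤ ‖q - p‖ + ‖p‖ := by simpa using norm_add_le (q - p) p
  have h2 : 1 + ‖p‖ ≤ (1 + ‖p‖) / ε * ‖q - p‖ := by
    rw [div_mul_eq_mul_div, le_div_iff₀ hε]
    gcongr
  linarith

end Bounds

end FreeFermionSixVertex

namespace FreeFermionSixVertex

/-! ### Uniform bounds for the columns. -/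

section ColumnBounds

/-- The vertical gauge `min 1 ‖y k - x‖` anticipates that a path sent upwards may meet a vertex of
weight `Ŵ` with small denominator `y k - x`. The vertex `(0, 1; 1, 0)`, which creates such a path,
supplies the compensating smallness by `exists_norm_sub_le`. If `s⁻²y` may approach `w`, only
vertices with empty bottom edge are controlled. -/
theorem exists_rowG_le {x w θ : ℂ} {y s : ℕ → ℂ} (hxw : x ≠ w)
    (hw : ∀ k, colParam y s k - w ≠ 0)
    (hratio : ∀ k, ‖colParam y s k - x‖ * ‖y k - w‖ ≤ ‖y k - x‖ * ‖colParam y s k - w‖) :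
    ∃ c : ℝ, 0 ≤ c ∧ ∀ k b j t j',
      ((∃ ε : ℝ, 0 < ε ∧ ∀ k, ε ≤ ‖colParam y s k - w‖) ∨ b = false) →
        ‖rowG y s w θ k b j t j'‖ * (1 + ‖colParam y s k‖) ^ j'.toNat *
            min 1 ‖y k - x‖ ^ b.toNat ≤
          c * (1 + ‖y k‖) ^ j.toNat * min 1 ‖y k - x‖ ^ t.toNat := by
  obtain ⟨C₁, hC₁, h₁⟩ := exists_norm_sub_mul_le hxw
  obtain ⟨C₂, hC₂, h₂⟩ := exists_norm_sub_le hxw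
  obtain ⟨C₃, hC₃, h₃⟩ : ∃ C₃ : ℝ, 0 ≤ C₃ ∧
      ((∃ ε : ℝ, 0 < ε ∧ ∀ k, ε ≤ ‖colParam y s k - w‖) →
        ∀ k, 1 + ‖colParam y s k‖ ≤ C₃ * ‖colParam y s k - w‖) := by
    by_cases h : ∃ ε : ℝ, 0 < ε ∧ ∀ k, ε ≤ ‖colParam y s k - w‖
    · obtain ⟨ε, hε, h⟩ := h
      exact ⟨(1 + ‖w‖) / ε + 1, by positivity, fun _ k => one_add_norm_le hε (h k)⟩
    · exact ⟨0, le_rfl, fun h' => absurd h' h⟩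
  set c₀ := 2 + ‖w‖ + ‖θ ^ (-2 : ℤ) * w‖ with hc₀
  refine ⟨c₀ * C₃ + C₁ + C₂ + 1, by positivity, fun k b j t j' hb => ?_⟩
  have hv := norm_vertex_le w (θ ^ (-2 : ℤ) * w) (y k) (colParam y s k) b j t j'
  have hk₁ := h₁ (y k) (colParam y s k) (hratio k)
  have hk₂ := h₂ (y k) (colParam y s k) (hratio k)
  have hD : 0 < ‖colParam y s k - w‖ := norm_pos_iff.2 (hw k)
  rw [rowG, vertexRow, norm_mul, norm_inv]
  have hη0 : 0 ≤ min 1 ‖y k - x‖ := by positivity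
  have hη1 : min 1 ‖y k - x‖ ≤ 1 := min_le_left _ _
  have h3k : (∃ ε : ℝ, 0 < ε ∧ ∀ k, ε ≤ ‖colParam y s k - w‖) →
    1 + ‖colParam y s k‖ ≤ C₃ * ‖colParam y s k - w‖ := fun h => h₃ h k
  generalize min 1 ‖y k - x‖ = η at *
  set q := y k
  set q' := colParam y s k
  set D := ‖q' - w‖
  set p' := θ ^ (-2 : ℤ) * w
  have hq := norm_nonneg q
  have hq' := norm_nonneg q'
  rw [mul_assoc, mul_assoc, ← div_eq_inv_mul, div_le_iff₀ hD]
  have triv : ‖(0 : ℂ)‖ * ((1 + ‖q'‖) ^ j'.toNat * η ^ b.toNat) ≤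
      (c₀ * C₃ + C₁ + C₂ + 1) * (1 + ‖q‖) ^ j.toNat * η ^ t.toNat * D := by
    rw [norm_zero, zero_mul]
    positivity
  by_cases hbt : b = false ∧ t = true
  · obtain ⟨rfl, rfl⟩ := hbt
    cases j <;> cases j' <;> simp only [vertex] <;> try exact triv
    simp only [Bool.toNat_true, Bool.toNat_false, pow_zero, pow_one, mul_one]
    calc _ ≤ _ := hk₂
      _ = C₂ * ((1 + ‖q‖) * η * D) := by ring
      _ ≤ (c₀ * C₃ + C₁ + C₂ + 1) * ((1 + ‖q‖) * η * D) := by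
          gcongr
          have : 0 ≤ c₀ * C₃ := by positivity
          linarith
      _ = _ := by ring
  · have hηbt : η ^ b.toNat ≤ η ^ t.toNat := by
      cases b <;> cases t <;> simp at hbt ⊢
      exact hη1
    by_cases haway : ∃ ε : ℝ, 0 < ε ∧ ∀ k, ε ≤ ‖colParam y s k - w‖
    · have h3 := h3k haway
      calc _ = (‖vertex w p' q q' b j t j'‖ * (1 + ‖q'‖) ^ j'.toNat) * η ^ b.toNat := by ring
        _ ≤ (c₀ * (1 + ‖q‖) ^ j.toNat * (C₃ * D)) * η ^ t.toNat := by
            refine mul_le_mul (hv.trans ?_) hηbt (by positivity) (by positivity)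
            gcongr
        _ = (c₀ * C₃) * ((1 + ‖q‖) ^ j.toNat * η ^ t.toNat * D) := by ring
        _ ≤ (c₀ * C₃ + C₁ + C₂ + 1) * ((1 + ‖q‖) ^ j.toNat * η ^ t.toNat * D) := by
            gcongr
            linarith
        _ = _ := by ring
    · obtain rfl := hb.resolve_left haway
      have hcC : 0 ≤ c₀ * C₃ := by positivity
      have ht : t = false := by
        cases t
        · rfl
        · exact absurd ⟨rfl, rfl⟩ hbt
      subst ht
      cases j <;> cases j' <;> simp only [vertex] <;> try exact triv
      · simp only [Bool.toNat_false, pow_zero, mul_one]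
        exact le_mul_of_one_le_left hD.le (by linarith)
      · simp only [Bool.toNat_true, Bool.toNat_false, pow_zero, pow_one, mul_one]
        refine hk₁.trans ?_
        gcongr
        linarith

/-- Here the vertical gauge lies between two positive constants and costs only the factor `1 / e`.
The quotient of the horizontal gauges comes from the normalization by `y - x` in place of `s⁻²y -
x`. -/
theorem exists_rowF_le {x₀ x r : ℂ} {y s : ℕ → ℂ}
    (haway : ∃ ε : ℝ, 0 < ε ∧ ∀ k, ε ≤ ‖y k - x‖) (haway₀ : ∃ ε : ℝ, 0 < ε ∧ ∀ k, ε ≤ ‖y k - x₀‖) :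
    ∃ c : ℝ, 0 ≤ c ∧ ∀ k b j t j',
      ‖rowF y s x r k b j t j'‖ * (1 + ‖colParam y s k‖) ^ j'.toNat *
          min 1 ‖y k - x₀‖ ^ b.toNat ≤
        c * ((1 + ‖colParam y s k‖) / (1 + ‖y k‖)) * (1 + ‖y k‖) ^ j.toNat *
          min 1 ‖y k - x₀‖ ^ t.toNat := by
  obtain ⟨ε, hε, h⟩ := haway
  obtain ⟨ε₀, hε₀, h₀⟩ := haway₀
  set c₀ := 2 + ‖x‖ + ‖r ^ (-2 : ℤ) * x‖ with hc₀
  set C₃ := (1 + ‖x‖) / ε + 1 with hC₃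
  set e := min 1 ε₀ with he
  have he0 : 0 < e := by positivity
  refine ⟨c₀ * C₃ / e, by positivity, fun k b j t j' => ?_⟩
  have hv := norm_vertex_le x (r ^ (-2 : ℤ) * x) (y k) (colParam y s k) b j t j'
  have h3 := one_add_norm_le hε (h k)
  have hD : 0 < ‖y k - x‖ := hε.trans_le (h k)
  have hη : e ≤ min 1 ‖y k - x₀‖ := min_le_min le_rfl (h₀ k)
  have hη1 : min 1 ‖y k - x₀‖ ≤ 1 := min_le_left _ _
  rw [rowF, vertexRow, norm_mul, norm_inv]
  generalize min 1 ‖y k - x₀‖ = η at *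
  have hη0 : 0 ≤ η := he0.le.trans hη
  set q := y k
  set q' := colParam y s k
  set D := ‖q - x‖
  set p' := r ^ (-2 : ℤ) * x
  have hq := norm_nonneg q
  have hq' := norm_nonneg q'
  rw [mul_assoc, mul_assoc, ← div_eq_inv_mul, div_le_iff₀ hD]
  have hηbt : e * η ^ b.toNat ≤ η ^ t.toNat := by
    cases b <;> cases t <;> simp only [Bool.toNat_true, Bool.toNat_false, pow_zero, pow_one] <;>
      nlinarith
  have h4 : (1 + ‖q'‖) * 1 ≤ (1 + ‖q'‖) / (1 + ‖q‖) * (C₃ * D) := by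
    rw [div_mul_eq_mul_div, le_div_iff₀ (by positivity)]
    rw [mul_one]
    gcongr
  rw [div_mul_eq_mul_div, div_mul_eq_mul_div, div_mul_eq_mul_div, div_mul_eq_mul_div,
    le_div_iff₀ he0]
  calc _ = (‖vertex x p' q q' b j t j'‖ * (1 + ‖q'‖) ^ j'.toNat) * (e * η ^ b.toNat) := by ring
    _ ≤ (c₀ * (1 + ‖q‖) ^ j.toNat * ((1 + ‖q'‖) / (1 + ‖q‖) * (C₃ * D))) * η ^ t.toNat := by
        refine mul_le_mul (hv.trans ?_) hηbt (by positivity) (by positivity)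
        rw [mul_one] at h4
        gcongr
    _ = _ := by ring

/-- A single row has an empty top edge. Among the remaining vertices only `(0, 0; 0, 0)` and `(1, 0;
0, 1)` have `y - x` as a denominator: the ratio hypothesis controls the first and the vertical gauge
the second, so `y` may approach `x`. -/
theorem exists_rowF_le_of_top {x r w : ℂ} {y s : ℕ → ℂ} (hxw : x ≠ w) (hx : ∀ k, y k - x ≠ 0)
    (hratio : ∀ k, ‖colParam y s k - x‖ * ‖y k - w‖ ≤ ‖y k - x‖ * ‖colParam y s k - w‖) :
    ∃ c : ℝ, 0 ≤ c ∧ ∀ k b j j',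
      ‖rowF y s x r k b j false j'‖ * (1 + ‖colParam y s k‖) ^ j'.toNat *
          min 1 ‖y k - x‖ ^ b.toNat ≤
        c * ((1 + ‖colParam y s k‖) / (1 + ‖y k‖)) * (1 + ‖y k‖) ^ j.toNat := by
  obtain ⟨C₁, hC₁, h₁⟩ := exists_norm_sub_mul_le hxw.symm
  refine ⟨C₁ + 1 + ‖r ^ (-2 : ℤ) * x - x‖ * (2 + ‖x‖), by positivity, fun k b j j' => ?_⟩
  have hD : 0 < ‖y k - x‖ := norm_pos_iff.2 (hx k)
  have hk := h₁ (colParam y s k) (y k) (by linarith [hratio k])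
  rw [rowF, vertexRow, norm_mul, norm_inv]
  have hη0 : 0 ≤ min 1 ‖y k - x‖ := by positivity
  have hη : min 1 ‖y k - x‖ * (1 + ‖y k‖) ≤ (2 + ‖x‖) * ‖y k - x‖ := by
    have h1 : ‖y k‖ ≤ ‖y k - x‖ + ‖x‖ := by simpa using norm_add_le (y k - x) x
    have hx := norm_nonneg x
    rcases le_total 1 ‖y k - x‖ with h | h
    · rw [min_eq_left h]
      nlinarith
    · rw [min_eq_right h]
      nlinarith
  generalize min 1 ‖y k - x‖ = η at *
  set q := y k
  set q' := colParam y s k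
  set D := ‖q - x‖
  set c := ‖r ^ (-2 : ℤ) * x - x‖
  have hq := norm_nonneg q
  have hq' := norm_nonneg q'
  have hc : 0 ≤ c * (2 + ‖x‖) := by positivity
  have hQ : 0 < 1 + ‖q‖ := by positivity
  rw [mul_assoc, mul_assoc, ← div_eq_inv_mul, div_le_iff₀ hD, mul_div_assoc', div_mul_eq_mul_div,
    div_mul_eq_mul_div, le_div_iff₀ hQ]
  have triv : ‖(0 : ℂ)‖ * ((1 + ‖q'‖) ^ j'.toNat * η ^ b.toNat) * (1 + ‖q‖) ≤
      (C₁ + 1 + c * (2 + ‖x‖)) * (1 + ‖q'‖) * (1 + ‖q‖) ^ j.toNat * D := by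
    rw [norm_zero, zero_mul, zero_mul]
    positivity
  cases b <;> cases j <;> cases j' <;> simp only [vertex] <;> try exact triv
  all_goals simp only [Bool.toNat_true, Bool.toNat_false, pow_zero, pow_one, mul_one]
  · refine hk.trans ?_
    gcongr
    linarith
  · calc _ = 1 * ((1 + ‖q'‖) * (1 + ‖q‖) * D) := by ring
      _ ≤ (C₁ + 1 + c * (2 + ‖x‖)) * ((1 + ‖q'‖) * (1 + ‖q‖) * D) := by
          gcongr
          linarith
      _ = _ := by ring
  · calc _ = c * (1 + ‖q'‖) * (η * (1 + ‖q‖)) := by ring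
      _ ≤ c * (1 + ‖q'‖) * ((2 + ‖x‖) * D) := by gcongr
      _ = (c * (2 + ‖x‖)) * ((1 + ‖q'‖) * D) := by ring
      _ ≤ (C₁ + 1 + c * (2 + ‖x‖)) * ((1 + ‖q'‖) * D) := by
          gcongr
          linarith
      _ = _ := by ring

theorem exists_uniform {ι : Type*} [Fintype ι] {P : ι → ℝ → Prop} (h : ∀ i, ∃ c, 0 ≤ c ∧ P i c)
    (hmono : ∀ i c c', c ≤ c' → P i c → P i c') : ∃ c, 0 ≤ c ∧ ∀ i, P i c := by
  choose c hc hP using h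
  refine ⟨∑ i, c i, Finset.sum_nonneg fun i _ => hc i, fun i => hmono i _ _ ?_ (hP i)⟩
  exact Finset.single_le_sum (fun i _ => hc i) (Finset.mem_univ i)

theorem col_singleton {R : Type*} [CommSemiring R] (k : ℕ) (V : RowWeight R) (b j t j' : Bool) :
    col k [V] b [j] t [j'] = V k b j t j' := by
  simp only [col, Fintype.sum_bool]
  cases t <;> simp

theorem count_singleton (j : Bool) : [j].count true = j.toNat := by
  cases j <;> rfl

/-- The hypotheses of the Cauchy identities on the parameters. -/
structure Admissible {M N : ℕ} (x : Fin M → ℂ) (w : Fin N → ℂ) (y s : ℕ → ℂ) : Prop where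
  ne_x : ∀ i k, y k - x i ≠ 0
  ne_w : ∀ j k, colParam y s k - w j ≠ 0
  ratio : ∃ ρ : ℝ, 0 ≤ ρ ∧ ρ < 1 ∧ ∀ i j k, ‖colParam y s k - x i‖ * ‖y k - w j‖ ≤
    ρ * (‖y k - x i‖ * ‖colParam y s k - w j‖)
  x_away : 2 ≤ M → ∀ i, ∃ ε : ℝ, 0 < ε ∧ ∀ k, ε ≤ ‖y k - x i‖
  w_away : 2 ≤ N → ∀ j, ∃ ε : ℝ, 0 < ε ∧ ∀ k, ε ≤ ‖colParam y s k - w j‖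

variable {M N : ℕ} {x : Fin M → ℂ} {w : Fin N → ℂ} {y s : ℕ → ℂ}

theorem Admissible.ratio_le (h : Admissible x w y s) (i : Fin M) (j : Fin N) (k : ℕ) :
    ‖colParam y s k - x i‖ * ‖y k - w j‖ ≤ ‖y k - x i‖ * ‖colParam y s k - w j‖ := by
  obtain ⟨ρ, _, hρ1, hr⟩ := h.ratio
  refine (hr i j k).trans (mul_le_of_le_one_left (by positivity) hρ1.le)

/-- For `x i = w j` the ratio would be equal to `1`. -/
theorem Admissible.x_ne_w (h : Admissible x w y s) (i : Fin M) (j : Fin N) : x i ≠ w j := by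
  intro hij
  obtain ⟨ρ, _, hρ1, hr⟩ := h.ratio
  have h1 := hr i j 0
  have h2 : 0 < ‖y 0 - x i‖ * ‖colParam y s 0 - w j‖ :=
    mul_pos (norm_pos_iff.2 (h.ne_x i 0)) (norm_pos_iff.2 (h.ne_w j 0))
  rw [← hij] at h1 h2
  nlinarith

/-- A single row only has vertices with empty bottom edge, so the distance from `w` is needed only
for `N ≥ 2`, where inner vertical edges may be occupied. -/
theorem Admissible.exists_blockG_le (h : Admissible x w y s) (hM : 1 ≤ M) (hN : 1 ≤ N)
    (θ : Fin N → ℂ) : ∃ C : ℝ, 0 ≤ C ∧ ∀ k v σ σ', σ.length = N → σ'.length = N →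
      col k ((List.ofFn fun j => rowG y s (w j) (θ j)).map absRow) false σ v σ' *
          (1 + ‖colParam y s k‖) ^ σ'.count true ≤
        C * (1 + ‖y k‖) ^ σ.count true * min 1 ‖y k - x ⟨0, hM⟩‖ ^ v.toNat := by
  obtain ⟨c, hc, hb⟩ := exists_uniform (fun j => exists_rowG_le (θ := θ j) (h.x_ne_w ⟨0, hM⟩ j)
    (h.ne_w j) (h.ratio_le ⟨0, hM⟩ j)) (fun j c c' hcc' hP k b i t i' hb =>
      (hP k b i t i' hb).trans (by gcongr))
  rcases Nat.lt_or_ge N 2 with hN2 | hN2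
  · obtain rfl : N = 1 := by omega
    refine ⟨c, hc, fun k v σ σ' hσ hσ' => ?_⟩
    obtain ⟨j, rfl⟩ := List.length_eq_one_iff.1 hσ
    obtain ⟨j', rfl⟩ := List.length_eq_one_iff.1 hσ'
    have := hb 0 k false j v j' (Or.inr rfl)
    simp only [Bool.toNat_false, pow_zero, mul_one] at this
    simp only [List.ofFn_succ, List.ofFn_zero, List.map_cons, List.map_nil, col_singleton,
      count_singleton]
    exact this
  · refine ⟨(2 * c) ^ N, by positivity, fun k v σ σ' hσ hσ' => ?_⟩
    have := col_weighted_le k (List.ofFn fun j => rowG y s (w j) (θ j))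
      (Q := 1 + ‖y k‖) (Q' := 1 + ‖colParam y s k‖) (η := min 1 ‖y k - x ⟨0, hM⟩‖) (c := c)
      (by positivity) (by positivity) (by positivity) hc (fun V hV b j t j' => by
        obtain ⟨i, rfl⟩ := (List.mem_ofFn' _ _).1 hV
        exact hb i k b j t j' (Or.inl (h.w_away hN2 i))) false v σ σ'
    simpa using this

theorem Admissible.exists_blockF_le (h : Admissible x w y s) (hM : 1 ≤ M) (hN : 1 ≤ N)
    (r : Fin M → ℂ) : ∃ C : ℝ, 0 ≤ C ∧ ∀ k v σ σ', σ.length = M → σ'.length = M →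
      col k ((List.ofFn fun i => rowF y s (x i) (r i)).map absRow) v σ false σ' *
          (1 + ‖colParam y s k‖) ^ σ'.count true * min 1 ‖y k - x ⟨0, hM⟩‖ ^ v.toNat ≤
        C * ((1 + ‖colParam y s k‖) / (1 + ‖y k‖)) ^ M * (1 + ‖y k‖) ^ σ.count true := by
  rcases Nat.lt_or_ge M 2 with hM2 | hM2
  · obtain rfl : M = 1 := by omega
    obtain ⟨c, hc, hb⟩ := exists_rowF_le_of_top (r := r 0) (h.x_ne_w 0 ⟨0, hN⟩) (h.ne_x 0)
      (h.ratio_le 0 ⟨0, hN⟩)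
    refine ⟨c, hc, fun k v σ σ' hσ hσ' => ?_⟩
    obtain ⟨j, rfl⟩ := List.length_eq_one_iff.1 hσ
    obtain ⟨j', rfl⟩ := List.length_eq_one_iff.1 hσ'
    simp only [List.ofFn_succ, List.ofFn_zero, List.map_cons, List.map_nil, col_singleton,
      count_singleton, pow_one]
    exact hb k v j j'
  · obtain ⟨c, hc, hb⟩ := exists_uniform (fun i => exists_rowF_le (s := s) (r := r i)
      (h.x_away hM2 i) (h.x_away hM2 ⟨0, hM⟩)) (fun j c c' hcc' hP k b i t i' =>
      (hP k b i t i').trans (by gcongr))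
    refine ⟨(2 * c) ^ M, by positivity, fun k v σ σ' hσ hσ' => ?_⟩
    have := col_weighted_le k (List.ofFn fun j => rowF y s (x j) (r j))
      (Q := 1 + ‖y k‖) (Q' := 1 + ‖colParam y s k‖) (η := min 1 ‖y k - x ⟨0, hM⟩‖)
      (c := c * ((1 + ‖colParam y s k‖) / (1 + ‖y k‖)))
      (by positivity) (by positivity) (by positivity) (by positivity) (fun V hV b j t j' => by
        obtain ⟨i, rfl⟩ := (List.mem_ofFn' _ _).1 hV
        exact hb i k b j t j') v false σ σ'
    simp only [List.length_ofFn, Bool.toNat_false, pow_zero, mul_one] at this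
    rw [← mul_assoc, mul_pow] at this
    exact this

/-- The rows with weights `W` below the rows with weights `Ŵ`. -/
noncomputable def cauchyRows (x r : Fin M → ℂ) (w θ : Fin N → ℂ) (y s : ℕ → ℂ) :
    List (RowWeight ℂ) :=
  (List.ofFn fun j => rowG y s (w j) (θ j)) ++ List.ofFn fun i => rowF y s (x i) (r i)

theorem conservative_of_mem_cauchyRows {r : Fin M → ℂ} {θ : Fin N → ℂ} {V : RowWeight ℝ}
    (hV : V ∈ (cauchyRows x r w θ y s).map absRow) : Conservative V := by
  obtain ⟨V', hV', rfl⟩ := List.mem_map.1 hV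
  refine absRow_conservative ?_
  rcases List.mem_append.1 hV' with h | h
  · obtain ⟨i, rfl⟩ := (List.mem_ofFn' _ _).1 h
    exact vertexRow_conservative _ _ _ _ _
  · obtain ⟨i, rfl⟩ := (List.mem_ofFn' _ _).1 h
    exact vertexRow_conservative _ _ _ _ _

theorem col_cauchyRows (k : ℕ) (r : Fin M → ℂ) (θ : Fin N → ℂ) {σ₁ σ₁' : List Bool}
    (σ₂ σ₂' : List Bool) (h₁ : σ₁.length = N) (h₁' : σ₁'.length = N) :
    col k ((cauchyRows x r w θ y s).map absRow) false (σ₁ ++ σ₂) false (σ₁' ++ σ₂') =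
      ∑ v, col k ((List.ofFn fun j => rowG y s (w j) (θ j)).map absRow) false σ₁ v σ₁' *
        col k ((List.ofFn fun i => rowF y s (x i) (r i)).map absRow) v σ₂ false σ₂' := by
  rw [cauchyRows, List.map_append, col_append _ _ _ _ _ _ _ _ _ (by simpa using h₁)
    (by simpa using h₁')]

theorem exists_append {N M : ℕ} {σ : List Bool} (h : σ.length = N + M) :
    ∃ σ₁ σ₂, σ = σ₁ ++ σ₂ ∧ σ₁.length = N ∧ σ₂.length = M :=
  ⟨σ.take N, σ.drop N, (List.take_append_drop N σ).symm, by rw [List.length_take]; omega,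
    by rw [List.length_drop]; omega⟩

/-- Away from the boundary paths the column weights are uniformly bounded. -/
theorem Admissible.exists_col_le (h : Admissible x w y s) (hM : 1 ≤ M) (hN : 1 ≤ N)
    (r : Fin M → ℂ) (θ : Fin N → ℂ) : ∃ C : ℝ, ∀ k σ σ', σ.length = N + M →
      σ'.length = N + M → σ.count true = M → σ'.count true = M →
      col k ((cauchyRows x r w θ y s).map absRow) false σ false σ' ≤ C := by
  obtain ⟨C₁, hC₁, h₁⟩ := h.exists_blockG_le hM hN θ
  obtain ⟨C₂, hC₂, h₂⟩ := h.exists_blockF_le hM hN r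
  refine ⟨2 * (C₁ * C₂), fun k σ σ' hσ hσ' hc hc' => ?_⟩
  obtain ⟨σ₁, σ₂, rfl, l₁, l₂⟩ := exists_append hσ
  obtain ⟨σ₁', σ₂', rfl, l₁', l₂'⟩ := exists_append hσ'
  rw [List.count_append] at hc hc'
  rw [col_cauchyRows k r θ σ₂ σ₂' l₁ l₁']
  have hη : 0 < min 1 ‖y k - x ⟨0, hM⟩‖ :=
    lt_min one_pos (norm_pos_iff.2 (h.ne_x _ _))
  have term : ∀ v, col k ((List.ofFn fun j => rowG y s (w j) (θ j)).map absRow) false σ₁ v σ₁' *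
        col k ((List.ofFn fun i => rowF y s (x i) (r i)).map absRow) v σ₂ false σ₂' ≤ C₁ * C₂ := by
    intro v
    have e₁ := h₁ k v σ₁ σ₁' l₁ l₁'
    have e₂ := h₂ k v σ₂ σ₂' l₂ l₂'
    have n₁ := col_absRow_nonneg k (List.ofFn fun j => rowG y s (w j) (θ j)) false v σ₁ σ₁'
    have n₂ := col_absRow_nonneg k (List.ofFn fun i => rowF y s (x i) (r i)) v false σ₂ σ₂'
    generalize col k ((List.ofFn fun j => rowG y s (w j) (θ j)).map absRow) false σ₁ v σ₁' = a
      at *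
    generalize col k ((List.ofFn fun i => rowF y s (x i) (r i)).map absRow) v σ₂ false σ₂' = b
      at *
    generalize min 1 ‖y k - x ⟨0, hM⟩‖ = η at *
    have hq := norm_nonneg (y k)
    have hq' := norm_nonneg (colParam y s k)
    set Q := 1 + ‖y k‖
    set Q' := 1 + ‖colParam y s k‖
    have hQ : 0 < Q := by positivity
    have hQ' : 0 < Q' := by positivity
    have := mul_le_mul e₁ e₂ (by positivity) (by positivity)
    -- Both blocks together carry exactly `M` paths on either side, so all gauge factors cancel,
    -- including `(Q' / Q) ^ M`.
    have e : C₁ * Q ^ List.count true σ₁ * η ^ v.toNat *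
        (C₂ * (Q' / Q) ^ M * Q ^ List.count true σ₂) = C₁ * C₂ * (Q' ^ M * η ^ v.toNat) := by
      calc _ = C₁ * C₂ * ((Q' / Q) ^ M * Q ^ (List.count true σ₁ + List.count true σ₂) *
            η ^ v.toNat) := by rw [pow_add]; ring
        _ = _ := by rw [hc, div_pow, div_mul_cancel₀ _ (by positivity)]
    have e' : a * Q' ^ List.count true σ₁' * (b * Q' ^ List.count true σ₂' * η ^ v.toNat) =
        a * b * (Q' ^ M * η ^ v.toNat) := by
      rw [← hc', pow_add]; ring
    rw [e, e'] at this
    exact le_of_mul_le_mul_right this (by positivity)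
  rw [Fintype.sum_bool, two_mul]
  exact add_le_add (term _) (term _)

end ColumnBounds

end FreeFermionSixVertex

namespace FreeFermionSixVertex

/-! ### Convergence and the exchange of the two blocks. -/

section Convergence

open Topology

variable {M N : ℕ} {x : Fin M → ℂ} {w : Fin N → ℂ} {y s : ℕ → ℂ}

theorem eq_replicate_false {σ : List Bool} (h : σ.count true = 0) :
    σ = List.replicate σ.length false := by
  refine List.eq_replicate_iff.2 ⟨rfl, fun b hb => ?_⟩
  cases b
  · rfl
  · exact absurd hb (List.count_eq_zero.1 h)

theorem eq_replicate_true {σ : List Bool} (h : σ.count true = σ.length) :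
    σ = List.replicate σ.length true :=
  List.eq_replicate_iff.2 ⟨rfl, fun b hb => (List.count_eq_length.1 h b hb).symm⟩

theorem count_false_add_count_true (σ : List Bool) :
    σ.count false + σ.count true = σ.length := by
  induction σ with
  | nil => rfl
  | cons b σ ih =>
    cases b <;> simp <;> omega

/-- The states of the horizontal edges far to the right on the left side of the Cauchy identity. -/
def target (N M : ℕ) : List Bool := List.replicate N false ++ List.replicate M true

theorem count_target (N M : ℕ) : (target N M).count true = M := by
  simp [target, List.count_replicate]

theorem length_target (N M : ℕ) : (target N M).length = N + M := by
  simp [target]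

/-- With `M` paths in total, there are as many occupied rows in the lower block as empty rows in the
upper one. Pairing them, each pair contributes one of the ratios of the hypothesis. -/
theorem Admissible.col_diagonal_le_pow (h : Admissible x w y s) (hM : 1 ≤ M) (hN : 1 ≤ N)
    (r : Fin M → ℂ) (θ : Fin N → ℂ) : ∃ ρ : ℝ, 0 ≤ ρ ∧ ρ < 1 ∧ ∀ k (σ₁ σ₂ : List Bool),
      σ₁.length = N → σ₂.length = M → (σ₁ ++ σ₂).count true = M →
      col k ((cauchyRows x r w θ y s).map absRow) false (σ₁ ++ σ₂) false (σ₁ ++ σ₂) ≤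
        ρ ^ σ₁.count true := by
  obtain ⟨ρ, hρ0, hρ1, hr⟩ := h.ratio
  refine ⟨ρ, hρ0, hρ1, fun k σ₁ σ₂ l₁ l₂ hc => ?_⟩
  rw [List.count_append] at hc
  have hf := count_false_add_count_true σ₂
  rw [col_cauchyRows k r θ σ₂ σ₂ l₁ l₁, Fintype.sum_bool]
  have hz : col k ((List.ofFn fun i => rowF y s (x i) (r i)).map absRow) true σ₂ false σ₂ = 0 := by
    by_contra hne
    have := (col_triangular (fun V hV => by
      obtain ⟨V', hV', rfl⟩ := List.mem_map.1 hV
      obtain ⟨i, rfl⟩ := (List.mem_ofFn' _ _).1 hV'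
      exact absRow_conservative (vertexRow_conservative _ _ _ _ _)) hne).1
    simp at this
  rw [hz, mul_zero, zero_add]
  have : Nonempty (Fin N) := ⟨⟨0, hN⟩⟩
  have : Nonempty (Fin M) := ⟨⟨0, hM⟩⟩
  -- The pairing is avoided by bounding each block by its largest factor: the product of the two
  -- maxima is itself a ratio for some `(i, j)`.
  obtain ⟨j, hj⟩ := Finite.exists_max fun j => ‖y k - w j‖ / ‖colParam y s k - w j‖
  obtain ⟨i, hi⟩ := Finite.exists_max fun i => ‖colParam y s k - x i‖ / ‖y k - x i‖
  have b₁ := col_diagonal_le k (List.ofFn fun j => rowG y s (w j) (θ j)) (α := 1)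
    (β := ‖y k - w j‖ / ‖colParam y s k - w j‖) (fun V hV => by
      obtain ⟨i, rfl⟩ := (List.mem_ofFn' _ _).1 hV
      exact vertexRow_conservative _ _ _ _ _) zero_le_one (by positivity) (fun V hV => by
      obtain ⟨i, rfl⟩ := (List.mem_ofFn' _ _).1 hV
      simp only [rowG, vertexRow, vertex, inv_mul_cancel₀ (h.ne_w i k), norm_one, le_refl])
      (fun V hV => by
      obtain ⟨i, rfl⟩ := (List.mem_ofFn' _ _).1 hV
      simp only [rowG, vertexRow, vertex, norm_mul, norm_inv]
      rw [← div_eq_inv_mul]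
      exact hj i) σ₁
  have b₂ := col_diagonal_le k (List.ofFn fun i => rowF y s (x i) (r i)) (β := 1)
    (α := ‖colParam y s k - x i‖ / ‖y k - x i‖) (fun V hV => by
      obtain ⟨i, rfl⟩ := (List.mem_ofFn' _ _).1 hV
      exact vertexRow_conservative _ _ _ _ _) (by positivity) zero_le_one (fun V hV => by
      obtain ⟨i', rfl⟩ := (List.mem_ofFn' _ _).1 hV
      simp only [rowF, vertexRow, vertex, norm_mul, norm_inv]
      rw [← div_eq_inv_mul]
      exact hi i') (fun V hV => by
      obtain ⟨i, rfl⟩ := (List.mem_ofFn' _ _).1 hV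
      simp only [rowF, vertexRow, vertex, inv_mul_cancel₀ (h.ne_x i k), norm_one, le_refl]) σ₂
  rw [one_pow, mul_one] at b₁
  rw [one_pow, one_mul, show σ₂.count false = σ₁.count true by omega] at b₂
  refine (mul_le_mul b₁ b₂ (col_absRow_nonneg _ _ _ _ _ _) (by positivity)).trans ?_
  rw [← mul_pow]
  refine pow_le_pow_left₀ (by positivity) ?_ _
  have p₁ : 0 < ‖colParam y s k - w j‖ := norm_pos_iff.2 (h.ne_w j k)
  have p₂ : 0 < ‖y k - x i‖ := norm_pos_iff.2 (h.ne_x i k)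
  rw [div_mul_div_comm, div_le_iff₀ (by positivity)]
  linarith [hr i j k]

/-- Convergence of the partition functions of the first `K` columns. -/
theorem Admissible.converges (h : Admissible x w y s) (hM : 1 ≤ M) (hN : 1 ≤ N)
    (r : Fin M → ℂ) (θ : Fin N → ℂ) {a b : Finset ℕ} {K₀ : ℕ} (ha : a ⊆ Finset.range K₀)
    (hb : b ⊆ Finset.range K₀) (σ₀ : List Bool) :
    (∀ σ : List Bool, σ.length = N + M → σ.count true = M → σ ≠ target N M →
      Tendsto (fun K => strip (cauchyRows x r w θ y s) (ind a) (ind b) σ₀ K σ) atTop (𝓝 0)) ∧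
    ∃ c : ℝ, ∀ K, K₀ ≤ K →
      strip ((cauchyRows x r w θ y s).map absRow) (ind a) (ind b) σ₀ K (target N M) ≤ c := by
  obtain ⟨ρ, hρ0, hρ1, hdiag⟩ := h.col_diagonal_le_pow hM hN r θ
  obtain ⟨C, hC⟩ := h.exists_col_le hM hN r θ
  have hlen : (cauchyRows x r w θ y s).length = N + M := by simp [cauchyRows]
  -- The recurrence starts at column `K₀`, from which on the bottom and top edges are empty.
  obtain ⟨h1, c, h2⟩ := summable_of_triangular (n := N + M) (M := M) (g := target N M)
    (v := fun K σ => strip ((cauchyRows x r w θ y s).map absRow) (ind a) (ind b) σ₀ (K + K₀) σ)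
    (T := fun K σ σ' => col (K + K₀) ((cauchyRows x r w θ y s).map absRow) false σ false σ')
    (C := C) hρ0 hρ1 (fun K σ => strip_absRow_nonneg _ _ _ _ _ _)
    (fun K σ' => by
      rw [show K + 1 + K₀ = (K + K₀) + 1 by ring, strip,
        ind_of_subset_range ha (Nat.le_add_left _ _), ind_of_subset_range hb (Nat.le_add_left _ _),
        List.length_map, hlen])
    (fun K σ σ' hne => by
      obtain ⟨e1, _, e3⟩ := col_triangular (fun V hV => conservative_of_mem_cauchyRows hV) hne
      exact ⟨by simpa using e1.symm, e3 rfl⟩)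
    (fun K σ hσ hc hne => by
      obtain ⟨σ₁, σ₂, rfl, l₁, l₂⟩ := exists_append (mem_states.1 hσ)
      refine (hdiag (K + K₀) σ₁ σ₂ l₁ l₂ hc).trans ?_
      refine pow_le_of_le_one hρ0 hρ1.le fun h0 => hne ?_
      rw [List.count_append, h0, zero_add] at hc
      rw [target, eq_replicate_false h0, eq_replicate_true (hc.trans l₂.symm), l₁, l₂])
    (fun K => by
      refine (hdiag (K + K₀) _ _ (by simp) (by simp) (count_target N M)).trans ?_
      exact pow_le_one₀ hρ0 hρ1.le)
    (mem_states.2 (length_target N M)) (count_target N M)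
    (fun σ hσ hc => height_le_ground (mem_states.1 hσ) hc)
    (fun K σ hσ σ' hσ' hc hc' => hC _ _ _ (mem_states.1 hσ) (mem_states.1 hσ') hc hc')
  refine ⟨fun σ hσ hc hne => ?_, c, fun K hK => ?_⟩
  · have ht := (h1 σ (mem_states.2 hσ) hc hne).tendsto_atTop_zero
    rw [tendsto_add_atTop_iff_nat (f := fun K =>
      strip ((cauchyRows x r w θ y s).map absRow) (ind a) (ind b) σ₀ K σ)] at ht
    exact squeeze_zero_norm (fun K => norm_strip_le _ _ _ _ _ _) ht
  · obtain ⟨d, rfl⟩ := Nat.exists_eq_add_of_le hK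
    rw [add_comm]
    exact h2 d

theorem strip_cauchyRows (r : Fin M → ℂ) (θ : Fin N → ℂ) (A B : ℕ → Bool) (K : ℕ) :
    strip (cauchyRows x r w θ y s) A B (List.replicate (N + M) false) K (target N M) =
      ∑ ν ∈ (Finset.range K).powerset,
        strip (List.ofFn fun j => rowG y s (w j) (θ j)) A (ind ν) (List.replicate N false) K
          (List.replicate N false) *
        strip (List.ofFn fun i => rowF y s (x i) (r i)) (ind ν) B (List.replicate M false) K
          (List.replicate M true) := by
  rw [List.replicate_add, cauchyRows, target, strip_append _ _ _ _ (by simp) _ (by simp)]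

theorem norm_strip_cauchyRows_le (r : Fin M → ℂ) (θ : Fin N → ℂ) (A B : ℕ → Bool) (K : ℕ) :
    ∑ ν ∈ (Finset.range K).powerset,
        ‖strip (List.ofFn fun j => rowG y s (w j) (θ j)) A (ind ν) (List.replicate N false) K
          (List.replicate N false) *
        strip (List.ofFn fun i => rowF y s (x i) (r i)) (ind ν) B (List.replicate M false) K
          (List.replicate M true)‖ ≤
      strip ((cauchyRows x r w θ y s).map absRow) A B (List.replicate (N + M) false) K
        (target N M) := by
  rw [List.replicate_add, cauchyRows, target, List.map_append,
    strip_append _ _ _ _ (by simp) _ (by simp)]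
  refine Finset.sum_le_sum fun ν _ => ?_
  rw [norm_mul]
  exact mul_le_mul (norm_strip_le _ _ _ _ _ _) (norm_strip_le _ _ _ _ _ _) (norm_nonneg _)
    (strip_absRow_nonneg _ _ _ _ _ _)

theorem subset_range_sup (t : Finset (Finset ℕ)) (K₀ : ℕ) :
    ∃ K, K₀ ≤ K ∧ t ⊆ (Finset.range K).powerset := by
  refine ⟨max K₀ ((t.sup id).sup id + 1), le_max_left _ _, fun ν hν => ?_⟩
  rw [Finset.mem_powerset]
  intro i hi
  rw [Finset.mem_range]
  refine lt_max_of_lt_right (Nat.lt_succ_of_le ?_)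
  exact Finset.le_sup (f := id) (Finset.mem_sup.2 ⟨ν, hν, hi⟩)

/-- A sum over finite sets of positive integers is the limit of the partial sums over the subsets
of the first `K` columns. -/
theorem hasSum_of_partial_sums {f : Finset ℕ → ℂ} {K₀ : ℕ} {c : ℝ}
    (h : ∀ K, K₀ ≤ K → ∑ ν ∈ (Finset.range K).powerset, ‖f ν‖ ≤ c) :
    ∃ L, HasSum f L ∧
      Tendsto (fun K => ∑ ν ∈ (Finset.range K).powerset, f ν) atTop (𝓝 L) := by
  have hs : Summable f := by
    refine Summable.of_norm (summable_of_sum_le (fun _ => norm_nonneg _) (c := c) fun t => ?_)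
    obtain ⟨K, hK, ht⟩ := subset_range_sup t K₀
    exact (Finset.sum_le_sum_of_subset_of_nonneg ht fun _ _ _ => norm_nonneg _).trans (h K hK)
  refine ⟨_, hs.hasSum, hs.hasSum.comp (tendsto_atTop_atTop.2 fun t => ?_)⟩
  obtain ⟨K, _, ht⟩ := subset_range_sup t 0
  exact ⟨K, fun K' hK' => ht.trans (Finset.powerset_mono.2 (Finset.range_mono hK'))⟩

/-- The left side of the skew Cauchy identity converges, and its sum is related to the partition
functions with the two families of rows exchanged. -/
theorem Admissible.exists_hasSum (h : Admissible x w y s) (hM : 1 ≤ M) (hN : 1 ≤ N)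
    (r : Fin M → ℂ) (θ : Fin N → ℂ) {a b : Finset ℕ} {K₀ : ℕ} (ha : a ⊆ Finset.range K₀)
    (hb : b ⊆ Finset.range K₀) {f : Finset ℕ → ℂ}
    (hf : ∀ K, K₀ ≤ K → ∀ ν, ν ⊆ Finset.range K → f ν =
      strip (List.ofFn fun j => rowG y s (w j) (θ j)) (ind a) (ind ν) (List.replicate N false) K
          (List.replicate N false) *
        strip (List.ofFn fun i => rowF y s (x i) (r i)) (ind ν) (ind b) (List.replicate M false) K
          (List.replicate M true))
    {S : ℂ} (hS : ∀ K, K₀ ≤ K → strip ((List.ofFn fun i => rowF y s (x i) (r i)) ++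
        List.ofFn fun j => rowG y s (w j) (θ j)) (ind a) (ind b) (List.replicate (M + N) false) K
        (List.replicate M true ++ List.replicate N false) = S) :
    HasSum f ((∏ i : Fin M, ∏ j : Fin N, (x i - θ j ^ (-2 : ℤ) * w j) / (x i - w j)) * S) := by
  obtain ⟨hlow, c, hc⟩ := h.converges hM hN r θ ha hb (List.replicate (N + M) false)
  obtain ⟨L, hL, hlim⟩ := hasSum_of_partial_sums (f := f) (K₀ := K₀) (c := c) fun K hK => by
    refine le_trans ?_ (hc K hK)
    refine le_trans (le_of_eq ?_) (norm_strip_cauchyRows_le r θ (ind a) (ind b) K)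
    exact Finset.sum_congr rfl fun ν hν => by rw [hf K hK ν (Finset.mem_powerset.1 hν)]
  have hlim' : Tendsto (fun K => strip (cauchyRows x r w θ y s) (ind a) (ind b)
      (List.replicate (N + M) false) K (target N M)) atTop (𝓝 L) := by
    refine hlim.congr' ?_
    filter_upwards [eventually_ge_atTop K₀] with K hK
    rw [strip_cauchyRows]
    exact Finset.sum_congr rfl fun ν hν => hf K hK ν (Finset.mem_powerset.1 hν)
  let gs : List TaggedRow := List.ofFn fun j =>
    ⟨false, w j, θ j ^ (-2 : ℤ) * w j, fun k => (colParam y s k - w j)⁻¹⟩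
  let fs : List TaggedRow := List.ofFn fun i =>
    ⟨true, x i, r i ^ (-2 : ℤ) * x i, fun k => (y k - x i)⁻¹⟩
  have hgs : gs.map (TaggedRow.weight y (colParam y s)) =
      List.ofFn fun j => rowG y s (w j) (θ j) := by
    simp only [gs, List.map_ofFn]
    rfl
  have hfs : fs.map (TaggedRow.weight y (colParam y s)) =
      List.ofFn fun i => rowF y s (x i) (r i) := by
    simp only [fs, List.map_ofFn]
    rfl
  have ggs : ground gs = List.replicate N false := by
    simp only [ground, gs, List.map_ofFn]
    exact List.ofFn_const N false
  have gfs : ground fs = List.replicate M true := by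
    simp only [ground, fs, List.map_ofFn]
    exact List.ofFn_const M true
  have lgs : gs.length = N := by simp [gs]
  have lfs : fs.length = M := by simp [fs]
  have gtar : ground (gs ++ fs) = target N M := by
    rw [ground, List.map_append]
    exact congrArg₂ _ ggs gfs
  have stk : ∀ K σ, stackStrip y (colParam y s) (ind a) (ind b) (gs ++ fs) K σ =
      strip (cauchyRows x r w θ y s) (ind a) (ind b) (List.replicate (N + M) false) K σ := by
    intro K σ
    rw [stackStrip, List.map_append, hgs, hfs, List.length_append, lgs, lfs, cauchyRows]
  have low : LowLimit y (colParam y s) (ind a) (ind b) ([] ++ (gs ++ fs)) 1 L := by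
    rw [List.nil_append]
    refine ⟨?_, fun σ hσ hc _ hne => ?_⟩
    · simp only [one_mul, stk, gtar]
      exact hlim'
    · simp only [one_mul, stk]
      rw [gtar] at hne hc
      exact hlow σ (by simpa [lgs, lfs] using hσ) (hc.trans (count_target N M)) hne
  have fin := (low.move_all (fun g hg => by
    obtain ⟨j, rfl⟩ := (List.mem_ofFn' _ _).1 hg
    rfl) (fun f hf => by
    obtain ⟨j, rfl⟩ := (List.mem_ofFn' _ _).1 hf
    rfl)).1
  have prodR : ∀ p : TaggedRow → ℂ, (fs.map fun f => (gs.map fun g => f.p - p g).prod).prod =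
      ∏ i : Fin M, ∏ j : Fin N, (x i - p ⟨false, w j, θ j ^ (-2 : ℤ) * w j,
        fun k => (colParam y s k - w j)⁻¹⟩) := by
    intro p
    simp only [fs, gs, List.map_ofFn, List.prod_ofFn]
    rfl
  rw [List.nil_append, prodR TaggedRow.p', prodR TaggedRow.p, one_mul] at fin
  have gnew : ground (fs ++ gs) = List.replicate M true ++ List.replicate N false := by
    rw [ground, List.map_append]
    exact congrArg₂ _ gfs ggs
  -- With the blocks exchanged the partition function no longer depends on `K` once `K ≥ K₀`, so the
  -- limit is an equation between `L` and `S`.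
  have e := tendsto_nhds_unique (fin.congr' (f₂ := fun _ =>
      (∏ i : Fin M, ∏ j : Fin N, (x i - θ j ^ (-2 : ℤ) * w j)) * S) (by
    filter_upwards [eventually_ge_atTop K₀] with K hK
    rw [gnew, stackStrip, List.map_append, hgs, hfs, List.length_append, lgs, lfs, hS K hK]))
    tendsto_const_nhds
  convert hL using 1
  simp_rw [Finset.prod_div_distrib]
  rw [div_mul_eq_mul_div, div_eq_iff]
  · exact e.symm
  · exact Finset.prod_ne_zero_iff.2 fun i _ => Finset.prod_ne_zero_iff.2 fun j _ =>
      sub_ne_zero.2 (h.x_ne_w i j)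

end Convergence

end FreeFermionSixVertex

namespace FreeFermionSixVertex

/-! ### The skew Cauchy identity. -/

section SkewCauchy

theorem col_count {R : Type*} [CommSemiring R] {k : ℕ} {l : List (RowWeight R)}
    (hl : ∀ V ∈ l, Conservative V) {b t : Bool} {σ σ' : List Bool} (h : col k l b σ t σ' ≠ 0) :
    b.toNat + σ.count true = t.toNat + σ'.count true := by
  induction l generalizing b σ σ' with
  | nil =>
    cases σ <;> cases σ' <;> simp [col] at h ⊢
    rw [h.1]
  | cons V l ih =>
    cases σ with
    | nil => simp [col] at h
    | cons j σ =>
      cases σ' with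
      | nil => simp [col] at h
      | cons j' σ' =>
        rw [col] at h
        obtain ⟨u, _, hu⟩ := Finset.exists_ne_zero_of_sum_ne_zero h
        have hV := hl V List.mem_cons_self _ _ _ _ _ (left_ne_zero_of_mul hu)
        have h1 := ih (fun V hV => hl V (List.mem_cons_of_mem _ hV)) (right_ne_zero_of_mul hu)
        have e1 : ∀ (a : Bool) (τ : List Bool), (a :: τ).count true = a.toNat + τ.count true := by
          intro a τ
          cases a <;> simp [add_comm]
        rw [e1, e1]
        omega

/-- Conservation for the whole strip; with empty ends it forces both signatures of a nonzero `G` to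
have the same number of parts. -/
theorem strip_count {R : Type*} [CommSemiring R] {l : List (RowWeight R)}
    (hl : ∀ V ∈ l, Conservative V) {A B : ℕ → Bool} {σ₀ σ : List Bool} {K : ℕ}
    (h : strip l A B σ₀ K σ ≠ 0) :
    ∑ i ∈ Finset.range K, (A i).toNat + σ₀.count true =
      ∑ i ∈ Finset.range K, (B i).toNat + σ.count true := by
  induction K generalizing σ with
  | zero =>
    rw [strip] at h
    have : σ = σ₀ := by
      by_contra hne
      exact h (if_neg hne)
    rw [this]
    simp
  | succ K ih =>
    rw [strip] at h
    obtain ⟨τ, _, hτ⟩ := Finset.exists_ne_zero_of_sum_ne_zero h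
    have h1 := ih (left_ne_zero_of_mul hτ)
    have h2 := col_count hl (right_ne_zero_of_mul hτ)
    rw [Finset.sum_range_succ, Finset.sum_range_succ]
    omega

theorem sum_ind {a : Finset ℕ} {K : ℕ} (ha : a ⊆ Finset.range K) :
    ∑ i ∈ Finset.range K, (ind a i).toNat = a.card := by
  have : ∀ i, (ind a i).toNat = if i ∈ a then 1 else 0 := by
    intro i
    by_cases h : i ∈ a <;> simp [ind, h]
  simp_rw [this]
  rw [Finset.sum_ite_mem, Finset.sum_const, Finset.inter_eq_right.2 ha, smul_eq_mul, mul_one]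

/-- Paths cannot exit to the left of the column where they enter. -/
theorem eq_false_of_strip_ne_zero {R : Type*} [CommSemiring R] {l : List (RowWeight R)}
    (hl : ∀ V ∈ l, Conservative V) {A B : ℕ → Bool} {σ₀ : List Bool} {K₀ K : ℕ}
    (hB : ∀ i, K₀ ≤ i → B i = false)
    (h : strip l A B σ₀ K (List.replicate l.length false) ≠ 0) {i : ℕ} (hi : K₀ ≤ i)
    (hiK : i < K) : A i = false := by
  induction K with
  | zero => omega
  | succ K ih =>
    rw [strip] at h
    obtain ⟨τ, hτs, hτ⟩ := Finset.exists_ne_zero_of_sum_ne_zero h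
    rcases lt_or_ge K K₀ with hK | hK
    · omega
    · have h2 := col_count hl (right_ne_zero_of_mul hτ)
      rw [hB K hK] at h2
      simp only [Bool.toNat_false, List.count_replicate, Bool.false_eq_true,
        beq_iff_eq, if_false, add_zero] at h2
      have h3 : τ = List.replicate l.length false := by
        rw [← mem_states.1 hτs]
        exact eq_replicate_false (by omega)
      rcases Nat.lt_succ_iff_lt_or_eq.1 hiK with h4 | h4
      · exact ih (h3 ▸ left_ne_zero_of_mul hτ) h4
      · rw [h4]
        cases hA : A K
        · rfl
        · rw [hA] at h2
          simp at h2

variable {M N : ℕ} {x : Fin M → ℂ} {w : Fin N → ℂ} {y s : ℕ → ℂ}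

theorem conservative_rowG {θ : Fin N → ℂ} {V : RowWeight ℂ}
    (hV : V ∈ List.ofFn fun j => rowG y s (w j) (θ j)) : Conservative V := by
  obtain ⟨j, rfl⟩ := (List.mem_ofFn' _ _).1 hV
  exact vertexRow_conservative _ _ _ _ _

theorem exists_subset_range (K : ℕ) (a b : Finset ℕ) :
    ∃ K', K ≤ K' ∧ a ⊆ Finset.range K' ∧ b ⊆ Finset.range K' := by
  obtain ⟨K', hK, h⟩ := subset_range_sup {a, b} K
  exact ⟨K', hK, Finset.mem_powerset.1 (h (by simp)), Finset.mem_powerset.1 (h (by simp))⟩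

theorem card_eq_of_skewG_ne_zero {m n : ℕ} {lam : Signature m} {mu : Signature n} {θ : Fin N → ℂ}
    (hw : ∀ j k, colParam y s k - w j ≠ 0) (h : skewG lam mu w y θ s ≠ 0) : m = n := by
  obtain ⟨K, _, h1, h2⟩ := exists_subset_range 0 lam.finset mu.finset
  rw [skewG_eq_strip lam mu hw h1 h2] at h
  have := strip_count (fun V hV => conservative_rowG hV) h
  rw [sum_ind h1, sum_ind h2, lam.card_finset, mu.card_finset] at this
  omega

/-- The skew Cauchy identity. -/
theorem Admissible.skew_cauchy (h : Admissible x w y s) (hM : 1 ≤ M) (hN : 1 ≤ N)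
    (r : Fin M → ℂ) (θ : Fin N → ℂ) {a b : ℕ} (lam : Signature a) (mu : Signature b) :
    HasSum (fun nu : (n : ℕ) × Signature n => skewG nu.2 lam w y θ s * skewF nu.2 mu x y r s)
      ((∏ i : Fin M, ∏ j : Fin N, (x i - θ j ^ (-2 : ℤ) * w j) / (x i - w j)) *
        ∑ᶠ ka : (n : ℕ) × Signature n, skewG mu ka.2 w y θ s * skewF lam ka.2 x y r s) := by
  obtain ⟨K₀, _, hlam, hmu⟩ := exists_subset_range 0 lam.finset mu.finset
  rw [← signatureEquiv.symm.hasSum_iff]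
  have fs : ∀ ν : Finset ℕ, (signatureEquiv.symm ν).2.finset = ν := by
    intro ν
    rw [← signatureEquiv_apply, Equiv.apply_symm_apply]
  refine h.exists_hasSum hM hN r θ hlam hmu ?_ ?_
  · intro K hK ν hν
    have hr := Finset.range_mono hK
    simp only [Function.comp_apply]
    rw [skewG_eq_strip _ lam h.ne_w (K := K) (by rwa [fs]) (hlam.trans hr),
      skewF_eq_strip _ mu h.ne_x (K := K) (by rwa [fs]) (hmu.trans hr), fs]
  · intro K hK
    have hr := Finset.range_mono hK
    rw [List.replicate_add, strip_append _ _ _ _ (by simp) _ (by simp),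
      ← finsum_comp_equiv signatureEquiv.symm, finsum_eq_sum_of_support_subset
      (s := (Finset.range K).powerset)]
    · refine Finset.sum_congr rfl fun ν hν => ?_
      have hν' := Finset.mem_powerset.1 hν
      rw [skewG_eq_strip mu _ h.ne_w (K := K) (hmu.trans hr) (by rwa [fs]),
        skewF_eq_strip lam _ h.ne_x (K := K) (hlam.trans hr) (by rwa [fs]), fs, mul_comm]
    · intro ν hν
      rw [Finset.mem_coe, Finset.mem_powerset]
      intro i hi
      rw [Finset.mem_range]
      by_contra hiK
      have hG := left_ne_zero_of_mul (Function.mem_support.1 hν)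
      -- `ν` may leave the window of `K` columns, so `G` is evaluated in a wider one; as paths only
      -- move right, a point of `ν` beyond `K₀` could not reach `μ`.
      obtain ⟨K', _, h1, h2⟩ := exists_subset_range K mu.finset ν
      rw [skewG_eq_strip mu _ h.ne_w (K := K') h1 (by rwa [fs]), fs] at hG
      have := eq_false_of_strip_ne_zero (K₀ := K₀) (fun V hV => conservative_rowG hV)
        (fun i hi => ind_of_subset_range hmu hi) (by simpa using hG) (i := i) (by omega)
        (Finset.mem_range.1 (h2 hi))
      simp [ind, hi] at this

end SkewCauchy

end FreeFermionSixVertex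

namespace FreeFermionSixVertex

/-! ### The domain wall partition function by interpolation. -/

section DomainWall

open Topology Polynomial

/-- A row of vertices without normalization. -/
def bareRow (q q' : ℕ → ℂ) (ρ : ℂ × ℂ) : RowWeight ℂ := fun k => vertex ρ.1 ρ.2 (q k) (q' k)

/-- The domain wall partition function: paths enter at the bottom of every column and exit at the
right end of every row. -/
def domainWall (q q' : ℕ → ℂ) (l : List (ℂ × ℂ)) : ℂ :=
  strip (l.map (bareRow q q')) (fun _ => true) (fun _ => false) (List.replicate l.length false)
    l.length (List.replicate l.length true)

/-- The product of `pᵢ' - pⱼ` over all pairs of rows `i < j`. -/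
def rowPairs : List (ℂ × ℂ) → ℂ
  | [] => 1
  | ρ :: l => (l.map fun τ => ρ.2 - τ.1).prod * rowPairs l

/-- The product of `qᵢ' - qⱼ` over all pairs of columns `i < j < n`. -/
def colPairs : ℕ → (ℕ → ℂ) → (ℕ → ℂ) → ℂ
  | 0, _, _ => 1
  | n + 1, q, q' => (∏ k ∈ Finset.range n, (q' 0 - q (k + 1))) *
      colPairs n (fun k => q (k + 1)) fun k => q' (k + 1)

/-- The product formula for the domain wall partition function. -/
def domainWallProduct (q q' : ℕ → ℂ) (l : List (ℂ × ℂ)) : ℂ :=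
  (l.map fun ρ => ρ.2 - ρ.1).prod * rowPairs l * colPairs l.length q q'

/-- With both right edges occupied, the only possible cross at the right end is the fully occupied
one, so the exchange relation has a single term on each side. -/
theorem domainWall_swap (q q' : ℕ → ℂ) (l₁ l₂ : List (ℂ × ℂ)) (a b : ℂ × ℂ) :
    (b.2 - a.1) * domainWall q q' (l₁ ++ a :: b :: l₂) =
      (a.2 - b.1) * domainWall q q' (l₁ ++ b :: a :: l₂) := by
  have one : ∀ ρ : ℂ × ℂ, vertexRow q q' ρ.1 ρ.2 (fun _ => 1) = bareRow q q' ρ := by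
    intro ρ
    funext k b j t j'
    exact one_mul _
  have hYB := yangBaxter_vertexRow q q' a.1 a.2 b.1 b.2 (fun _ => 1) (fun _ => 1)
  rw [one, one] at hYB
  have h := strip_exchange hYB (cross_empty _ _ _ _) rfl (l₁.map (bareRow q q'))
    (l₂.map (bareRow q q')) (fun _ => true) (fun _ => false)
    (τ₁ := List.replicate l₁.length false) (τ₂ := List.replicate l₂.length false)
    (l₁.length + (l₂.length + 2)) (σ₁ := List.replicate l₁.length true)
    (List.replicate l₂.length true) true true (by simp) (by simp) (by simp)
  have e : ∀ (c : Bool), List.replicate (l₁.length + (l₂.length + 2)) c =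
      List.replicate l₁.length c ++ c :: c :: List.replicate l₂.length c := by
    intro c
    rw [List.replicate_add]
    rfl
  simp only [domainWall, List.length_append, List.length_cons, List.map_append, List.map_cons,
    add_assoc, one_add_one_eq_two]
  rw [e false, e true]
  simp only [Fintype.sum_bool, cross, mul_zero, add_zero] at h
  linear_combination -h

theorem domainWall_move (q q' : ℕ → ℂ) (l₁ l₂ : List (ℂ × ℂ)) (a : ℂ × ℂ) :
    (l₁.map fun b => a.2 - b.1).prod * domainWall q q' (l₁ ++ a :: l₂) =
      (l₁.map fun b => b.2 - a.1).prod * domainWall q q' (a :: (l₁ ++ l₂)) := by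
  induction l₁ using List.reverseRecOn generalizing l₂ with
  | nil => simp
  | append_singleton l₁ b ih =>
    have h1 := domainWall_swap q q' l₁ l₂ b a
    have h2 := ih (b :: l₂)
    simp only [List.map_append, List.map_cons, List.map_nil, List.prod_append, List.prod_singleton,
      List.append_assoc, List.singleton_append]
    linear_combination (l₁.map fun b => a.2 - b.1).prod * h1 + (b.2 - a.1) * h2

theorem domainWallProduct_move (q q' : ℕ → ℂ) (l₁ l₂ : List (ℂ × ℂ)) (a : ℂ × ℂ) :
    (l₁.map fun b => a.2 - b.1).prod * domainWallProduct q q' (l₁ ++ a :: l₂) =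
      (l₁.map fun b => b.2 - a.1).prod * domainWallProduct q q' (a :: (l₁ ++ l₂)) := by
  have h : (l₁.map fun b => a.2 - b.1).prod * rowPairs (l₁ ++ a :: l₂) =
      (l₁.map fun b => b.2 - a.1).prod * rowPairs (a :: (l₁ ++ l₂)) := by
    induction l₁ with
    | nil => simp
    | cons b l₁ ih =>
      simp only [List.cons_append, rowPairs, List.map_cons, List.prod_cons, List.map_append,
        List.prod_append] at ih ⊢
      linear_combination (a.2 - b.1) * (b.2 - a.1) *
        ((l₁.map fun τ => b.2 - τ.1).prod * (l₂.map fun τ => b.2 - τ.1).prod) * ih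
  have hl : (l₁ ++ a :: l₂).length = (a :: (l₁ ++ l₂)).length := by
    simp
    ring
  simp only [domainWallProduct, hl, List.map_cons, List.prod_cons, List.map_append,
    List.prod_append] at h ⊢
  linear_combination (l₁.map fun ρ => ρ.2 - ρ.1).prod * ((a.2 - a.1) *
    (l₂.map fun ρ => ρ.2 - ρ.1).prod) * colPairs (a :: (l₁ ++ l₂)).length q q' * h

theorem col_bareRow_empty (q q' : ℕ → ℂ) (k : ℕ) (l : List (ℂ × ℂ)) {σ : List Bool}
    (hσ : σ.length = l.length) :
    col k (l.map (bareRow q q')) false (List.replicate l.length false) false σ =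
      if σ = List.replicate l.length false then (l.map fun τ => q' k - τ.1).prod else 0 := by
  induction l generalizing σ with
  | nil =>
    obtain rfl := List.length_eq_zero_iff.1 hσ
    simp [col]
  | cons ρ l ih =>
    obtain ⟨j, σ, rfl⟩ := List.exists_cons_of_length_eq_add_one hσ
    simp only [List.length_cons, add_left_inj] at hσ
    simp only [List.map_cons, List.length_cons, List.replicate_succ, col, Fintype.sum_bool,
      ih hσ, List.prod_cons, List.cons.injEq]
    cases j <;> simp [bareRow, vertex]

/-- A row entered both from the left and from below in every column is saturated: it is frozen in
the vertices `(1, 1; 1, 1)`, and all columns remain occupied above it. -/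
theorem strip_full_row (q q' : ℕ → ℂ) (ρ : ℂ × ℂ) (L : List (RowWeight ℂ)) (B : ℕ → Bool)
    (σ₀ : List Bool) (K : ℕ) (j : Bool) (σ : List Bool) :
    strip (bareRow q q' ρ :: L) (fun _ => true) B (true :: σ₀) K (j :: σ) =
      if j = true then (∏ k ∈ Finset.range K, (ρ.2 - q k)) * strip L (fun _ => true) B σ₀ K σ
      else 0 := by
  induction K generalizing j σ with
  | zero =>
    simp only [strip, List.cons.injEq, Finset.range_zero, Finset.prod_empty, one_mul]
    cases j <;> simp
  | succ K ih =>
    simp only [strip, List.length_cons, sum_states_succ, ih, col, Fintype.sum_bool, if_true,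
      Bool.false_eq_true, if_false, zero_mul, Finset.sum_const_zero, add_zero]
    cases j
    · simp [bareRow, vertex]
    · simp only [if_true, bareRow, vertex, zero_mul, add_zero]
      rw [Finset.prod_range_succ, Finset.mul_sum]
      exact Finset.sum_congr rfl fun τ _ => by ring

theorem shiftRows_map_bareRow (q q' : ℕ → ℂ) (l : List (ℂ × ℂ)) :
    shiftRows (l.map (bareRow q q')) = l.map (bareRow (fun k => q (k + 1)) fun k => q' (k + 1)) := by
  rw [shiftRows, List.map_map]
  rfl

/-- The recursion for the domain wall partition function at a special value of a parameter. -/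
theorem domainWall_cons (q q' : ℕ → ℂ) (ρ : ℂ × ℂ) (l : List (ℂ × ℂ)) (h : q' 0 = ρ.2) :
    domainWall q q' (ρ :: l) = (ρ.2 - ρ.1) * (l.map fun τ => ρ.2 - τ.1).prod *
      (∏ k ∈ Finset.range l.length, (ρ.2 - q (k + 1))) *
        domainWall (fun k => q (k + 1)) (fun k => q' (k + 1)) l := by
  rw [domainWall, List.length_cons, strip_succ_left _ _ _ (by simp) _ (by simp),
    shiftRows_map_bareRow, List.length_map, List.length_cons, sum_states_succ, Fintype.sum_bool]
  simp only [List.map_cons, List.replicate_succ, strip_full_row, col, Fintype.sum_bool, if_true]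
  -- At `q' 0 = p'` the corner path cannot go straight up. It turns right, which leaves the first
  -- column empty above it and the rest of the bottom row full.
  have z : ∀ σ ∈ states l.length, (bareRow q q' ρ 0 true false true false *
      col 0 (l.map (bareRow q q')) true (List.replicate l.length false) false σ +
      bareRow q q' ρ 0 true false false false *
      col 0 (l.map (bareRow q q')) false (List.replicate l.length false) false σ) *
      strip (bareRow (fun k => q (k + 1)) (fun k => q' (k + 1)) ρ ::
        l.map (bareRow (fun k => q (k + 1)) fun k => q' (k + 1))) (fun _ => true) (fun _ => false)
        (false :: σ) l.length (true :: List.replicate l.length true) = 0 := by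
    intro σ _
    simp [bareRow, vertex, h]
  rw [Finset.sum_eq_zero z, add_zero]
  have z2 : ∀ σ ∈ states l.length, (bareRow q q' ρ 0 true false true true *
      col 0 (l.map (bareRow q q')) true (List.replicate l.length false) false σ +
      bareRow q q' ρ 0 true false false true *
      col 0 (l.map (bareRow q q')) false (List.replicate l.length false) false σ) *
      ((∏ k ∈ Finset.range l.length, (ρ.2 - q (k + 1))) *
        strip (l.map (bareRow (fun k => q (k + 1)) fun k => q' (k + 1))) (fun _ => true)
        (fun _ => false) σ l.length (List.replicate l.length true)) =
      if σ = List.replicate l.length false then (ρ.2 - ρ.1) * (l.map fun τ => ρ.2 - τ.1).prod *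
      (∏ k ∈ Finset.range l.length, (ρ.2 - q (k + 1))) *
        domainWall (fun k => q (k + 1)) (fun k => q' (k + 1)) l else 0 := by
    intro σ hσ
    rw [col_bareRow_empty q q' 0 l (mem_states.1 hσ), h]
    split_ifs with hs
    · rw [hs, domainWall]
      simp only [bareRow, vertex]
      ring
    · simp [bareRow, vertex]
  rw [Finset.sum_congr rfl z2, Finset.sum_ite_eq', if_pos (mem_states.2 (by simp))]

/-- A sequence with a term added at the beginning. -/
def consSeq (t : ℂ) (q : ℕ → ℂ) : ℕ → ℂ
  | 0 => t
  | k + 1 => q k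

/-- In the first column the left edges are empty, so a path going straight up or an empty vertex
contributes a linear factor in `t`. The path has to turn right in exactly one row, with a weight
free of `t`, and this saves one degree. -/
theorem exists_polynomial_col (q q' : ℕ → ℂ) (l : List (ℂ × ℂ)) (σ : List Bool)
    (hσ : σ.length = l.length) :
    ∃ P : ℂ[X], P.degree < l.length ∧ ∀ t, col 0 (l.map (bareRow q (consSeq t q'))) true
      (List.replicate l.length false) false σ = P.eval t := by
  induction l generalizing σ with
  | nil =>
    obtain rfl := List.length_eq_zero_iff.1 hσ
    exact ⟨0, by simp, by simp [col]⟩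
  | cons ρ l ih =>
    obtain ⟨j, σ, rfl⟩ := List.exists_cons_of_length_eq_add_one hσ
    simp only [List.length_cons, add_left_inj] at hσ
    obtain ⟨P, hP, hPt⟩ := ih σ hσ
    cases j with
    | false =>
      refine ⟨(X - C ρ.2) * P, ?_, fun t => ?_⟩
      · rw [degree_mul, degree_X_sub_C, List.length_cons]
        push_cast
        rw [add_comm]
        by_cases h0 : P = 0
        · rw [h0, degree_zero, WithBot.bot_add]
          exact WithBot.bot_lt_coe (l.length + 1)
        · rw [degree_eq_natDegree h0] at hP ⊢
          exact_mod_cast Nat.add_lt_add_right (by exact_mod_cast hP) 1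
      · simp [List.replicate_succ, col, hPt, bareRow, vertex, consSeq]
    | true =>
      refine ⟨C (if σ = List.replicate l.length false then ρ.2 - ρ.1 else 0) *
        (l.map fun τ => X - C τ.1).prod, ?_, fun t => ?_⟩
      · rw [degree_lt_iff_coeff_zero]
        intro m hm
        rw [coeff_C_mul, coeff_eq_zero_of_natDegree_lt, mul_zero]
        refine lt_of_le_of_lt (natDegree_list_prod_le _) ?_
        simp only [List.map_map, Function.comp_def, natDegree_X_sub_C, List.map_const',
          List.sum_replicate, smul_eq_mul, mul_one]
        simpa using hm
      · simp only [List.map_cons, List.length_cons, List.replicate_succ, col, Fintype.sum_bool,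
          col_bareRow_empty _ _ _ _ hσ, eval_mul, eval_C, eval_list_prod, List.map_map,
          Function.comp_def, eval_sub, eval_X]
        split_ifs <;> simp [bareRow, vertex, consSeq]

theorem consSeq_eta (q : ℕ → ℂ) : consSeq (q 0) (fun k => q (k + 1)) = q := by
  funext k
  cases k <;> rfl

theorem exists_polynomial_domainWall (q q' : ℕ → ℂ) {l : List (ℂ × ℂ)} (hl : l ≠ []) :
    ∃ P : ℂ[X], P.degree < l.length ∧ ∀ t, domainWall q (consSeq t q') l = P.eval t := by
  obtain ⟨n, hn⟩ : ∃ n, l.length = n + 1 := ⟨l.length - 1, by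
    have := List.length_pos_iff.2 hl
    omega⟩
  choose! P hP hPt using exists_polynomial_col q q' l
  refine ⟨∑ σ ∈ states l.length, P σ * C (strip (l.map (bareRow (fun k => q (k + 1)) q'))
    (fun _ => true) (fun _ => false) σ n (List.replicate l.length true)), ?_, fun t => ?_⟩
  · refine lt_of_le_of_lt (degree_sum_le _ _) ((Finset.sup_lt_iff ?_).2 fun σ hσ => ?_)
    · exact WithBot.bot_lt_coe l.length
    · refine lt_of_le_of_lt ((degree_mul_le _ _).trans (add_le_add le_rfl degree_C_le)) ?_
      rw [add_zero]
      exact hP σ (mem_states.1 hσ)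
  · rw [domainWall]
    nth_rewrite 2 [hn]
    rw [strip_succ_left _ _ _ (by simp) _ (by simp), shiftRows_map_bareRow, List.length_map,
      eval_finsetSum]
    refine Finset.sum_congr rfl fun σ hσ => ?_
    rw [hPt σ (mem_states.1 hσ), eval_mul, eval_C]
    rfl

/-- The domain wall partition function for parameters in general position. -/
theorem domainWall_eq_of_generic (n : ℕ) (q q' : ℕ → ℂ) {l : List (ℂ × ℂ)} (hn : l.length = n)
    (hl : l.Pairwise fun a b => a.2 ≠ b.2 ∧ a.2 ≠ b.1 ∧ b.2 ≠ a.1) :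
    domainWall q q' l = domainWallProduct q q' l := by
  induction n generalizing q q' l with
  | zero =>
    obtain rfl := List.length_eq_zero_iff.1 hn
    simp [domainWall, domainWallProduct, strip, rowPairs, colPairs]
  | succ n ih =>
    have hne : l ≠ [] := by
      rintro rfl
      simp at hn
    rw [← consSeq_eta q']
    generalize q' 0 = t
    generalize (fun k => q' (k + 1)) = q''
    obtain ⟨P, hP, hPt⟩ := exists_polynomial_domainWall q q'' hne
    set S : ℂ[X] := C ((l.map fun ρ => ρ.2 - ρ.1).prod * rowPairs l *
      colPairs n (fun k => q (k + 1)) q'') * ∏ k ∈ Finset.range n, (X - C (q (k + 1))) with hS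
    have hSt : ∀ t, domainWallProduct q (consSeq t q'') l = S.eval t := by
      intro t
      rw [domainWallProduct, hn, colPairs, hS, eval_mul, eval_C, eval_prod]
      simp only [eval_sub, eval_X, eval_C]
      change _ * ((∏ k ∈ Finset.range n, (t - q (k + 1))) *
        colPairs n (fun k => q (k + 1)) q'') = _
      ring
    have hSd : S.degree < l.length := by
      rw [degree_lt_iff_coeff_zero]
      intro m hm
      rw [hS, coeff_C_mul, coeff_eq_zero_of_natDegree_lt, mul_zero]
      refine lt_of_le_of_lt (natDegree_prod_le _ _) ?_
      simp only [natDegree_X_sub_C, Finset.sum_const, Finset.card_range, smul_eq_mul, mul_one]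
      omega
    have hnodup : (l.map Prod.snd).Nodup := by
      rw [List.Nodup, List.pairwise_map]
      exact hl.imp fun h => h.1
    have hcard : (l.map Prod.snd).toFinset.card = l.length := by
      rw [List.toFinset_card_of_nodup hnodup, List.length_map]
    rw [hPt, hSt]
    congr 1
    -- The nodes are the parameters `p'` of the rows, distinct by genericity. At such a node the
    -- corresponding row is moved to the bottom on both sides, where the recursion applies.
    refine eq_of_degree_sub_lt_of_eval_finset_eq (l.map Prod.snd).toFinset ?_ ?_
    · rw [hcard]
      exact (degree_sub_le _ _).trans_lt (max_lt hP hSd)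
    · intro z hz
      rw [List.mem_toFinset] at hz
      obtain ⟨a, ha, rfl⟩ := List.mem_map.1 hz
      rw [← hPt, ← hSt]
      obtain ⟨l₁, l₂, rfl⟩ := List.append_of_mem ha
      have hpw := List.pairwise_append.1 hl
      have hne : (l₁.map fun b => a.2 - b.1).prod ≠ 0 := by
        rw [Ne, List.prod_eq_zero_iff]
        intro h0
        obtain ⟨b, hb, h0⟩ := List.mem_map.1 h0
        exact (hpw.2.2 b hb a List.mem_cons_self).2.2 (sub_eq_zero.1 h0)
      refine mul_left_cancel₀ hne ?_
      rw [domainWall_move, domainWallProduct_move, domainWall_cons _ _ _ _ rfl]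
      have hlen : (l₁ ++ l₂).length = n := by
        simp only [List.length_append, List.length_cons] at hn ⊢
        omega
      have hpw' : (l₁ ++ l₂).Pairwise fun a b => a.2 ≠ b.2 ∧ a.2 ≠ b.1 ∧ b.2 ≠ a.1 :=
        hl.sublist ((List.Sublist.refl l₁).append (List.sublist_cons_self a l₂))
      rw [ih _ _ hlen hpw', domainWallProduct, domainWallProduct, List.length_cons, colPairs,
        List.map_cons, List.prod_cons, rowPairs]
      simp only [consSeq]
      ring

end DomainWall

end FreeFermionSixVertex

namespace FreeFermionSixVertex

/-! ### Removing genericity, and the value of `F` at the zero signature. -/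

section DomainWallLimit

open Topology

theorem continuous_col {α : Type*} {V : α → ℂ → RowWeight ℂ}
    (hV : ∀ a k b j t j', Continuous fun ε => V a ε k b j t j') (k : ℕ) (l : List α) (b t : Bool)
    (σ σ' : List Bool) : Continuous fun ε => col k (l.map fun a => V a ε) b σ t σ' := by
  induction l generalizing b σ σ' with
  | nil =>
    simp only [List.map_nil]
    exact continuous_const
  | cons a l ih =>
    cases σ with
    | nil => exact continuous_const
    | cons j σ =>
      cases σ' with
      | nil => exact continuous_const
      | cons j' σ' =>
        simp only [List.map_cons, col]
        exact continuous_finsetSum _ fun v _ => (hV a k b j v j').mul (ih v σ σ')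

theorem continuous_strip {α : Type*} {V : α → ℂ → RowWeight ℂ}
    (hV : ∀ a k b j t j', Continuous fun ε => V a ε k b j t j') (l : List α) (A B : ℕ → Bool)
    (σ₀ : List Bool) (K : ℕ) (σ : List Bool) :
    Continuous fun ε => strip (l.map fun a => V a ε) A B σ₀ K σ := by
  induction K generalizing σ with
  | zero => exact continuous_const
  | succ K ih =>
    simp only [strip, List.length_map]
    exact continuous_finsetSum _ fun τ _ => (ih τ).mul (continuous_col hV _ _ _ _ _ _)

theorem rowPairs_ofFn {n : ℕ} (p p' : Fin n → ℂ) :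
    rowPairs (List.ofFn fun i => (p i, p' i)) = ∏ i, ∏ j ∈ Finset.Ioi i, (p' i - p j) := by
  induction n with
  | zero => simp [rowPairs]
  | succ n ih =>
    rw [List.ofFn_succ, rowPairs, ih, Fin.prod_univ_succ, Fin.prod_Ioi_zero, List.map_ofFn,
      List.prod_ofFn]
    simp only [Fin.prod_Ioi_succ, Function.comp_apply]

theorem colPairs_eq (n : ℕ) (q q' : ℕ → ℂ) :
    colPairs n q q' = ∏ i : Fin n, ∏ j ∈ Finset.Ioi i, (q' i - q j) := by
  induction n generalizing q q' with
  | zero => simp [colPairs]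
  | succ n ih =>
    rw [colPairs, ih, Fin.prod_univ_succ, Fin.prod_Ioi_zero, Finset.prod_range]
    simp only [Fin.prod_Ioi_succ, Fin.val_succ, Fin.val_zero]

theorem domainWallProduct_ofFn {n : ℕ} (q q' : ℕ → ℂ) (p p' : Fin n → ℂ) :
    domainWallProduct q q' (List.ofFn fun i => (p i, p' i)) =
      (∏ i, (p' i - p i)) * (∏ i, ∏ j ∈ Finset.Ioi i, (p' i - p j)) *
        ∏ i : Fin n, ∏ j ∈ Finset.Ioi i, (q' i - q j) := by
  rw [domainWallProduct, rowPairs_ofFn, List.length_ofFn, colPairs_eq, List.map_ofFn,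
    List.prod_ofFn]
  rfl

theorem eventually_affine_ne_zero (c : ℂ) {d : ℂ} (hd : d ≠ 0) :
    ∀ᶠ ε in 𝓝[≠] (0 : ℂ), c + ε * d ≠ 0 := by
  by_cases hc : c = 0
  · filter_upwards [self_mem_nhdsWithin] with ε hε
    rw [hc, zero_add]
    exact mul_ne_zero hε hd
  · have : Continuous fun ε : ℂ => c + ε * d := by fun_prop
    have h := this.tendsto 0
    rw [zero_mul, add_zero] at h
    exact nhdsWithin_le_nhds (h.eventually_ne hc)

/-- The product formula for the domain wall partition function. -/
theorem domainWall_eq {n : ℕ} (q q' : ℕ → ℂ) (p p' : Fin n → ℂ) :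
    domainWall q q' (List.ofFn fun i => (p i, p' i)) =
      (∏ i, (p' i - p i)) * (∏ i, ∏ j ∈ Finset.Ioi i, (p' i - p j)) *
        ∏ i : Fin n, ∏ j ∈ Finset.Ioi i, (q' i - q j) := by
  -- The slopes are nonzero and distinct, so each relevant difference is affine in `ε` with nonzero
  -- slope and vanishes for no small `ε ≠ 0`. Moving the parameters `p'` alone suffices.
  let P : Fin n → ℂ → ℂ := fun i ε => p' i + ε * ((i : ℕ) + 1 : ℂ)
  have generic : ∀ᶠ ε in 𝓝[≠] (0 : ℂ),
      domainWall q q' (List.ofFn fun i => (p i, P i ε)) =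
      (∏ i, (P i ε - p i)) * (∏ i, ∏ j ∈ Finset.Ioi i, (P i ε - p j)) *
        ∏ i : Fin n, ∏ j ∈ Finset.Ioi i, (q' i - q j) := by
    have h1 : ∀ᶠ ε in 𝓝[≠] (0 : ℂ), ∀ i j : Fin n, i ≠ j → P i ε ≠ P j ε := by
      refine eventually_all.2 fun i => eventually_all.2 fun j => ?_
      by_cases hij : i = j
      · exact Eventually.of_forall fun ε h => absurd hij h
      · have hd : ((i : ℕ) + 1 : ℂ) - ((j : ℕ) + 1) ≠ 0 := by
          rw [add_sub_add_right_eq_sub, sub_ne_zero]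
          exact_mod_cast fun h => hij (Fin.ext h)
        filter_upwards [eventually_affine_ne_zero (p' i - p' j) hd] with ε hε _
        rw [← sub_ne_zero]
        convert hε using 1
        simp only [P]
        ring
    have h2 : ∀ᶠ ε in 𝓝[≠] (0 : ℂ), ∀ i j : Fin n, P i ε ≠ p j := by
      refine eventually_all.2 fun i => eventually_all.2 fun j => ?_
      have hd : ((i : ℕ) + 1 : ℂ) ≠ 0 := by exact_mod_cast Nat.succ_ne_zero (i : ℕ)
      filter_upwards [eventually_affine_ne_zero (p' i - p j) hd] with ε hε
      rw [← sub_ne_zero]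
      convert hε using 1
      simp only [P]
      ring
    filter_upwards [h1, h2] with ε h1 h2
    rw [domainWall_eq_of_generic n q q' (List.length_ofFn), domainWallProduct_ofFn]
    rw [List.pairwise_ofFn]
    exact fun i j hij => ⟨h1 i j hij.ne, h2 i j, h2 j i⟩
  have hP : ∀ i, Continuous (P i) := fun i => by
    simp only [P]
    fun_prop
  have cont : Continuous fun ε => domainWall q q' (List.ofFn fun i => (p i, P i ε)) := by
    have := continuous_strip (V := fun (i : Fin n) ε => bareRow q q' (p i, P i ε))
      (fun i k b j t j' => by
        have := hP i
        cases b <;> cases j <;> cases t <;> cases j' <;> simp only [bareRow, vertex] <;> fun_prop)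
      (List.finRange n) (fun _ => true) (fun _ => false) (List.replicate n false) n
      (List.replicate n true)
    refine this.congr fun ε => ?_
    rw [domainWall, List.length_ofFn, List.map_ofFn, List.ofFn_eq_map]
    rfl
  have cont' : Continuous fun ε => (∏ i, (P i ε - p i)) *
      (∏ i, ∏ j ∈ Finset.Ioi i, (P i ε - p j)) *
        ∏ i : Fin n, ∏ j ∈ Finset.Ioi i, (q' i - q j) := by
    refine Continuous.mul (Continuous.mul ?_ ?_) continuous_const
    · exact continuous_finsetProd _ fun i _ => (hP i).sub continuous_const
    · exact continuous_finsetProd _ fun i _ => continuous_finsetProd _ fun j _ =>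
        (hP i).sub continuous_const
  have l1 := (cont.tendsto 0).mono_left (nhdsWithin_le_nhds (s := {0}ᶜ))
  have l2 := (cont'.tendsto 0).mono_left (nhdsWithin_le_nhds (s := {0}ᶜ))
  have := tendsto_nhds_unique l1 (l2.congr' (generic.mono fun ε h => h.symm))
  simpa [P] using this

theorem col_normalized (k : ℕ) {α : Type*} (d : α → ℕ → ℂ) (V : α → RowWeight ℂ) (l : List α)
    (b t : Bool) (σ σ' : List Bool) :
    col k (l.map fun a => fun k b j t j' => d a k * V a k b j t j') b σ t σ' =
      (l.map fun a => d a k).prod * col k (l.map V) b σ t σ' := by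
  induction l generalizing b σ σ' with
  | nil => simp
  | cons a l ih =>
    cases σ with
    | nil => simp [col]
    | cons j σ =>
      cases σ' with
      | nil => simp [col]
      | cons j' σ' =>
        simp only [List.map_cons, col, ih, List.prod_cons, Finset.mul_sum]
        exact Finset.sum_congr rfl fun v _ => by ring

theorem strip_normalized {α : Type*} (d : α → ℕ → ℂ) (V : α → RowWeight ℂ) (l : List α)
    (A B : ℕ → Bool) (σ₀ : List Bool) (K : ℕ) (σ : List Bool) :
    strip (l.map fun a => fun k b j t j' => d a k * V a k b j t j') A B σ₀ K σ =
      (∏ k ∈ Finset.range K, (l.map fun a => d a k).prod) * strip (l.map V) A B σ₀ K σ := by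
  induction K generalizing σ with
  | zero => simp [strip]
  | succ K ih =>
    simp only [strip, List.length_map, ih, col_normalized, Finset.prod_range_succ, Finset.mul_sum]
    exact Finset.sum_congr rfl fun v _ => by ring

/-- The zero signature fills exactly the first `M` columns, so this is an `M × M` domain wall; the
normalizations of its vertices form the denominator. -/
theorem skewF_zero_zero {M : ℕ} {x : Fin M → ℂ} {y s : ℕ → ℂ} (r : Fin M → ℂ)
    (hx : ∀ i k, y k - x i ≠ 0) :
    skewF (Signature.zero M) (Signature.zero 0) x y r s =
      (∏ i : Fin M, x i * (r i ^ (-2 : ℤ) - 1)) *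
        ((∏ i : Fin M, ∏ j ∈ Finset.Ioi i,
            (r i ^ (-2 : ℤ) * x i - x j) * (s i ^ (-2 : ℤ) * y i - y j)) /
          ∏ i : Fin M, ∏ j : Fin M, (y i - x j)) := by
  rw [skewF_eq_strip _ _ hx (K := M) (by rw [Signature.finset_zero])
    (by rw [Signature.finset_zero]; simp), Signature.finset_zero, Signature.finset_zero]
  have h1 := strip_normalized (fun (i : Fin M) k => (y k - x i)⁻¹)
    (fun i => bareRow y (colParam y s) (x i, r i ^ (-2 : ℤ) * x i)) (List.finRange M)
    (ind (Finset.range M)) (ind (Finset.range 0)) (List.replicate M false) M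
    (List.replicate M true)
  rw [← List.ofFn_eq_map, ← List.ofFn_eq_map] at h1
  have h2 := domainWall_eq y (colParam y s) x (fun i => r i ^ (-2 : ℤ) * x i)
  rw [domainWall, List.length_ofFn, List.map_ofFn, strip_congr (A' := ind (Finset.range M))
    (B' := ind (Finset.range 0))] at h2
  · refine h1.trans ?_
    have h3 := h2
    simp only [Function.comp_def] at h3
    rw [h3]
    simp_rw [← List.ofFn_eq_map, List.prod_ofFn]
    rw [Finset.prod_range]
    simp only [Finset.prod_inv_distrib, Finset.prod_mul_distrib, colParam]
    have : ∀ i, r i ^ (-2 : ℤ) * x i - x i = x i * (r i ^ (-2 : ℤ) - 1) := fun i => by ring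
    simp only [this, Finset.prod_mul_distrib]
    rw [div_eq_inv_mul]
    ring
  · intro i hi
    simp [ind, hi]
  · intro i hi
    simp [ind]

end DomainWallLimit

/-! ### The Cauchy identity. -/

section Cauchy

theorem Signature.eq_of_finset_eq_empty {l : (n : ℕ) × Signature n} (h : l.2.finset = ∅) :
    l = ⟨0, Signature.zero 0⟩ :=
  Signature.finset_injective (by simp [h, Signature.finset_zero])

variable {M N : ℕ} {x : Fin M → ℂ} {w : Fin N → ℂ} {y s : ℕ → ℂ}

/-- The Cauchy identity. -/
theorem Admissible.cauchy (h : Admissible x w y s) (hM : 1 ≤ M) (hN : 1 ≤ N)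
    (r : Fin M → ℂ) (θ : Fin N → ℂ) :
    HasSum (fun nu : Signature M => G nu w y θ s * F nu x y r s)
      ((∏ i : Fin M, ∏ j : Fin N, (x i - θ j ^ (-2 : ℤ) * w j) / (x i - w j)) *
        skewF (Signature.zero M) (Signature.zero 0) x y r s) := by
  have h1 := h.skew_cauchy hM hN r θ (Signature.zero M) (Signature.zero 0)
  have e : ∑ᶠ ka : (n : ℕ) × Signature n, skewG (Signature.zero 0) ka.2 w y θ s *
      skewF (Signature.zero M) ka.2 x y r s =
      skewF (Signature.zero M) (Signature.zero 0) x y r s := by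
    -- `G` preserves the number of parts, so only the empty signature contributes, with `G = 1` from
    -- a strip without columns.
    rw [finsum_eq_single _ ⟨0, Signature.zero 0⟩]
    · rw [skewG_eq_strip _ _ h.ne_w (K := 0) (by rw [Signature.finset_zero])
        (by rw [Signature.finset_zero]), strip, if_pos rfl, one_mul]
    · intro ka hka
      by_contra hne
      have hc := card_eq_of_skewG_ne_zero h.ne_w (left_ne_zero_of_mul hne)
      refine hka (Signature.eq_of_finset_eq_empty ?_)
      rw [← Finset.card_eq_zero, ka.2.card_finset]
      exact hc.symm
  rw [e] at h1
  have hinj : Function.Injective fun nu : Signature M => (⟨M, nu⟩ : (n : ℕ) × Signature n) :=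
    sigma_mk_injective
  refine (hinj.hasSum_iff ?_).2 h1
  rintro ⟨n, nu⟩ hn
  by_contra hne
  obtain rfl := card_eq_of_skewG_ne_zero h.ne_w (left_ne_zero_of_mul hne)
  exact hn ⟨nu, rfl⟩

end Cauchy

end FreeFermionSixVertex

/-! ### Translating the hypotheses, and the theorem. -/

namespace FreeFermionSixVertex

theorem colParam_sub {y s : ℕ → ℂ} {k : ℕ} (hs : s k ≠ 0) (z : ℂ) :
    colParam y s k - z = s k ^ (-2 : ℤ) * (y k - s k ^ 2 * z) := by
  rw [colParam, mul_sub, ← mul_assoc, zpow_neg, zpow_ofNat, inv_mul_cancel₀ (pow_ne_zero 2 hs),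
    one_mul]

theorem Admissible.of_hypotheses {M N : ℕ} (hM : 1 ≤ M) (hN : 1 ≤ N) {x : Fin M → ℂ}
    {w : Fin N → ℂ} {y s : ℕ → ℂ} (hs : ∀ k, s k ≠ 0) (hyx : ∀ i k, y k - x i ≠ 0)
    (hyw : ∀ j k, y k - s k ^ 2 * w j ≠ 0)
    (hconv : ∃ δ : ℝ, 0 < δ ∧ ∀ (i : Fin M) (j : Fin N) (k : ℕ),
      ‖(y k - s k ^ 2 * x i) / (y k - x i) * ((y k - w j) / (y k - s k ^ 2 * w j))‖ < 1 - δ)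
    (hx_away : 2 ≤ M → ∀ i, ∃ ε : ℝ, 0 < ε ∧ ∀ k, ε ≤ ‖y k - x i‖)
    (hw_away : 2 ≤ N → ∀ j, ∃ ε : ℝ, 0 < ε ∧ ∀ k, ε ≤ ‖s k ^ (-2 : ℤ) * y k - w j‖) :
    Admissible x w y s where
  ne_x := hyx
  ne_w j k := by
    rw [colParam_sub (hs k)]
    exact mul_ne_zero (zpow_ne_zero _ (hs k)) (hyw j k)
  ratio := by
    obtain ⟨δ, hδ, h⟩ := hconv
    -- `1 - δ` exceeds a norm and is therefore nonnegative. Since `s⁻²y - z = s⁻²(y - s²z)`, both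
    -- sides of the ratio bound share the factor `‖s⁻²‖`.
    refine ⟨1 - δ, (norm_nonneg _).trans (h ⟨0, hM⟩ ⟨0, hN⟩ 0).le, by linarith, fun i j k => ?_⟩
    have h1 := (h i j k).le
    have p1 : 0 < ‖y k - x i‖ := norm_pos_iff.2 (hyx i k)
    have p2 : 0 < ‖y k - s k ^ 2 * w j‖ := norm_pos_iff.2 (hyw j k)
    rw [norm_mul, norm_div, norm_div, div_mul_div_comm, div_le_iff₀ (by positivity)] at h1
    rw [colParam_sub (hs k), colParam_sub (hs k), norm_mul, norm_mul]
    calc _ = ‖s k ^ (-2 : ℤ)‖ * (‖y k - s k ^ 2 * x i‖ * ‖y k - w j‖) := by ring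
      _ ≤ ‖s k ^ (-2 : ℤ)‖ * ((1 - δ) * (‖y k - x i‖ * ‖y k - s k ^ 2 * w j‖)) := by gcongr
      _ = _ := by ring
  x_away := hx_away
  w_away := hw_away

end FreeFermionSixVertex

theorem theorem3p6 (M N : ℕ) (hM : 1 ≤ M) (hN : 1 ≤ N)
    (x r : Fin M → ℂ) (w θ : Fin N → ℂ) (y s : ℕ → ℂ)
    (hs : ∀ k, s k ≠ 0) (hr : ∀ i, r i ≠ 0) (hθ : ∀ j, θ j ≠ 0)
    (hyx : ∀ i k, y k - x i ≠ 0) (hyw : ∀ j k, y k - s k ^ 2 * w j ≠ 0)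
    (hconv : ∃ δ : ℝ, 0 < δ ∧ ∀ (i : Fin M) (j : Fin N) (k : ℕ),
      ‖(y k - s k ^ 2 * x i) / (y k - x i) * ((y k - w j) / (y k - s k ^ 2 * w j))‖ < 1 - δ)
    (hx_away : 2 ≤ M → ∀ i, ∃ ε : ℝ, 0 < ε ∧ ∀ k, ε ≤ ‖y k - x i‖)
    (hw_away : 2 ≤ N → ∀ j, ∃ ε : ℝ, 0 < ε ∧ ∀ k, ε ≤ ‖s k ^ (-2 : ℤ) * y k - w j‖) :
    (∀ (a b : ℕ) (lam : FreeFermionSixVertex.Signature a) (mu : FreeFermionSixVertex.Signature b),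
      HasSum
        (fun nu : (n : ℕ) × FreeFermionSixVertex.Signature n =>
          FreeFermionSixVertex.skewG nu.2 lam w y θ s *
            FreeFermionSixVertex.skewF nu.2 mu x y r s)
        ((∏ i : Fin M, ∏ j : Fin N, (x i - θ j ^ (-2 : ℤ) * w j) / (x i - w j)) *
          ∑ᶠ ka : (n : ℕ) × FreeFermionSixVertex.Signature n,
            FreeFermionSixVertex.skewG mu ka.2 w y θ s *
              FreeFermionSixVertex.skewF lam ka.2 x y r s)) ∧
    HasSum
      (fun nu : FreeFermionSixVertex.Signature M =>
        FreeFermionSixVertex.G nu w y θ s * FreeFermionSixVertex.F nu x y r s)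
      ((∏ i : Fin M, x i * (r i ^ (-2 : ℤ) - 1)) *
        ((∏ i : Fin M, ∏ j ∈ Finset.Ioi i,
            (r i ^ (-2 : ℤ) * x i - x j) * (s i ^ (-2 : ℤ) * y i - y j)) /
          ∏ i : Fin M, ∏ j : Fin M, (y i - x j)) *
        ∏ i : Fin M, ∏ j : Fin N, (x i - θ j ^ (-2 : ℤ) * w j) / (x i - w j)) := by
  have h := FreeFermionSixVertex.Admissible.of_hypotheses hM hN hs hyx hyw hconv hx_away hw_away
  refine ⟨fun a b lam mu => h.skew_cauchy hM hN r θ lam mu, ?_⟩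
  have h2 := h.cauchy hM hN r θ
  rwa [FreeFermionSixVertex.skewF_zero_zero r hyx, mul_comm] at h2
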